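/- Let $\pi:Z\to M$ be a smooth principal circle bundle over a manifold, with circle coordinate $\theta\in\mathbb R/\mathbb Z$ on the fibres. Put $v=\frac1{2\pi i}\partial_\theta$ (a complex vector field), and let $A$ be an invariant $i\mathbb R$-valued connection form, so $A(v)=1$ and $A=2\pi i\,d\theta+\pi^*A_\sigma$, $A_\sigma=\sigma^*A$, in the trivialization given by a local section $\sigma$ of $\pi$. Let $H$ be an invariant closed real 3-form on $Z$, and let $h_A$ denote the horizontal lift. All sections and functions are smooth and complex valued. *Over $Z$.* $TZ\oplus T^*Z$ carries the $H$-twisted Dorfman bracket $[x+\alpha,y+\beta]_H=[x,y]+\mathcal L_x\beta-\iota_yd\alpha+\iota_x\iota_yH$, the pairing $\langle x+\alpha,y+\beta\rangle=\alpha(y)+\beta(x)$ and the anchor $\rho(x+\alpha)=x$. Let $\Gamma_n(Z)=\{a\in\Gamma(Z,TZ\oplus T^*Z):\mathcal L_va=na\}$. *Over $M$.* Let $L=Z\times_{S^1}\mathbb C$ be the line bundle associated with the standard representation, $s_\sigma=[\sigma,1]$ its local frames, $\nabla s_\sigma=A_\sigma\otimes s_\sigma$ the induced connection, $E=TM\oplus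 1\oplus T^*M\oplus 1$ (complexified) and $E_n=E\otimes L^{\otimes n}$. In this statement $\bigoplus_n\Gamma(M,E_n)$ and $\bigoplus_n\Gamma(M,L^{\otimes n})$ denote the Fréchet completions of the direct sums: the families $(c_n)_{n\in\mathbb Z}$ of sections whose coefficients in the frames $s_\sigma^{\otimes n}$ decrease faster than any power of $|n|$, together with all derivatives in local coordinates, uniformly on compact sets. Let $$\psi\big((X,f,\xi,g)\otimes s_\sigma^{\otimes n}\big)=(h_A(X)+fv+\pi^*\xi+gA)\otimes\pi^*s_\sigma^{\otimes n}$$ identify $\Gamma(M,E_n)$ with the invariant sections of $(TZ\oplus T^*Z)\otimes\pi^*L^{\otimes n}$. The exotic structure is the following. - $D h=\nabla h-nAh$ for $h\in\Gamma(M,L^{\otimes n})$; thus on $Z$, $D s_\sigma^{\otimes n}=n\tau_\sigma\otimes s_\sigma^{\otimes n}$ with $\tau_\sigma=\pi^*A_\sigma-A$. - The bracket $\Gamma(E_n)\times\Gamma(E_m)\to\Gamma(E_{n+m})$ is the $H$-twisted derived bracket of $D$, transported by $\psi$: the bracket of $(x+\alpha)\otimes s_\sigma^{\otimes n}$ and $(y+\beta)\otimes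 s_\sigma^{\otimes m}$ (with $x+\alpha$, $y+\beta$ invariant) is $s_\sigma^{\otimes(n+m)}$ with the coefficient, where $\tau=\tau_\sigma$, $$[x,y]+m\tau(x)y-n\tau(y)x+\iota_x(d\beta+m\,\tau\wedge\beta)+\big(d+(n+m)\tau\big)(\beta(x))-\iota_y(d\alpha+n\,\tau\wedge\alpha)+\iota_x\iota_yH .$$ - The pairing is $\langle(X,f,\xi,g)\otimes s_1,(Y,\tilde f,\eta,\tilde g)\otimes s_2\rangle=(\eta(X)+\xi(Y)+g\tilde f+f\tilde g)\,s_1s_2\in\Gamma(L^{\otimes(n+m)})$. - The anchor is defined by $\rho(a)h=\langle a,Dh\rangle$; that is, $\rho\big((X,f,\xi,g)\otimes s\big)=(X,f)\otimes s\in(TM\oplus1)\otimes L^{\otimes n}$ with $\big((X,f)\otimes s\big)h=(\nabla_Xh-mfh)\,s$ for $h\in\Gamma(L^{\otimes m})$. On the completions, these operations are extended by convergent sums over the weights. **Proposition.** There are $\mathbb C$-linear bijections $$\phi':\Gamma(Z,TZ\oplus T^*Z)\to\bigoplus_{n}\Gamma(M,E_n),\qquad \phi'':C^\infty(Z)\to\bigoplus_{n}\Gamma(M,L^{\otimes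 n}),$$ given by the fibrewise Fourier expansion: if $\phi'(a)_n=(X_n,f_n,\xi_n,g_n)\otimes s_\sigma^{\otimes n}$ and $\phi''(F)_n=F_n\,s_\sigma^{\otimes n}$ locally, then $$a=\sum_{n\in\mathbb Z}e^{-2\pi in\theta}\big(h_A(X_n)+f_nv+\pi^*\xi_n+g_nA\big),\qquad F=\sum_{n\in\mathbb Z}e^{-2\pi in\theta}\,\pi^*F_n .$$ For every $n$, they restrict to bijections of $\Gamma_{-n}(Z)$ onto $\Gamma(M,E_n)$ and of $\{F: vF=-nF\}$ onto $\Gamma(M,L^{\otimes n})$, and an element has weight $-n$ if and only if only its $n$-th component is nonzero or all components vanish. They intertwine the two structures: for all $a,b\in\Gamma(Z,TZ\oplus T^*Z)$ and $F\in C^\infty(Z)$, $$[\phi'(a),\phi'(b)]_H=\phi'([a,b]_H),\quad \langle\phi'(a),\phi'(b)\rangle=\phi''(\langle a,b\rangle),\quad \rho(\phi'(a))=\phi'(\rho(a)),\quad \rho(\phi'(a))\,\phi''(F)=\phi''(\rho(a)F).$$ -/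

import Mathlib

open scoped Manifold ContDiff

noncomputable section

namespace ExoticCourant

/-! ### Complexification of a real vector space -/

/-- The complexification `V ⊗_ℝ ℂ = V ⊕ iV` of a real vector space; `(x, y)` stands for `x + iy`. -/
def Cplx (V : Type*) : Type _ := V × V

namespace Cplx

variable {V W F : Type*}

instance [AddCommGroup V] : AddCommGroup (Cplx V) := inferInstanceAs (AddCommGroup (V × V))

instance [TopologicalSpace V] : TopologicalSpace (Cplx V) :=
  inferInstanceAs (TopologicalSpace (V × V))

instance [AddCommGroup V] [Module ℝ V] : SMul ℂ (Cplx V) :=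
  ⟨fun c u => (c.re • u.1 - c.im • u.2, c.re • u.2 + c.im • u.1)⟩

/-- Real part. -/
def re (u : Cplx V) : V := u.1

/-- Imaginary part. -/
def im (u : Cplx V) : V := u.2

/-- The complex vector `x + iy`. -/
def mk (x y : V) : Cplx V := (x, y)

theorem ext' {u w : Cplx V} (h₁ : u.re = w.re) (h₂ : u.im = w.im) : u = w := Prod.ext h₁ h₂

@[simp] theorem re_mk (x y : V) : (mk x y).re = x := rfl
@[simp] theorem im_mk (x y : V) : (mk x y).im = y := rfl

section
variable [AddCommGroup V]
@[simp] theorem re_add (u w : Cplx V) : (u + w).re = u.re + w.re := rfl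
@[simp] theorem im_add (u w : Cplx V) : (u + w).im = u.im + w.im := rfl
@[simp] theorem re_zero : (0 : Cplx V).re = 0 := rfl
@[simp] theorem im_zero : (0 : Cplx V).im = 0 := rfl
variable [Module ℝ V]
@[simp] theorem re_smul (c : ℂ) (u : Cplx V) : (c • u).re = c.re • u.re - c.im • u.im := rfl
@[simp] theorem im_smul (c : ℂ) (u : Cplx V) : (c • u).im = c.re • u.im + c.im • u.re := rfl
end

instance [AddCommGroup V] [Module ℝ V] : Module ℂ (Cplx V) where
  one_smul u := by apply ext' <;> simp
  mul_smul c d u := by apply ext' <;> simp <;> module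
  smul_zero c := by apply ext' <;> simp
  smul_add c u w := by apply ext' <;> simp <;> module
  add_smul c d u := by apply ext' <;> simp <;> module
  zero_smul u := by apply ext' <;> simp

variable [AddCommGroup V] [Module ℝ V] [TopologicalSpace V]
  [AddCommGroup W] [Module ℝ W] [TopologicalSpace W]

/-- Complex-linear extension of a real-linear map `V → W`. -/
def map (T : V →L[ℝ] W) (u : Cplx V) : Cplx W := mk (T u.re) (T u.im)

/-- The value `α(x + iy) = α(x) + iα(y)` of a complex covector on a complex vector. -/
def eval (α : V →L[ℝ] ℂ) (u : Cplx V) : ℂ := α u.re + Complex.I * α u.im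

/-- The contraction `η(u, ·)` of a complex 2-form with a complex vector. -/
def contract₂ (η : V [⋀^Fin 2]→L[ℝ] ℂ) (u : Cplx V) : V →L[ℝ] ℂ :=
  η.toContinuousLinearMap ![u.re, 0] 1 + Complex.I • η.toContinuousLinearMap ![u.im, 0] 1

/-- The contraction `H(u, w, ·)` of a real 3-form with two real vectors, as a complex covector. -/
def contractReal (H : V [⋀^Fin 3]→L[ℝ] ℝ) (u w : V) : V →L[ℝ] ℂ :=
  Complex.ofRealCLM ∘L H.toContinuousLinearMap ![u, w, 0] 2

/-- The contraction `H(u, w, ·) = ι_w ι_u H` of a real 3-form with two complex vectors. -/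
def contract₃ (H : V [⋀^Fin 3]→L[ℝ] ℝ) (u w : Cplx V) : V →L[ℝ] ℂ :=
  (contractReal H u.re w.re - contractReal H u.im w.im)
    + Complex.I • (contractReal H u.re w.im + contractReal H u.im w.re)

end Cplx

/-! ### Calculus on a manifold `N` modelled on `E` -/

section Calculus

variable {E : Type*} [NormedAddCommGroup E] [NormedSpace ℝ E]
  {N : Type*} [TopologicalSpace N] [ChartedSpace E N]

variable (E) in
/-- The complexified generalized tangent space `(T_pN ⊕ T_p^*N) ⊗ ℂ`. -/
abbrev GTan (p : N) : Type _ :=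
  Cplx (TangentSpace 𝓘(ℝ, E) p) × (TangentSpace 𝓘(ℝ, E) p →L[ℝ] ℂ)

/-- Smoothness on `U` of a real vector field. -/
def SmoothVecOn (x : ∀ p : N, TangentSpace 𝓘(ℝ, E) p) (U : Set N) [IsManifold 𝓘(ℝ, E) ∞ N] : Prop :=
  ContMDiffOn 𝓘(ℝ, E) (𝓘(ℝ, E).prod 𝓘(ℝ, E)) ∞
    (fun p => (⟨p, x p⟩ : Bundle.TotalSpace E (TangentSpace 𝓘(ℝ, E) : N → Type _))) U

/-- Smoothness on `U` of a 1-form with values in `F`. -/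
def SmoothFormOn {F : Type*} [NormedAddCommGroup F] [NormedSpace ℝ F] [IsManifold 𝓘(ℝ, E) ∞ N]
    (α : ∀ p : N, TangentSpace 𝓘(ℝ, E) p →L[ℝ] F) (U : Set N) : Prop :=
  ContMDiffOn 𝓘(ℝ, E) (𝓘(ℝ, E).prod 𝓘(ℝ, E →L[ℝ] F)) ∞
    (fun p => (⟨p, α p⟩ : Bundle.TotalSpace (E →L[ℝ] F)
      (fun p : N => TangentSpace 𝓘(ℝ, E) p →L[ℝ] Bundle.Trivial N F p))) U

/-- Smoothness on `U` of a complex vector field. -/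
def SmoothCVecOn [IsManifold 𝓘(ℝ, E) ∞ N]
    (x : ∀ p : N, Cplx (TangentSpace 𝓘(ℝ, E) p)) (U : Set N) : Prop :=
  SmoothVecOn (fun p => (x p).re) U ∧ SmoothVecOn (fun p => (x p).im) U

/-- The coordinate expression of a `k`-form in the chart around `p₀`. -/
def chartForm {k : ℕ} {F : Type*} [NormedAddCommGroup F] [NormedSpace ℝ F] (p₀ : N)
    (θ : ∀ p : N, TangentSpace 𝓘(ℝ, E) p [⋀^Fin k]→L[ℝ] F) (u : E) : E [⋀^Fin k]→L[ℝ] F :=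
  (θ ((extChartAt 𝓘(ℝ, E) p₀).symm u)).compContinuousLinearMap
    (mfderiv 𝓘(ℝ, E) 𝓘(ℝ, E) (extChartAt 𝓘(ℝ, E) p₀).symm u : E →L[ℝ] _)

/-- The exterior derivative of a `k`-form on a manifold, computed in a chart. -/
def extD {k : ℕ} {F : Type*} [NormedAddCommGroup F] [NormedSpace ℝ F]
    (θ : ∀ p : N, TangentSpace 𝓘(ℝ, E) p [⋀^Fin k]→L[ℝ] F) (p : N) :
    TangentSpace 𝓘(ℝ, E) p [⋀^Fin (k + 1)]→L[ℝ] F :=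
  (extDeriv (chartForm p θ) (extChartAt 𝓘(ℝ, E) p p)).compContinuousLinearMap
    (mfderiv 𝓘(ℝ, E) 𝓘(ℝ, E) (extChartAt 𝓘(ℝ, E) p) p : TangentSpace 𝓘(ℝ, E) p →L[ℝ] E)

/-- The exterior derivative of a complex 1-form. -/
def dForm (α : ∀ p : N, TangentSpace 𝓘(ℝ, E) p →L[ℝ] ℂ) (p : N) :
    TangentSpace 𝓘(ℝ, E) p [⋀^Fin 2]→L[ℝ] ℂ :=
  extD (fun q => ContinuousAlternatingMap.ofSubsingleton ℝ _ ℂ (0 : Fin 1) (α q)) p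

/-- The differential of a complex function. -/
def dFun (f : N → ℂ) (p : N) : TangentSpace 𝓘(ℝ, E) p →L[ℝ] ℂ :=
  mvfderiv 𝓘(ℝ, E) f p

/-- The Lie bracket of vector fields, extended complex-bilinearly. -/
def lieC (x y : ∀ p : N, Cplx (TangentSpace 𝓘(ℝ, E) p)) (p : N) :
    Cplx (TangentSpace 𝓘(ℝ, E) p) :=
  let L := fun (u w : ∀ q : N, TangentSpace 𝓘(ℝ, E) q) =>
    VectorField.mlieBracket 𝓘(ℝ, E) u w p
  Cplx.mk
    (L (fun q => (x q).re) (fun q => (y q).re) - L (fun q => (x q).im) (fun q => (y q).im))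
    (L (fun q => (x q).re) (fun q => (y q).im) + L (fun q => (x q).im) (fun q => (y q).re))

/-- The Lie derivative `L_x β = ι_x dβ + d(ι_x β)` of a 1-form. -/
def lieForm (x : ∀ p : N, Cplx (TangentSpace 𝓘(ℝ, E) p))
    (β : ∀ p : N, TangentSpace 𝓘(ℝ, E) p →L[ℝ] ℂ) (p : N) : TangentSpace 𝓘(ℝ, E) p →L[ℝ] ℂ :=
  Cplx.contract₂ (dForm β p) (x p) + dFun (fun q => Cplx.eval (β q) (x q)) p

/-- The Lie derivative of a section of `(TN ⊕ T^*N) ⊗ ℂ` along a complex vector field. -/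
def lieG (x : ∀ p : N, Cplx (TangentSpace 𝓘(ℝ, E) p)) (b : ∀ p : N, GTan E p) (p : N) :
    GTan E p :=
  (lieC x (fun q => (b q).1) p, lieForm x (fun q => (b q).2) p)

/-- The `H`-twisted Dorfman bracket
`[x + α, y + β]_H = [x, y] + L_x β - ι_y dα + ι_x ι_y H`. -/
def dorfman (H : ∀ p : N, TangentSpace 𝓘(ℝ, E) p [⋀^Fin 3]→L[ℝ] ℝ)
    (a b : ∀ p : N, GTan E p) (p : N) : GTan E p :=
  (lieC (fun q => (a q).1) (fun q => (b q).1) p,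
    lieForm (fun q => (a q).1) (fun q => (b q).2) p
      - Cplx.contract₂ (dForm (fun q => (a q).2) p) (b p).1
      + Cplx.contract₃ (H p) (b p).1 (a p).1)

/-- The pairing `⟨x + α, y + β⟩ = α(y) + β(x)`. -/
def pairing {p : N} (a b : GTan E p) : ℂ := Cplx.eval a.2 b.1 + Cplx.eval b.2 a.1

/-- The anchor `ρ(x + α) = x`. -/
def anchor {p : N} (a : GTan E p) : Cplx (TangentSpace 𝓘(ℝ, E) p) := a.1

/-! A line bundle with a nowhere vanishing local section `s` whose powers satisfy
`D s^k = k τ ⊗ s^k` for a 1-form `τ` has the following differential calculus for sections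
`f ⊗ s^k`, `α ⊗ s^k`, in terms of the coefficients `f`, `α`. -/

/-- `D(f ⊗ s^k) = (df + k f τ) ⊗ s^k`. -/
def covFun (τ : ∀ p : N, TangentSpace 𝓘(ℝ, E) p →L[ℝ] ℂ) (k : ℤ) (f : N → ℂ) (p : N) :
    TangentSpace 𝓘(ℝ, E) p →L[ℝ] ℂ :=
  dFun f p + ((k : ℂ) * f p) • τ p

/-- `ι_x D(α ⊗ s^k) = ι_x (dα + k τ ∧ α) ⊗ s^k`. -/
def contractCovForm (τ : ∀ p : N, TangentSpace 𝓘(ℝ, E) p →L[ℝ] ℂ) (k : ℤ)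
    (α : ∀ p : N, TangentSpace 𝓘(ℝ, E) p →L[ℝ] ℂ) (p : N) (x : Cplx (TangentSpace 𝓘(ℝ, E) p)) :
    TangentSpace 𝓘(ℝ, E) p →L[ℝ] ℂ :=
  Cplx.contract₂ (dForm α p) x
    + (k : ℂ) • (Cplx.eval (τ p) x • α p - Cplx.eval (α p) x • τ p)

/-- The coefficient of `s^{n+m}` in the `H`-twisted derived bracket
`[[D + H, (x + α) ⊗ s^n], (y + β) ⊗ s^m]` of the differential `D`, where `x + α` acts on forms by
`ι_x + α ∧`. Since `[[D, ι_x], ι_y]` is contraction with the bracket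
`[x ⊗ s^n, y ⊗ s^m] = ([x, y] + m τ(x) y - n τ(y) x) ⊗ s^{n+m}` of vector fields with coefficients
and `[D, ι_x] = D ι_x + ι_x D`, this is
`[x ⊗ s^n, y ⊗ s^m] + (ι_x D + D ι_x)(β ⊗ s^m) - ι_y D(α ⊗ s^n) + ι_x ι_y H ⊗ s^{n+m}`. -/
def derivedBracket (H : ∀ p : N, TangentSpace 𝓘(ℝ, E) p [⋀^Fin 3]→L[ℝ] ℝ)
    (τ : ∀ p : N, TangentSpace 𝓘(ℝ, E) p →L[ℝ] ℂ) (n m : ℤ)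
    (a b : ∀ p : N, GTan E p) (p : N) : GTan E p :=
  (lieC (fun q => (a q).1) (fun q => (b q).1) p
      + ((m : ℂ) * Cplx.eval (τ p) (a p).1) • (b p).1
      - ((n : ℂ) * Cplx.eval (τ p) (b p).1) • (a p).1,
    contractCovForm τ m (fun q => (b q).2) p (a p).1
      + covFun τ (n + m) (fun q => Cplx.eval (b q).2 (a q).1) p
      - contractCovForm τ n (fun q => (a q).2) p (b p).1
      + Cplx.contract₃ (H p) (b p).1 (a p).1)

/-- Given a family `(s_n)` of sections over `U` of a vector bundle, `s_n → 0` faster than any power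
of `n`, together with all derivatives in local coordinates, uniformly on compact sets. -/
def RapidlyDecreasingOn {F : Type*} [NormedAddCommGroup F] [NormedSpace ℝ F]
    (V : N → Type*) [TopologicalSpace (Bundle.TotalSpace F V)] [∀ p, TopologicalSpace (V p)]
    [FiberBundle F V] (s : ℤ → ∀ p : N, V p) (U : Set N) : Prop :=
  ∀ (p₀ : N) (K : Set N), IsCompact K → K ⊆ U → K ⊆ (chartAt E p₀).source → ∀ r l : ℕ,
    ∃ C : ℝ, ∀ (n : ℤ), ∀ p ∈ K,
      (1 + |(n : ℝ)|) ^ l *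
        ‖iteratedFDeriv ℝ r
          (fun u : E => (trivializationAt F V p₀
            ⟨(extChartAt 𝓘(ℝ, E) p₀).symm u, s n ((extChartAt 𝓘(ℝ, E) p₀).symm u)⟩).2)
          (extChartAt 𝓘(ℝ, E) p₀ p)‖ ≤ C

theorem contMDiffOn_const_mul (c : ℂ) {f : N → ℂ} {U : Set N}
    (h : ContMDiffOn 𝓘(ℝ, E) 𝓘(ℝ, ℂ) ∞ f U) :
    ContMDiffOn 𝓘(ℝ, E) 𝓘(ℝ, ℂ) ∞ (fun p => c • f p) U := by
  have h2 : ContMDiff 𝓘(ℝ, ℂ) 𝓘(ℝ, ℂ) ∞ (fun z : ℂ => c • z) := (contDiff_const_smul c).contMDiff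
  exact h2.comp_contMDiffOn h

theorem SmoothVecOn.smulConst [IsManifold 𝓘(ℝ, E) ∞ N]
    {x : ∀ p : N, TangentSpace 𝓘(ℝ, E) p} {U : Set N} (h : SmoothVecOn x U) (c : ℝ) :
    SmoothVecOn (fun p => c • x p) U :=
  ContMDiffOn.const_smul_section h

theorem SmoothVecOn.add [IsManifold 𝓘(ℝ, E) ∞ N]
    {x y : ∀ p : N, TangentSpace 𝓘(ℝ, E) p} {U : Set N} (h : SmoothVecOn x U)
    (h' : SmoothVecOn y U) : SmoothVecOn (fun p => x p + y p) U :=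
  ContMDiffOn.add_section h h'

theorem SmoothVecOn.zero [IsManifold 𝓘(ℝ, E) ∞ N] (U : Set N) :
    SmoothVecOn (fun p : N => (0 : TangentSpace 𝓘(ℝ, E) p)) U :=
  (Bundle.contMDiff_zeroSection ℝ (TangentSpace 𝓘(ℝ, E) : N → Type _)).contMDiffOn

theorem SmoothFormOn.add [IsManifold 𝓘(ℝ, E) ∞ N]
    {α β : ∀ p : N, TangentSpace 𝓘(ℝ, E) p →L[ℝ] ℂ} {U : Set N} (h : SmoothFormOn α U)
    (h' : SmoothFormOn β U) : SmoothFormOn (fun p => α p + β p) U :=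
  ContMDiffOn.add_section h h'

theorem SmoothFormOn.zero [IsManifold 𝓘(ℝ, E) ∞ N] (U : Set N) :
    SmoothFormOn (fun p : N => (0 : TangentSpace 𝓘(ℝ, E) p →L[ℝ] ℂ)) U :=
  (Bundle.contMDiff_zeroSection ℝ
    (fun p : N => TangentSpace 𝓘(ℝ, E) p →L[ℝ] Bundle.Trivial N ℂ p)).contMDiffOn

theorem SmoothFormOn.smulConst [IsManifold 𝓘(ℝ, E) ∞ N]
    {α : ∀ p : N, TangentSpace 𝓘(ℝ, E) p →L[ℝ] ℂ} {U : Set N} (h : SmoothFormOn α U) (c : ℂ) :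
    SmoothFormOn (fun p => c • α p) U := by
  intro p hp
  have h1 := h p hp
  rw [contMDiffWithinAt_hom_bundle] at h1 ⊢
  refine ⟨h1.1, ?_⟩
  have h2 : ContMDiff 𝓘(ℝ, E →L[ℝ] ℂ) 𝓘(ℝ, E →L[ℝ] ℂ) ∞ (fun T : E →L[ℝ] ℂ => c • T) :=
    (contDiff_const_smul c).contMDiff
  convert! h2.contMDiffAt.comp_contMDiffWithinAt p h1.2 using 1
  ext q u
  simp [ContinuousLinearMap.inCoordinates]

theorem SmoothCVecOn.zero [IsManifold 𝓘(ℝ, E) ∞ N] (U : Set N) :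
    SmoothCVecOn (fun p : N => (0 : Cplx (TangentSpace 𝓘(ℝ, E) p))) U :=
  ⟨SmoothVecOn.zero U, SmoothVecOn.zero U⟩

theorem SmoothCVecOn.add [IsManifold 𝓘(ℝ, E) ∞ N]
    {x y : ∀ p : N, Cplx (TangentSpace 𝓘(ℝ, E) p)} {U : Set N} (h : SmoothCVecOn x U)
    (h' : SmoothCVecOn y U) : SmoothCVecOn (fun p => x p + y p) U :=
  ⟨SmoothVecOn.add h.1 h'.1, SmoothVecOn.add h.2 h'.2⟩

theorem SmoothCVecOn.smulConst [IsManifold 𝓘(ℝ, E) ∞ N]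
    {x : ∀ p : N, Cplx (TangentSpace 𝓘(ℝ, E) p)} {U : Set N} (h : SmoothCVecOn x U) (c : ℂ) :
    SmoothCVecOn (fun p => c • x p) U := by
  refine ⟨?_, ?_⟩
  · simp only [Cplx.re_smul, sub_eq_add_neg, ← neg_smul]
    exact (h.1.smulConst _).add (h.2.smulConst _)
  · simp only [Cplx.im_smul]
    exact (h.2.smulConst _).add (h.1.smulConst _)

end Calculus

/-! ### Principal circle bundles -/

section Bundle

variable (EM M EZ Z : Type*)
  [NormedAddCommGroup EM] [NormedSpace ℝ EM] [TopologicalSpace M] [ChartedSpace EM M]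
  [NormedAddCommGroup EZ] [NormedSpace ℝ EZ] [TopologicalSpace Z] [ChartedSpace EZ Z]
  [MulAction Circle Z]

/-- A smooth principal circle bundle `π : Z → M`: a smooth fibre-preserving action of the circle
on `Z` with equivariant local trivializations `p ↦ (π p, θ p)`, `(x, z) ↦ z • σ x`. -/
structure PrincipalCircleBundle where
  /-- The projection. -/
  proj : Z → M
  contMDiff_proj : ContMDiff 𝓘(ℝ, EZ) 𝓘(ℝ, EM) ∞ proj
  contMDiff_smul : ContMDiff ((𝓡 1).prod 𝓘(ℝ, EZ)) 𝓘(ℝ, EZ) ∞ (fun q : Circle × Z => q.1 • q.2)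
  proj_smul : ∀ (z : Circle) (p : Z), proj (z • p) = proj p
  locally_trivial : ∀ x : M, ∃ (U : Set M) (σ : M → Z) (θ : Z → Circle), IsOpen U ∧ x ∈ U ∧
    ContMDiffOn 𝓘(ℝ, EM) 𝓘(ℝ, EZ) ∞ σ U ∧
    ContMDiffOn 𝓘(ℝ, EZ) (𝓡 1) ∞ θ (proj ⁻¹' U) ∧
    (∀ y ∈ U, proj (σ y) = y) ∧
    (∀ y ∈ U, ∀ z : Circle, θ (z • σ y) = z) ∧
    (∀ p ∈ proj ⁻¹' U, θ p • σ (proj p) = p)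

variable {EM M EZ Z}

variable (EZ) in
/-- The real vector field generating the action, `d/dt (e^{it} • p)` at `t = 0`. -/
def generator (p : Z) : TangentSpace 𝓘(ℝ, EZ) p :=
  (mfderiv 𝓘(ℝ, ℝ) 𝓘(ℝ, EZ) (fun t : ℝ => Circle.exp t • p) 0 : ℝ →L[ℝ] EZ) (1 : ℝ)

variable (EZ) in
/-- The complex vector field `v = -i d/dt = (2πi)⁻¹ ∂/∂θ`, where `t = 2πθ`. -/
def vertical (p : Z) : Cplx (TangentSpace 𝓘(ℝ, EZ) p) := Cplx.mk 0 (-generator EZ p)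

variable (EZ Z) in
/-- A connection on `Z`: a smooth invariant real 1-form `a` with `a(d/dt) = 1`. The connection form
with values in `iℝ = Lie(S¹)` is `A = i a`. -/
structure Connection [IsManifold 𝓘(ℝ, EZ) ∞ Z] where
  /-- The 1-form `a`. -/
  form : ∀ p : Z, TangentSpace 𝓘(ℝ, EZ) p →L[ℝ] ℝ
  smooth : SmoothFormOn form Set.univ
  invariant : ∀ (z : Circle) (p : Z),
    form (z • p) ∘L mfderiv 𝓘(ℝ, EZ) 𝓘(ℝ, EZ) (fun q : Z => z • q) p = form p
  normalized : ∀ p : Z, form p (generator EZ p) = 1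

/-- The connection form `A = i a`, which satisfies `A(v) = 1`. -/
def Connection.complexForm [IsManifold 𝓘(ℝ, EZ) ∞ Z] (A : Connection EZ Z) (p : Z) :
    TangentSpace 𝓘(ℝ, EZ) p →L[ℝ] ℂ :=
  Complex.I • (Complex.ofRealCLM ∘L A.form p)

variable (EZ Z) in
/-- An invariant closed smooth 3-form on `Z`. -/
structure Flux where
  /-- The 3-form `H`. -/
  form : ∀ p : Z, TangentSpace 𝓘(ℝ, EZ) p [⋀^Fin 3]→L[ℝ] ℝ
  smooth : ∀ p₀ : Z, ContDiffOn ℝ ∞ (chartForm p₀ form) (extChartAt 𝓘(ℝ, EZ) p₀).target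
  invariant : ∀ (z : Circle) (p : Z),
    (form (z • p)).compContinuousLinearMap
      (mfderiv 𝓘(ℝ, EZ) 𝓘(ℝ, EZ) (fun q : Z => z • q) p) = form p
  closed : ∀ p : Z, extD form p = 0

namespace PrincipalCircleBundle

variable (B : PrincipalCircleBundle EM M EZ Z)

/-! #### The associated line bundles over `M` -/

/-- For a family of complex vector spaces `V_x`, `x ∈ M`, the space `V_x ⊗ L_x^{⊗n}`, where
`L = Z ×_{S¹} ℂ` is the line bundle associated with the standard representation of the circle.
An element is a function on the fibre `Z_x` with `u(z • p) = z^{-n} u(p)`: given `p ∈ Z_x`,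
it is the element `u(p) ⊗ [p, 1]^{⊗n}`, where `[z • p, 1] = z [p, 1]` in `L_x`. -/
def TensorL (n : ℤ) (V : M → Type*) [∀ x, AddCommGroup (V x)] [∀ x, Module ℂ (V x)] (x : M) :
    Submodule ℂ ({p : Z // B.proj p = x} → V x) where
  carrier := {u | ∀ (z : Circle) (p : {p : Z // B.proj p = x}),
    u ⟨z • p.1, (B.proj_smul z p.1).trans p.2⟩ = ((z : ℂ) ^ (-n)) • u p}
  zero_mem' := by intro z p; simp
  add_mem' := by intro u w hu hw z p; simp [hu z p, hw z p]
  smul_mem' := by intro c u hu z p; simp [hu z p, smul_comm c]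

/-- The fibre of `E = TM ⊕ 1 ⊕ T^*M ⊕ 1`, complexified, with elements `(X, f, ξ, g)`. -/
abbrev EFib (EM : Type*) {M : Type*} [NormedAddCommGroup EM] [NormedSpace ℝ EM]
    [TopologicalSpace M] [ChartedSpace EM M] (x : M) : Type _ :=
  Cplx (TangentSpace 𝓘(ℝ, EM) x) × ℂ × (TangentSpace 𝓘(ℝ, EM) x →L[ℝ] ℂ) × ℂ

/-- The pairing `⟨(X, f, ξ, g), (Y, f', η, g')⟩ = η(X) + ξ(Y) + g f' + f g'` on `E`. -/
def pairingE {x : M} (a b : EFib EM x) : ℂ :=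
  Cplx.eval b.2.2.1 a.1 + Cplx.eval a.2.2.1 b.1 + a.2.2.2 * b.2.1 + a.2.1 * b.2.2.2

/-- A smooth local section of `π` over the open set `U`. -/
structure IsLocalSection (σ : M → Z) (U : Set M) : Prop where
  isOpen : IsOpen U
  smooth : ContMDiffOn 𝓘(ℝ, EM) 𝓘(ℝ, EZ) ∞ σ U
  proj_eq : ∀ x ∈ U, B.proj (σ x) = x

open Classical in
/-- The coefficient `c_σ` of a section `c = c_σ ⊗ s_σ^{⊗n}` of `V ⊗ L^{⊗n}` with respect to the
frame `s_σ = [σ, 1]` of `L` given by a local section `σ` of `π`. -/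
def coeff {n : ℤ} {V : M → Type*} [∀ x, AddCommGroup (V x)] [∀ x, Module ℂ (V x)]
    (c : ∀ x, B.TensorL n V x) (σ : M → Z) (x : M) : V x :=
  if h : B.proj (σ x) = x then (c x).1 ⟨σ x, h⟩ else 0

section
variable {n : ℤ} {V : M → Type*} [∀ x, AddCommGroup (V x)] [∀ x, Module ℂ (V x)]

theorem coeff_add (c d : ∀ x, B.TensorL n V x) (σ : M → Z) (x : M) :
    B.coeff (c + d) σ x = B.coeff c σ x + B.coeff d σ x := by
  unfold coeff; split <;> simp

theorem coeff_smul (k : ℂ) (c : ∀ x, B.TensorL n V x) (σ : M → Z) (x : M) :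
    B.coeff (k • c) σ x = k • B.coeff c σ x := by
  unfold coeff; split <;> simp

theorem coeff_zero (σ : M → Z) (x : M) :
    B.coeff (0 : ∀ x, B.TensorL n V x) σ x = 0 := by
  unfold coeff; split <;> simp

end

variable [IsManifold 𝓘(ℝ, EM) ∞ M] [IsManifold 𝓘(ℝ, EZ) ∞ Z]

/-- The space `Γ(M, L^{⊗n})` of smooth sections. -/
def LSection (n : ℤ) : Submodule ℂ (∀ x : M, B.TensorL n (fun _ : M => ℂ) x) where
  carrier := {h | ∀ (σ : M → Z) (U : Set M), B.IsLocalSection σ U →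
    ContMDiffOn 𝓘(ℝ, EM) 𝓘(ℝ, ℂ) ∞ (B.coeff h σ) U}
  zero_mem' := by
    intro σ U _
    exact (contMDiffOn_const (c := (0 : ℂ))).congr fun x _ => B.coeff_zero σ x
  add_mem' := by
    intro h k hh hk σ U hσ
    exact ((hh σ U hσ).add (hk σ U hσ)).congr fun x _ => B.coeff_add h k σ x
  smul_mem' := by
    intro c h hh σ U hσ
    exact (contMDiffOn_const_mul c (hh σ U hσ)).congr fun x _ => B.coeff_smul c h σ x

/-- The space `Γ(M, (TM ⊕ 1 ⊕ T^*M ⊕ 1) ⊗ L^{⊗n})` of smooth sections. -/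
def ESection (n : ℤ) : Submodule ℂ (∀ x : M, B.TensorL n (EFib EM) x) where
  carrier := {c | ∀ (σ : M → Z) (U : Set M), B.IsLocalSection σ U →
    SmoothCVecOn (fun x => (B.coeff c σ x).1) U ∧
    ContMDiffOn 𝓘(ℝ, EM) 𝓘(ℝ, ℂ) ∞ (fun x => (B.coeff c σ x).2.1) U ∧
    SmoothFormOn (fun x => (B.coeff c σ x).2.2.1) U ∧
    ContMDiffOn 𝓘(ℝ, EM) 𝓘(ℝ, ℂ) ∞ (fun x => (B.coeff c σ x).2.2.2) U}
  zero_mem' := by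
    intro σ U _
    simp only [coeff_zero]
    exact ⟨SmoothCVecOn.zero U, contMDiffOn_const, SmoothFormOn.zero U, contMDiffOn_const⟩
  add_mem' := by
    intro c d hc hd σ U hσ
    obtain ⟨h1, h2, h3, h4⟩ := hc σ U hσ
    obtain ⟨k1, k2, k3, k4⟩ := hd σ U hσ
    simp only [coeff_add]
    exact ⟨h1.add k1, h2.add k2, h3.add k3, h4.add k4⟩
  smul_mem' := by
    intro k c hc σ U hσ
    obtain ⟨h1, h2, h3, h4⟩ := hc σ U hσ
    simp only [coeff_smul]
    exact ⟨h1.smulConst k, contMDiffOn_const_mul k h2,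
      h3.smulConst k, contMDiffOn_const_mul k h4⟩

/-- A family `h_n ∈ Γ(M, L^{⊗n})`, `n ∈ ℤ`, belongs to the Fréchet completion of the direct sum. -/
def RapidL (h : ∀ n : ℤ, B.LSection n) : Prop :=
  ∀ (σ : M → Z) (U : Set M), B.IsLocalSection σ U →
    RapidlyDecreasingOn (E := EM) (F := ℂ) (Bundle.Trivial M ℂ) (fun n x => B.coeff (h n).1 σ x) U

/-- A family `c_n ∈ Γ(M, (TM ⊕ 1 ⊕ T^*M ⊕ 1) ⊗ L^{⊗n})`, `n ∈ ℤ`, belongs to the Fréchet completion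
of the direct sum. -/
def RapidE (c : ∀ n : ℤ, B.ESection n) : Prop :=
  ∀ (σ : M → Z) (U : Set M), B.IsLocalSection σ U →
    RapidlyDecreasingOn (E := EM) (F := EM) (TangentSpace 𝓘(ℝ, EM) : M → Type _)
      (fun n x => (B.coeff (c n).1 σ x).1.re) U ∧
    RapidlyDecreasingOn (E := EM) (F := EM) (TangentSpace 𝓘(ℝ, EM) : M → Type _)
      (fun n x => (B.coeff (c n).1 σ x).1.im) U ∧
    RapidlyDecreasingOn (E := EM) (F := ℂ) (Bundle.Trivial M ℂ)
      (fun n x => (B.coeff (c n).1 σ x).2.1) U ∧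
    RapidlyDecreasingOn (E := EM) (F := EM →L[ℝ] ℂ)
      (fun x : M => TangentSpace 𝓘(ℝ, EM) x →L[ℝ] Bundle.Trivial M ℂ x)
      (fun n x => (B.coeff (c n).1 σ x).2.2.1) U ∧
    RapidlyDecreasingOn (E := EM) (F := ℂ) (Bundle.Trivial M ℂ)
      (fun n x => (B.coeff (c n).1 σ x).2.2.2) U

/-- The horizontal lift `h_A : T_{π p} M → T_p Z`. -/
def horizontal (A : Connection EZ Z) (p : Z) :
    TangentSpace 𝓘(ℝ, EM) (B.proj p) →L[ℝ] TangentSpace 𝓘(ℝ, EZ) p :=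
  ((mfderiv 𝓘(ℝ, EZ) 𝓘(ℝ, EM) B.proj p).prod (A.form p)).inverse ∘L
    ContinuousLinearMap.inl ℝ _ ℝ

/-- The map `(X, f, ξ, g) ↦ h_A(X) + f v + π^*ξ + g A`. -/
def psi (A : Connection EZ Z) (p : Z) (e : EFib EM (B.proj p)) : GTan EZ p :=
  (Cplx.map (B.horizontal A p) e.1 + e.2.1 • vertical EZ p,
    e.2.2.1 ∘L mfderiv 𝓘(ℝ, EZ) 𝓘(ℝ, EM) B.proj p + e.2.2.2 • A.complexForm p)

/-- The local connection form `A_σ = σ^*A` on `M`; the induced connection on `L` is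
`∇ s_σ = A_σ ⊗ s_σ`. -/
def localForm (A : Connection EZ Z) (σ : M → Z) (x : M) : TangentSpace 𝓘(ℝ, EM) x →L[ℝ] ℂ :=
  A.complexForm (σ x) ∘L mfderiv 𝓘(ℝ, EM) 𝓘(ℝ, EZ) σ x

/-- The 1-form `τ_σ = π^*A_σ - A` on `Z`: the differential `D = ∇ - n A` on `L^{⊗n}` satisfies
`D s_σ^{⊗n} = n τ_σ ⊗ s_σ^{⊗n}`. -/
def tau (A : Connection EZ Z) (σ : M → Z) (p : Z) : TangentSpace 𝓘(ℝ, EZ) p →L[ℝ] ℂ :=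
  localForm A σ (B.proj p) ∘L mfderiv 𝓘(ℝ, EZ) 𝓘(ℝ, EM) B.proj p - A.complexForm p

/-- The coefficient, in the frame given by `σ`, of `D h = ∇h - n h A ∈ Γ(E ⊗ L^{⊗n})`, for
`h ∈ Γ(L^{⊗n})`. -/
def localD (A : Connection EZ Z) {n : ℤ} (h : B.LSection n) (σ : M → Z) (x : M) : EFib EM x :=
  (0, 0, covFun (localForm A σ) n (B.coeff h.1 σ) x, -((n : ℂ) * B.coeff h.1 σ x))

/-- `e = [c, d]_H` for the exotic bracket: in the frame given by any local section `σ`, the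
component of `e` in weight `k` is the sum over `n + m = k` of the `H`-twisted derived brackets of
`c_n` and `d_m` for the differential `D = ∇ - n A`, sections over `M` being identified with
invariant sections over `Z` through `psi`. -/
def IsExoticBracket (A : Connection EZ Z) (H : Flux EZ Z) (c d e : ∀ n : ℤ, B.ESection n) : Prop :=
  ∀ (k : ℤ) (σ : M → Z) (U : Set M), B.IsLocalSection σ U → ∀ p : Z, B.proj p ∈ U →
    HasSum (fun n : ℤ => derivedBracket H.form (B.tau A σ) n (k - n)
        (fun q => B.psi A q (B.coeff (c n).1 σ (B.proj q)))
        (fun q => B.psi A q (B.coeff (d (k - n)).1 σ (B.proj q))) p)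
      (B.psi A p (B.coeff (e k).1 σ (B.proj p)))

/-- `h = ρ(c) k` for the exotic anchor `ρ`, which is defined by `ρ(c) k = ⟨c, D k⟩`. -/
def IsExoticAction (A : Connection EZ Z) (c : ∀ n : ℤ, B.ESection n) (k h : ∀ n : ℤ, B.LSection n) : Prop :=
  ∀ (l : ℤ) (σ : M → Z) (U : Set M), B.IsLocalSection σ U → ∀ x ∈ U,
    HasSum (fun n : ℤ => pairingE (B.coeff (c n).1 σ x) (B.localD A (k (l - n)) σ x))
      (B.coeff (h l).1 σ x)

/-- `h = ⟨c, d⟩` for the exotic pairing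
`⟨a ⊗ s₁, b ⊗ s₂⟩ = ⟨a, b⟩ s₁ s₂ ∈ Γ(L^{⊗(n+m)})`, `a ⊗ s₁ ∈ Γ(E_n)`, `b ⊗ s₂ ∈ Γ(E_m)`. -/
def IsExoticPairing (c d : ∀ n : ℤ, B.ESection n) (h : ∀ n : ℤ, B.LSection n) : Prop :=
  ∀ (k : ℤ) (x : M) (p : {p : Z // B.proj p = x}),
    HasSum (fun n : ℤ => pairingE (((c n).1 x).1 p) (((d (k - n)).1 x).1 p)) (((h k).1 x).1 p)

end PrincipalCircleBundle

/-! #### Sections over `Z` -/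

variable (EZ Z) [IsManifold 𝓘(ℝ, EZ) ∞ Z]

/-- The space `C^∞(Z, ℂ)`. -/
def SmoothFun : Submodule ℂ (Z → ℂ) where
  carrier := {f | ContMDiff 𝓘(ℝ, EZ) 𝓘(ℝ, ℂ) ∞ f}
  zero_mem' := contMDiff_const
  add_mem' := fun hf hg => hf.add hg
  smul_mem' := fun c _ hf =>
    contMDiffOn_univ.1 (contMDiffOn_const_mul c (contMDiffOn_univ.2 hf))

/-- The space `Γ(Z, (TZ ⊕ T^*Z) ⊗ ℂ)` of smooth sections. -/
def GSection : Submodule ℂ (∀ p : Z, GTan EZ p) where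
  carrier := {a | SmoothCVecOn (fun p => (a p).1) Set.univ ∧
    SmoothFormOn (fun p => (a p).2) Set.univ}
  zero_mem' := ⟨SmoothCVecOn.zero _, SmoothFormOn.zero _⟩
  add_mem' := fun ha hb => ⟨ha.1.add hb.1, ha.2.add hb.2⟩
  smul_mem' := fun c _ ha => ⟨ha.1.smulConst c, ha.2.smulConst c⟩

variable {EZ Z}

/-- `a ∈ Γ_n(Z, TZ ⊕ T^*Z)`, that is `L_v a = n a`. -/
def HasWeight (n : ℤ) (a : GSection EZ Z) : Prop :=
  ∀ p : Z, lieG (vertical EZ) a.1 p = (n : ℂ) • a.1 p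

/-- `f ∈ C^∞(Z, ℂ)` has weight `n`, that is `v f = n f`. -/
def FunHasWeight (n : ℤ) (f : SmoothFun EZ Z) : Prop :=
  ∀ p : Z, Cplx.eval (dFun f.1 p) (vertical EZ p) = (n : ℂ) * f.1 p

end Bundle
end ExoticCourant

set_option linter.unusedSectionVars false

/-! Over a chart of the base, a local section `σ` gives coordinates `(u, t) ↦ e^{it} • σ(x(u))` on
`Z` (`tube`, shown to be a parametrization in `isParam_tube`), where `t = 2πθ` and `∂_t` generates
the action. All components in these coordinates are `2π`-periodic in `t`, so everything reduces to
scalar Fourier analysis in `t` with parameters `u`.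

An element of `V ⊗ L^n` is a function on a fibre of `Z` with `u(z • p) = z^{-n} u(p)`. The average
`(2π)⁻¹ ∫ e^{int} ψ⁻¹ a(e^{it} p) dt` has this equivariance in `p`, so the Fourier maps `PhiE` and
`PhiL` are defined globally without choosing sections; local sections only serve to compute them.
Since the connection and the flux are invariant, the matrix relating `ψ`-components to coordinate
components does not depend on `t` and commutes with Fourier coefficients (`fc_toZ`).

Bijectivity onto the completed sums is the classical correspondence between smooth periodic
functions and rapidly decreasing coefficients, with parameters: integration by parts in `t` and
differentiation under the integral give decay (`PerSmooth.rapid_fcp`), and termwise differentiation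
of the series gives smoothness of the sum (`Rapid.contDiffOn_fseries`).

The bracket rests on two facts. In any coordinates the derived bracket for `D` is the Dorfman
formula with each `∂_i x_k` replaced by `∂_i x_k + n τ_i x_k` (`IsParam.derivedBracket_vec`,
`IsParam.derivedBracket_form`). In tube coordinates `τ_σ = -i dt` exactly (`tau_dM_tube`), so this
replacement acts on an invariant Fourier coefficient as `∂_i` acts on the corresponding term with
its factor `e^{-int}`: the covariant derivatives of the `n`-th coefficient are the `n`-th
coefficients of the ordinary derivatives (`covariant_invariantPart`). Both brackets are thus the
same bilinear expression `brk` with coefficients constant in `t`, and the convolution theorem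
`SmoothPer.hasSum_fc_mul` matches them (`fcSum_brk`, `isExoticBracket_PhiE`).

The pairing and the action on functions are again bilinear expressions handled by convolution, using
that `ψ` is an isometry. For the weights, `L_v` is `-i ∂_t` on each component because `v = -i ∂_t`
has constant components; a smooth periodic function has weight `-n` exactly when all its other
coefficients vanish (`PerSmooth.weight_iff`). -/

namespace ExoticCourant

open Set Filter Topology

section

open MeasureTheory intervalIntegral

/-! ### Fourier coefficients of periodic functions -/

/-- The exponential `e^{int}`. -/
def expI (n : ℤ) (t : ℝ) : ℂ := Complex.exp (n * t * Complex.I)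

theorem expI_add (n : ℤ) (s t : ℝ) : expI n (s + t) = expI n s * expI n t := by
  simp only [expI, ← Complex.exp_add]; congr 1; push_cast; ring

theorem expI_add_left (n m : ℤ) (t : ℝ) : expI (n + m) t = expI n t * expI m t := by
  simp only [expI, ← Complex.exp_add]; congr 1; push_cast; ring

@[simp] theorem expI_zero_left (t : ℝ) : expI 0 t = 1 := by simp [expI]

@[simp] theorem expI_zero_right (n : ℤ) : expI n 0 = 1 := by simp [expI]

@[simp] theorem norm_expI (n : ℤ) (t : ℝ) : ‖expI n t‖ = 1 := by
  have h : ((n : ℂ) * (t : ℂ)) * Complex.I = ((n * t : ℝ) : ℂ) * Complex.I := by push_cast; ring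
  rw [expI, h, Complex.norm_exp_ofReal_mul_I]

theorem expI_neg_mul (n : ℤ) (t : ℝ) : expI (-n) t * expI n t = 1 := by
  rw [← expI_add_left]; simp

theorem contDiff_expI (n : ℤ) {m : WithTop ℕ∞} : ContDiff ℝ m (expI n) := by
  unfold expI
  exact ((contDiff_const.mul Complex.ofRealCLM.contDiff).mul contDiff_const).cexp

theorem hasDerivAt_expI (n : ℤ) (t : ℝ) :
    HasDerivAt (expI n) (n * Complex.I * expI n t) t := by
  have h1 : HasDerivAt (fun s : ℝ => (n : ℂ) * (s : ℂ) * Complex.I) (n * 1 * Complex.I) t :=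
    ((Complex.ofRealCLM.hasDerivAt (x := t)).const_mul (n : ℂ)).mul_const Complex.I
  have h2 := h1.cexp
  simp only [mul_one] at h2
  rw [mul_comm]
  exact h2

theorem expI_two_pi (n : ℤ) : expI n (2 * Real.pi) = 1 := by
  rw [expI, Complex.exp_eq_one_iff]; exact ⟨n, by push_cast; ring⟩

theorem expI_periodic (n : ℤ) : Function.Periodic (expI n) (2 * Real.pi) := by
  intro t; rw [expI_add, expI_two_pi, mul_one]

theorem coe_circle_exp_zpow (n : ℤ) (t : ℝ) : ((Circle.exp t : Circle) : ℂ) ^ n = expI n t := by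
  rw [Circle.coe_exp, ← Complex.exp_int_mul, expI, mul_assoc]

/-- The coefficient `(2π)⁻¹ ∫ e^{int} g(t) dt` of `e^{-int}` in the Fourier expansion of `g`. -/
def fc (n : ℤ) (g : ℝ → ℂ) : ℂ := (2 * Real.pi : ℂ)⁻¹ * ∫ s in 0..(2 * Real.pi), expI n s * g s

theorem two_pi_ne : (2 * Real.pi : ℂ) ≠ 0 := by
  exact_mod_cast Real.two_pi_pos.ne'

theorem fc_intervalIntegrable (n : ℤ) {g : ℝ → ℂ} (hg : Continuous g) (a b : ℝ) :
    IntervalIntegrable (fun s => expI n s * g s) volume a b :=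
  (((contDiff_expI n (m := 0)).continuous).mul hg).intervalIntegrable _ _

theorem fc_add (n : ℤ) {f g : ℝ → ℂ} (hf : Continuous f) (hg : Continuous g) :
    fc n (fun s => f s + g s) = fc n f + fc n g := by
  simp only [fc, mul_add]
  rw [integral_add (fc_intervalIntegrable n hf _ _) (fc_intervalIntegrable n hg _ _)]
  ring

theorem fc_const_mul (n : ℤ) (c : ℂ) (g : ℝ → ℂ) :
    fc n (fun s => c * g s) = c * fc n g := by
  simp only [fc, mul_left_comm _ c]
  rw [intervalIntegral.integral_const_mul]
  ring

theorem fc_sum (n : ℤ) {ι : Type*} (s : Finset ι) {f : ι → ℝ → ℂ} (hf : ∀ i, Continuous (f i)) :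
    fc n (fun t => ∑ i ∈ s, f i t) = ∑ i ∈ s, fc n (f i) := by
  classical
  induction s using Finset.induction_on with
  | empty => simp [fc]
  | insert a s ha ih =>
    simp only [Finset.sum_insert ha]
    rw [fc_add n (hf a) (continuous_finsetSum _ fun i _ => hf i), ih]

/-- Orthogonality of the exponentials. With the sign convention used here `fc n` detects `e^{-int}`,
the function of weight `-n`. -/
theorem fc_expI (n m : ℤ) : fc n (expI (-m)) = if m = n then 1 else 0 := by
  have h : ∀ s, expI n s * expI (-m) s = expI (n - m) s := fun s => by
    rw [← expI_add_left]; rfl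
  simp only [fc, h]
  split_ifs with hnm
  · subst hnm
    simpa using inv_mul_cancel₀ two_pi_ne
  · have hne : ((n - m : ℤ) : ℂ) * Complex.I ≠ 0 := by
      refine mul_ne_zero ?_ Complex.I_ne_zero
      exact_mod_cast sub_ne_zero.2 (Ne.symm hnm)
    have h2 : ∀ s : ℝ, HasDerivAt (fun t => (((n - m : ℤ) : ℂ) * Complex.I)⁻¹ * expI (n - m) t)
        (expI (n - m) s) s := fun s => by
      have := (hasDerivAt_expI (n - m) s).const_mul (((n - m : ℤ) : ℂ) * Complex.I)⁻¹
      rwa [← mul_assoc, inv_mul_cancel₀ hne, one_mul] at this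
    rw [intervalIntegral.integral_eq_sub_of_hasDerivAt (fun s _ => h2 s)
      ((contDiff_expI (n - m) (m := 0)).continuous.intervalIntegrable _ _)]
    simp [expI_two_pi]

/-- Substitution, and invariance of the integral over a period. The factor is the equivariance law
of `TensorL n`, so averaging along an orbit automatically produces an element of `V ⊗ L^n`. -/
theorem fc_shift (n : ℤ) {g : ℝ → ℂ} (hg : Function.Periodic g (2 * Real.pi)) (a : ℝ) :
    fc n (fun s => g (s + a)) = expI (-n) a * fc n g := by
  have h1 : ∀ s, expI n s * g (s + a) = expI (-n) a * (fun r => expI n r * g r) (s + a) := by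
    intro s
    simp only [expI_add]
    linear_combination (-expI n s * g (s + a)) * expI_neg_mul n a
  have hp : Function.Periodic (fun r => expI n r * g r) (2 * Real.pi) := fun r => by
    simp only [expI_periodic n r, hg r]
  simp only [fc, h1]
  rw [intervalIntegral.integral_const_mul, intervalIntegral.integral_comp_add_right
    (fun r => expI n r * g r)]
  have := hp.intervalIntegral_add_eq (a) 0
  simp only [zero_add] at this ⊢
  rw [add_comm (2 * Real.pi) a, this]
  ring

/-- Integration by parts; the boundary terms cancel by periodicity. -/
theorem fc_hasDerivAt (n : ℤ) {g g' : ℝ → ℂ} (hg : Function.Periodic g (2 * Real.pi))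
    (h : ∀ t, HasDerivAt g (g' t) t) (hc : Continuous g') :
    fc n g' = -(n * Complex.I) * fc n g := by
  have key := intervalIntegral.integral_mul_deriv_eq_deriv_mul (a := 0) (b := 2 * Real.pi)
    (fun s _ => hasDerivAt_expI n s) (fun s _ => h s)
    (((continuous_const.mul (contDiff_expI n (m := 0)).continuous)).intervalIntegrable _ _)
    (hc.intervalIntegrable _ _)
  have h0 : g (2 * Real.pi) = g 0 := by simpa using hg 0
  simp only [expI_two_pi, expI_zero_right, h0, sub_self, zero_sub, mul_assoc] at key
  simp only [fc]
  rw [key]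
  simp only [intervalIntegral.integral_const_mul]
  ring

theorem norm_fc_le (n : ℤ) {g : ℝ → ℂ} {C : ℝ} (h : ∀ s ∈ Icc 0 (2 * Real.pi), ‖g s‖ ≤ C) :
    ‖fc n g‖ ≤ C := by
  have hp := Real.two_pi_pos
  have h1 : ‖∫ s in 0..(2 * Real.pi), expI n s * g s‖ ≤ C * |2 * Real.pi - 0| := by
    refine intervalIntegral.norm_integral_le_of_norm_le_const fun s hs => ?_
    rw [uIoc_of_le hp.le] at hs
    simpa using h s ⟨hs.1.le, hs.2⟩
  rw [fc, norm_mul, norm_inv]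
  have h2 : ‖(2 * Real.pi : ℂ)‖ = 2 * Real.pi := by
    rw [show (2 * Real.pi : ℂ) = ((2 * Real.pi : ℝ) : ℂ) by push_cast; rfl, Complex.norm_real,
      Real.norm_of_nonneg hp.le]
  rw [h2, inv_mul_le_iff₀ hp]
  rwa [sub_zero, abs_of_pos hp, mul_comm C] at h1

/-- Functions on `ℝ` that are `2π`-periodic and smooth. -/
structure SmoothPer (g : ℝ → ℂ) : Prop where
  smooth : ContDiff ℝ ∞ g
  per : Function.Periodic g (2 * Real.pi)

namespace SmoothPer

theorem continuous {g : ℝ → ℂ} (hg : SmoothPer g) : Continuous g := hg.smooth.continuous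

theorem deriv {g : ℝ → ℂ} (hg : SmoothPer g) : SmoothPer (deriv g) := by
  refine ⟨(contDiff_infty_iff_deriv.1 hg.smooth).2, fun t => ?_⟩
  have h : (fun s => g (s + 2 * Real.pi)) = g := funext hg.per
  rw [← deriv_comp_add_const, h]

theorem fc_deriv {g : ℝ → ℂ} (hg : SmoothPer g) (n : ℤ) :
    fc n (_root_.deriv g) = -(n * Complex.I) * fc n g :=
  fc_hasDerivAt n hg.per (fun t => ((hg.smooth.differentiable (by simp)) t).hasDerivAt)
    hg.deriv.continuous

/-- Two integrations by parts give a bound by a multiple of `n⁻²`. -/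
theorem summable_fc {g : ℝ → ℂ} (hg : SmoothPer g) : Summable fun n : ℤ => ‖fc n g‖ := by
  obtain ⟨C, hC⟩ := (isCompact_Icc (a := (0 : ℝ)) (b := 2 * Real.pi)).exists_bound_of_continuousOn
    (f := _root_.deriv (_root_.deriv g)) hg.deriv.deriv.continuous.continuousOn
  have hs : Summable fun n : ℤ => C * (1 / (n : ℝ) ^ 2) :=
    (Real.summable_one_div_int_pow.2 one_lt_two).mul_left C
  -- At `n = 0` the comparison term is `1 / 0 = 0` and bounds nothing, so the comparison is made off
  -- a finite set.
  refine Summable.of_norm_bounded_eventually hs ?_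
  have : ∀ᶠ n : ℤ in cofinite, n ≠ 0 :=
    (Set.finite_singleton (0 : ℤ)).compl_mem_cofinite
  filter_upwards [this] with n hn
  have h1 := norm_fc_le n hC
  rw [hg.deriv.fc_deriv, hg.fc_deriv] at h1
  simp only [norm_mul, norm_neg, Complex.norm_intCast, Complex.norm_I, mul_one] at h1
  have hn' : 0 < |(n : ℝ)| := abs_pos.2 (by exact_mod_cast hn)
  rw [norm_norm, mul_one_div, le_div_iff₀ (by positivity), ← sq_abs]
  linarith

/-- Descends `g` to the circle of length `2π`, where absolutely summable Fourier coefficients give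
pointwise convergence. The index is negated because the standard coefficient of index `-n` is the
coefficient of `e^{-int}`. -/
theorem hasSum {g : ℝ → ℂ} (hg : SmoothPer g) (t : ℝ) :
    HasSum (fun n : ℤ => fc n g * expI (-n) t) (g t) := by
  have : Fact (0 < 2 * Real.pi) := ⟨Real.two_pi_pos⟩
  let G : C(AddCircle (2 * Real.pi), ℂ) :=
    ⟨hg.per.lift, by
      refine continuous_coinduced_dom.2 ?_
      exact hg.continuous⟩
  have hco : ∀ n : ℤ, fourierCoeff G (-n) = fc n g := fun n => by
    rw [fourierCoeff_eq_intervalIntegral _ _ 0, fc, zero_add, Complex.real_smul]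
    congr 1
    · push_cast; rw [one_div]
    · refine intervalIntegral.integral_congr fun s _ => ?_
      simp only [fourier_coe_apply, neg_neg, smul_eq_mul]
      have : G (s : AddCircle (2 * Real.pi)) = g s := hg.per.lift_coe s
      rw [this, expI]
      congr 2
      push_cast
      have := two_pi_ne
      field_simp
  have hs : Summable (fourierCoeff G) := by
    rw [← (Equiv.neg ℤ).summable_iff]
    refine Summable.of_norm ?_
    simpa [Function.comp_def, hco] using hg.summable_fc
  have := has_pointwise_sum_fourier_series_of_summable hs (t : AddCircle (2 * Real.pi))
  rw [← (Equiv.neg ℤ).hasSum_iff] at this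
  have hGt : G (t : AddCircle (2 * Real.pi)) = g t := hg.per.lift_coe t
  rw [hGt] at this
  convert! this using 1
  ext n
  simp only [Function.comp, Equiv.neg_apply, hco, fourier_coe_apply, smul_eq_mul, expI]
  congr 2
  push_cast
  have := two_pi_ne
  field_simp

end SmoothPer

/-- Dominated convergence with bound `‖c n‖ · sup |g|`: since `e^{ikt} e^{-int} = e^{i(k-n)t}`,
integrating term by term produces the convolution. It specializes to the convolution theorem, and
with `g = 1` to the recovery of the coefficients of a series. -/
theorem fc_tsum {c : ℤ → ℂ} (hc : Summable fun n => ‖c n‖) {g : ℝ → ℂ} (hg : Continuous g)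
    (k : ℤ) : HasSum (fun n => c n * fc (k - n) g)
      (fc k (fun t => (∑' n, c n * expI (-n) t) * g t)) := by
  obtain ⟨C, hC⟩ := (isCompact_Icc (a := (0 : ℝ)) (b := 2 * Real.pi)).exists_bound_of_continuousOn
    (f := g) hg.continuousOn
  have hsum : ∀ t, Summable fun n => c n * expI (-n) t := fun t =>
    Summable.of_norm (by simpa using hc)
  have h := intervalIntegral.hasSum_integral_of_dominated_convergence (μ := volume)
    (a := 0) (b := 2 * Real.pi)
    (F := fun n t => c n * (expI (k - n) t * g t))
    (f := fun t => expI k t * ((∑' n, c n * expI (-n) t) * g t))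
    (fun n _ => ‖c n‖ * C)
    (fun n => (continuous_const.mul
      ((contDiff_expI (k - n) (m := 0)).continuous.mul hg)).aestronglyMeasurable)
    (fun n => Eventually.of_forall fun t ht => by
      rw [uIoc_of_le Real.two_pi_pos.le] at ht
      rw [norm_mul, norm_mul, norm_expI, one_mul]
      exact mul_le_mul_of_nonneg_left (hC t ⟨ht.1.le, ht.2⟩) (norm_nonneg _))
    (Eventually.of_forall fun t _ => hc.mul_right C)
    (continuous_const.intervalIntegrable _ _)
    (Eventually.of_forall fun t _ => by
      have := (hsum t).hasSum.mul_left (expI k t) |>.mul_right (g t)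
      convert! this using 1
      · ext n
        rw [sub_eq_add_neg, expI_add_left]
        ring
      · ring)
  have h2 := h.mul_left (2 * Real.pi : ℂ)⁻¹
  convert! h2 using 1
  ext n
  rw [intervalIntegral.integral_const_mul, fc]
  ring

/-- The Fourier coefficients of a product are the convolution of the Fourier coefficients. -/
theorem SmoothPer.hasSum_fc_mul {f g : ℝ → ℂ} (hf : SmoothPer f) (hg : Continuous g) (k : ℤ) :
    HasSum (fun n => fc n f * fc (k - n) g) (fc k (fun t => f t * g t)) := by
  have := fc_tsum hf.summable_fc hg k
  simpa only [(hf.hasSum _).tsum_eq] using this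

theorem fc_hasSum {c : ℤ → ℂ} (hc : Summable fun n => ‖c n‖) (k : ℤ) :
    fc k (fun t => ∑' n, c n * expI (-n) t) = c k := by
  have h := fc_tsum hc (g := fun _ => 1) continuous_const k
  simp only [mul_one] at h
  have h1 : ∀ n : ℤ, fc n (fun _ => 1) = if n = 0 then 1 else 0 := fun n => by
    have := fc_expI n 0
    simp only [neg_zero, eq_comm (a := (0 : ℤ))] at this
    rw [← this]
    congr 1
    ext t
    simp
  refine h.unique ?_
  convert! hasSum_ite_eq k (c k) using 1
  ext n
  rw [h1]
  by_cases hn : n = k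
  · simp [hn]
  · simp [hn, sub_eq_zero, Ne.symm hn]

end

/-! ### Fourier coefficients and Fourier series depending smoothly on parameters. -/

section

open MeasureTheory intervalIntegral

section Parametric

variable {E : Type*} [NormedAddCommGroup E] [NormedSpace ℝ E]

/-- Smooth functions on `W × ℝ` that are `2π`-periodic in the second variable. -/
structure PerSmooth (W : Set E) (G : E × ℝ → ℂ) : Prop where
  smooth : ContDiffOn ℝ ∞ G (W ×ˢ univ)
  per : ∀ u ∈ W, ∀ t, G (u, t + 2 * Real.pi) = G (u, t)

/-- The Fourier coefficients of a function on `E × ℝ` in the second variable. -/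
def fcp (n : ℤ) (G : E × ℝ → ℂ) (u : E) : ℂ := fc n (fun s => G (u, s))

variable {W : Set E} {G : E × ℝ → ℂ}

theorem PerSmooth.smoothPer (h : PerSmooth W G) {u : E} (hu : u ∈ W) :
    SmoothPer (fun t => G (u, t)) := by
  refine ⟨?_, fun t => h.per u hu t⟩
  rw [← contDiffOn_univ]
  exact h.smooth.comp (contDiff_const.prodMk contDiff_id).contDiffOn fun t _ => ⟨hu, mem_univ _⟩

theorem PerSmooth.contDiffAt (h : PerSmooth W G) (hW : IsOpen W) {y : E × ℝ} (hy : y.1 ∈ W) :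
    ContDiffAt ℝ ∞ G y :=
  h.smooth.contDiffAt ((hW.prod isOpen_univ).mem_nhds ⟨hy, mem_univ _⟩)

theorem PerSmooth.hasFDerivAt (h : PerSmooth W G) (hW : IsOpen W) {y : E × ℝ} (hy : y.1 ∈ W) :
    HasFDerivAt G (fderiv ℝ G y) y :=
  ((h.contDiffAt hW hy).differentiableAt (by simp)).hasFDerivAt

/-- Closure under directional derivatives, in base and fibre directions alike, drives every
induction on the order of differentiation below. Periodicity survives because `G` and its translate
by a period agree near each point, not only at it. -/
theorem PerSmooth.dir (h : PerSmooth W G) (hW : IsOpen W) (w : E × ℝ) :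
    PerSmooth W (fun y => fderiv ℝ G y w) := by
  refine ⟨?_, fun u hu t => ?_⟩
  · have := (contDiffOn_infty_iff_fderiv_of_isOpen (hW.prod isOpen_univ)).1 h.smooth
    exact this.2.clm_apply contDiffOn_const
  · have h1 : (fun y : E × ℝ => G (y + (0, 2 * Real.pi))) =ᶠ[𝓝 (u, t)] G := by
      filter_upwards [(hW.prod isOpen_univ).mem_nhds (show (u, t) ∈ W ×ˢ univ from ⟨hu, mem_univ _⟩)]
        with y hy
      have := h.per y.1 hy.1 y.2
      rwa [show y + (0, 2 * Real.pi) = (y.1, y.2 + 2 * Real.pi) from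
        Prod.ext (add_zero _) rfl]
    have h2 := h1.fderiv_eq (𝕜 := ℝ)
    rw [fderiv_comp_add_right] at h2
    simp only [Prod.mk_add_mk, add_zero] at h2
    simp only [h2]

theorem PerSmooth.deriv_eq (h : PerSmooth W G) (hW : IsOpen W) {u : E} (hu : u ∈ W) (t : ℝ) :
    HasDerivAt (fun s => G (u, s)) (fderiv ℝ G (u, t) (0, 1)) t := by
  have h1 := h.hasFDerivAt hW (y := (u, t)) hu
  have h2 : HasDerivAt (fun s : ℝ => (u, s)) ((0 : E), (1 : ℝ)) t :=
    (hasDerivAt_const t u).prodMk (hasDerivAt_id t)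
  exact h1.comp_hasDerivAt t h2

theorem PerSmooth.fcp_dir_snd (h : PerSmooth W G) (hW : IsOpen W) {u : E} (hu : u ∈ W) (n : ℤ) :
    fcp n (fun y => fderiv ℝ G y (0, 1)) u = -(n * Complex.I) * fcp n G u :=
  fc_hasDerivAt n (fun t => h.per u hu t) (fun t => h.deriv_eq hW hu t)
    ((h.dir hW (0, 1)).smoothPer hu).continuous

/-- Differentiation under the integral. Finite dimension makes a closed ball inside `W` compact, and
its product with a period gives a uniform bound for the partial derivative. -/
theorem PerSmooth.hasFDerivAt_fcp [FiniteDimensional ℝ E] (h : PerSmooth W G) (hW : IsOpen W)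
    (n : ℤ) {u : E} (hu : u ∈ W) :
    ∃ L : E →L[ℝ] ℂ, HasFDerivAt (fcp n G) L u ∧
      ∀ w, L w = fcp n (fun y => fderiv ℝ G y (w, 0)) u := by
  obtain ⟨ε, hε, hball⟩ := Metric.nhds_basis_closedBall.mem_iff.1 (hW.mem_nhds hu)
  have hfd : ContinuousOn (fun y => fderiv ℝ G y) (W ×ˢ univ) :=
    h.smooth.continuousOn_fderiv_of_isOpen (hW.prod isOpen_univ) (by simp)
  let F' : E → ℝ → E →L[ℝ] ℂ := fun u s =>
    expI n s • (fderiv ℝ G (u, s) ∘L ContinuousLinearMap.inl ℝ E ℝ)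
  have hF'c : ContinuousOn (fun y : E × ℝ => F' y.1 y.2) (W ×ˢ univ) := by
    have h1 : ContinuousOn (fun y : E × ℝ => expI n y.2) (W ×ˢ univ) :=
      ((contDiff_expI n (m := 0)).continuous.comp continuous_snd).continuousOn
    have h2 : ContinuousOn (fun y => fderiv ℝ G y ∘L ContinuousLinearMap.inl ℝ E ℝ) (W ×ˢ univ) :=
      hfd.clm_comp continuousOn_const
    exact h1.smul h2
  obtain ⟨C, hC⟩ := ((isCompact_closedBall u ε).prod
    (isCompact_Icc (a := (0 : ℝ)) (b := 2 * Real.pi))).exists_bound_of_continuousOn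
    (hF'c.mono (prod_mono hball (subset_univ _)))
  have hF'u : Continuous (F' u) :=
    hF'c.comp_continuous (by fun_prop : Continuous fun s : ℝ => (u, s))
      fun s => ⟨hu, mem_univ _⟩
  have key := intervalIntegral.hasFDerivAt_integral_of_dominated_of_fderiv_le (𝕜 := ℝ)
    (μ := volume) (a := 0) (b := 2 * Real.pi) (F := fun u s => expI n s * G (u, s)) (F' := F')
    (x₀ := u) (bound := fun _ => C) (Metric.closedBall_mem_nhds u hε)
    (by
      filter_upwards [hW.mem_nhds hu] with x hx
      exact ((contDiff_expI n (m := 0)).continuous.mul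
        (h.smoothPer hx).continuous).aestronglyMeasurable)
    (fc_intervalIntegrable n (h.smoothPer hu).continuous _ _)
    hF'u.aestronglyMeasurable
    (Eventually.of_forall fun t ht x hx => by
      rw [uIoc_of_le Real.two_pi_pos.le] at ht
      exact hC (x, t) ⟨hx, ht.1.le, ht.2⟩)
    (continuous_const.intervalIntegrable _ _)
    (Eventually.of_forall fun t ht x hx => by
      have h1 := h.hasFDerivAt hW (y := (x, t)) (hball hx)
      exact (h1.comp x (hasFDerivAt_prodMk_left x t)).const_smul (expI n t))
  refine ⟨_, key.const_smul ((2 * Real.pi : ℂ)⁻¹), fun w => ?_⟩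
  rw [smul_apply, ContinuousLinearMap.intervalIntegral_apply
    (hF'u.intervalIntegrable _ _)]
  rfl

theorem PerSmooth.fderiv_fcp [FiniteDimensional ℝ E] (h : PerSmooth W G) (hW : IsOpen W)
    (n : ℤ) {u : E} (hu : u ∈ W) (w : E) :
    fderiv ℝ (fcp n G) u w = fcp n (fun y => fderiv ℝ G y (w, 0)) u := by
  obtain ⟨L, hL, hw⟩ := h.hasFDerivAt_fcp hW n hu
  rw [hL.fderiv, hw]

theorem PerSmooth.contDiffOn_fcp [FiniteDimensional ℝ E] (h : PerSmooth W G) (hW : IsOpen W)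
    (n : ℤ) : ContDiffOn ℝ ∞ (fcp n G) W := by
  rw [contDiffOn_infty]
  intro m
  induction m generalizing G with
  | zero =>
    refine contDiffOn_zero.2 fun u hu => ?_
    obtain ⟨L, hL, -⟩ := h.hasFDerivAt_fcp hW n hu
    exact hL.continuousAt.continuousWithinAt
  | succ m ih =>
    push_cast
    rw [contDiffOn_succ_iff_fderiv_apply hW.uniqueDiffOn]
    refine ⟨fun u hu => ?_, by simp, fun w => ?_⟩
    · obtain ⟨L, hL, -⟩ := h.hasFDerivAt_fcp hW n hu
      exact hL.differentiableAt.differentiableWithinAt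
    · refine (ih (h.dir hW (w, 0))).congr fun u hu => ?_
      rw [fderivWithin_of_isOpen hW hu, h.fderiv_fcp hW n hu]

/-! ### Rapidly decreasing families -/

/-- `c_n → 0` faster than any power of `n`, with all derivatives, uniformly on compact subsets. -/
def Rapid {F : Type*} [NormedAddCommGroup F] [NormedSpace ℝ F] (W : Set E) (c : ℤ → E → F) : Prop :=
  ∀ K : Set E, IsCompact K → K ⊆ W → ∀ r l : ℕ, ∃ C : ℝ, ∀ (n : ℤ), ∀ u ∈ K,
    (1 + |(n : ℝ)|) ^ l * ‖iteratedFDeriv ℝ r (c n) u‖ ≤ C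

/-- Each fibre derivative pays for one factor `|n|`, so the induction on the exponent replaces `G`
by `∂_t G`. -/
theorem PerSmooth.fcp_bound (h : PerSmooth W G) (hW : IsOpen W) {K : Set E} (hK : IsCompact K)
    (hKW : K ⊆ W) (l : ℕ) :
    ∃ C : ℝ, ∀ (n : ℤ), ∀ u ∈ K, |(n : ℝ)| ^ l * ‖fcp n G u‖ ≤ C := by
  induction l generalizing G with
  | zero =>
    obtain ⟨C, hC⟩ := (hK.prod (isCompact_Icc (a := (0 : ℝ)) (b := 2 * Real.pi)))
      |>.exists_bound_of_continuousOn
      (h.smooth.continuousOn.mono (prod_mono hKW (subset_univ _)))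
    refine ⟨C, fun n u hu => ?_⟩
    rw [pow_zero, one_mul]
    exact norm_fc_le n fun s hs => hC (u, s) ⟨hu, hs⟩
  | succ l ih =>
    obtain ⟨C, hC⟩ := ih (h.dir hW (0, 1))
    refine ⟨C, fun n u hu => ?_⟩
    have := hC n u hu
    rw [h.fcp_dir_snd hW (hKW hu)] at this
    simp only [norm_mul, norm_neg, Complex.norm_intCast, Complex.norm_I, mul_one] at this
    rwa [pow_succ, mul_assoc]

/-- Writes `df = ∑ (∂_i f) b_i^*`. The constant depends only on the basis, not on `f`, so it applies
uniformly to a family indexed by `n` when the order of differentiation is raised. -/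
theorem norm_iteratedFDeriv_succ_le [FiniteDimensional ℝ E] {ι : Type*} [Fintype ι]
    (b : Module.Basis ι ℝ E) :
    ∃ B : ℝ, 0 ≤ B ∧ ∀ (W : Set E), IsOpen W → ∀ f : E → ℂ, ContDiffOn ℝ ∞ f W → ∀ u ∈ W,
      ∀ r : ℕ, ‖iteratedFDeriv ℝ (r + 1) f u‖ ≤
        B * ∑ i, ‖iteratedFDeriv ℝ r (fun x => fderiv ℝ f x (b i)) u‖ := by
  let P : ι → ℂ →L[ℝ] (E →L[ℝ] ℂ) := fun i =>
    (ContinuousLinearMap.smulRightL ℝ E ℂ) (LinearMap.toContinuousLinearMap (b.coord i))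
  refine ⟨∑ i, ‖P i‖, Finset.sum_nonneg fun i _ => norm_nonneg (P i), fun W hW f hf u hu r => ?_⟩
  have h1 : fderiv ℝ f = fun x => ∑ i, P i (fderiv ℝ f x (b i)) := by
    ext x v
    have := congrArg (fderiv ℝ f x) (b.sum_repr v)
    rw [← this, map_sum]
    simp only [map_smul, sum_apply]
    rfl
  have hd : ∀ i, ContDiffAt ℝ ∞ (fun x => fderiv ℝ f x (b i)) u := fun i =>
    ((((contDiffOn_infty_iff_fderiv_of_isOpen hW).1 hf).2.clm_apply contDiffOn_const).contDiffAt
      (hW.mem_nhds hu))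
  have h2 : fderiv ℝ f = ∑ i, fun x => P i (fderiv ℝ f x (b i)) :=
    h1.trans (by ext; simp)
  have hsum := iteratedFDeriv_sum_apply (𝕜 := ℝ) (n := r) (x := u) (u := Finset.univ)
    (f := fun i x => P i (fderiv ℝ f x (b i)))
    (fun i _ => ((P i).contDiff.contDiffAt.comp u (hd i)).of_le (by exact_mod_cast le_top))
  rw [← h2] at hsum
  rw [← norm_iteratedFDeriv_fderiv, hsum]
  refine (norm_sum_le _ _).trans ?_
  rw [Finset.sum_mul]
  refine Finset.sum_le_sum fun i _ => ?_
  refine ((P i).norm_iteratedFDeriv_comp_left (hd i) (by exact_mod_cast le_top)).trans ?_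
  exact mul_le_mul_of_nonneg_left
    (Finset.single_le_sum (f := fun i => ‖iteratedFDeriv ℝ r (fun x => fderiv ℝ f x (b i)) u‖)
      (fun i _ => norm_nonneg _) (Finset.mem_univ i)) (norm_nonneg (P i))

theorem PerSmooth.rapid_fcp [FiniteDimensional ℝ E] (h : PerSmooth W G) (hW : IsOpen W) :
    Rapid W (fun n => fcp n G) := by
  intro K hK hKW r l
  induction r generalizing G with
  | zero =>
    obtain ⟨C₀, hC₀⟩ := h.fcp_bound hW hK hKW 0
    obtain ⟨C, hC⟩ := h.fcp_bound hW hK hKW l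
    refine ⟨2 ^ l * (C₀ + C), fun n u hu => ?_⟩
    rw [norm_iteratedFDeriv_zero]
    have h0 := hC₀ n u hu
    have h1 := hC n u hu
    -- `add_pow_le` gives the constant `2^(l-1)` with truncated subtraction; rounding it up to `2^l`
    -- covers `l = 0` as well.
    have hmax : (1 + |(n : ℝ)|) ^ l ≤ 2 ^ l * (1 + |(n : ℝ)| ^ l) := by
      have := add_pow_le (zero_le_one' ℝ) (abs_nonneg (n : ℝ)) l
      refine this.trans ?_
      rw [one_pow]
      exact mul_le_mul_of_nonneg_right
        (pow_le_pow_right₀ one_le_two (Nat.sub_le _ _)) (by positivity)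
    calc (1 + |(n : ℝ)|) ^ l * ‖fcp n G u‖
        ≤ 2 ^ l * (1 + |(n : ℝ)| ^ l) * ‖fcp n G u‖ :=
          mul_le_mul_of_nonneg_right hmax (norm_nonneg _)
      _ = 2 ^ l * (|(n : ℝ)| ^ 0 * ‖fcp n G u‖ + |(n : ℝ)| ^ l * ‖fcp n G u‖) := by ring
      _ ≤ _ := by gcongr
  | succ r ih =>
    let b := Module.finBasis ℝ E
    obtain ⟨B, hB, hle⟩ := norm_iteratedFDeriv_succ_le b
    choose C hC using fun i => ih (h.dir hW (b i, 0))
    refine ⟨B * ∑ i, C i, fun n u hu => ?_⟩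
    have h1 := hle W hW _ (h.contDiffOn_fcp hW n) u (hKW hu) r
    have h2 : ∀ i, iteratedFDeriv ℝ r (fun x => fderiv ℝ (fcp n G) x (b i)) u
        = iteratedFDeriv ℝ r (fcp n fun y => fderiv ℝ G y (b i, 0)) u := fun i => by
      have he : (fun x => fderiv ℝ (fcp n G) x (b i)) =ᶠ[𝓝 u]
          fcp n fun y => fderiv ℝ G y (b i, 0) := by
        filter_upwards [hW.mem_nhds (hKW hu)] with x hx
        exact h.fderiv_fcp hW n hx (b i)
      exact (he.iteratedFDeriv ℝ r).self_of_nhds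
    simp only [h2] at h1
    calc _ ≤ (1 + |(n : ℝ)|) ^ l * (B * ∑ i,
          ‖iteratedFDeriv ℝ r (fcp n fun y => fderiv ℝ G y (b i, 0)) u‖) := by gcongr
      _ = B * ∑ i, (1 + |(n : ℝ)|) ^ l *
          ‖iteratedFDeriv ℝ r (fcp n fun y => fderiv ℝ G y (b i, 0)) u‖ := by
        rw [Finset.mul_sum, Finset.mul_sum, Finset.mul_sum]
        refine Finset.sum_congr rfl fun i _ => by ring
      _ ≤ _ := by
        refine mul_le_mul_of_nonneg_left (Finset.sum_le_sum fun i _ => hC i n u hu) hB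

theorem Rapid.clm_comp {F F' : Type*} [NormedAddCommGroup F] [NormedSpace ℝ F]
    [NormedAddCommGroup F'] [NormedSpace ℝ F'] {c : ℤ → E → F} (h : Rapid W c) (hW : IsOpen W)
    (hc : ∀ n, ContDiffOn ℝ ∞ (c n) W) (L : F →L[ℝ] F') : Rapid W (fun n u => L (c n u)) := by
  intro K hK hKW r l
  obtain ⟨C, hC⟩ := h K hK hKW r l
  refine ⟨‖L‖ * C, fun n u hu => ?_⟩
  have h1 := L.norm_iteratedFDeriv_comp_left ((hc n).contDiffAt (hW.mem_nhds (hKW hu)))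
    (n := r) (by exact_mod_cast le_top)
  calc _ ≤ (1 + |(n : ℝ)|) ^ l * (‖L‖ * ‖iteratedFDeriv ℝ r (c n) u‖) := by
        gcongr; exact h1
    _ = ‖L‖ * ((1 + |(n : ℝ)|) ^ l * ‖iteratedFDeriv ℝ r (c n) u‖) := by ring
    _ ≤ _ := mul_le_mul_of_nonneg_left (hC n u hu) (norm_nonneg _)

theorem Rapid.sum {F : Type*} [NormedAddCommGroup F] [NormedSpace ℝ F] {ι : Type*} (s : Finset ι)
    {c : ι → ℤ → E → F} (h : ∀ i, Rapid W (c i)) (hW : IsOpen W)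
    (hc : ∀ i n, ContDiffOn ℝ ∞ (c i n) W) : Rapid W (fun n u => ∑ i ∈ s, c i n u) := by
  intro K hK hKW r l
  choose C hC using fun i => h i K hK hKW r l
  refine ⟨∑ i ∈ s, C i, fun n u hu => ?_⟩
  have hsum := iteratedFDeriv_sum_apply (𝕜 := ℝ) (n := r) (x := u) (u := s)
    (f := fun i x => c i n x)
    (fun i _ => ((hc i n).contDiffAt (hW.mem_nhds (hKW hu))).of_le (by exact_mod_cast le_top))
  beta_reduce
  rw [show (fun u => ∑ i ∈ s, c i n u) = ∑ j ∈ s, fun x => c j n x from by ext; simp, hsum]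
  calc _ ≤ (1 + |(n : ℝ)|) ^ l * ∑ i ∈ s, ‖iteratedFDeriv ℝ r (c i n) u‖ := by
        gcongr; exact norm_sum_le _ _
    _ ≤ _ := by
        rw [Finset.mul_sum]
        exact Finset.sum_le_sum fun i _ => hC i n u hu

theorem Rapid.congr {F : Type*} [NormedAddCommGroup F] [NormedSpace ℝ F] {c c' : ℤ → E → F}
    (h : Rapid W c) (hW : IsOpen W) (hc : ∀ n, ∀ u ∈ W, c' n u = c n u) : Rapid W c' := by
  intro K hK hKW r l
  obtain ⟨C, hC⟩ := h K hK hKW r l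
  refine ⟨C, fun n u hu => ?_⟩
  have he : c' n =ᶠ[𝓝 u] c n := by
    filter_upwards [hW.mem_nhds (hKW hu)] with x hx using hc n x hx
  rw [(he.iteratedFDeriv ℝ r).self_of_nhds]
  exact hC n u hu

theorem Rapid.of_finite_support {F : Type*} [NormedAddCommGroup F] [NormedSpace ℝ F]
    {c : ℤ → E → F} (hW : IsOpen W) (hc : ∀ n, ContDiffOn ℝ ∞ (c n) W) (k : ℤ)
    (hk : ∀ n, n ≠ k → ∀ u ∈ W, c n u = 0) : Rapid W c := by
  intro K hK hKW r l
  have h1 : ContinuousOn (iteratedFDeriv ℝ r (c k)) K := by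
    have := (hc k).continuousOn_iteratedFDerivWithin (m := r) (by exact_mod_cast le_top)
      hW.uniqueDiffOn
    refine (this.congr fun u hu => ?_).mono hKW
    exact (iteratedFDerivWithin_of_isOpen r hW hu).symm
  obtain ⟨C, hC⟩ := hK.exists_bound_of_continuousOn h1
  refine ⟨(1 + |(k : ℝ)|) ^ l * C, fun n u hu => ?_⟩
  by_cases hn : n = k
  · subst hn
    exact mul_le_mul_of_nonneg_left (hC u hu) (by positivity)
  · have he : c n =ᶠ[𝓝 u] fun _ => 0 := by
      filter_upwards [hW.mem_nhds (hKW hu)] with x hx using hk n hn x hx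
    rw [(he.iteratedFDeriv ℝ r).self_of_nhds]
    have : iteratedFDeriv ℝ r (fun _ : E => (0 : F)) u = 0 := by
      rw [iteratedFDeriv_fun_zero]; rfl
    rw [this, norm_zero, mul_zero]
    -- The bound `C` is known to be nonnegative only because `K` contains `u`.
    have := (norm_nonneg _).trans (hC u hu)
    positivity

theorem Rapid.fderiv' {F : Type*} [NormedAddCommGroup F] [NormedSpace ℝ F] {c : ℤ → E → F}
    (h : Rapid W c) : Rapid W (fun n => fderiv ℝ (c n)) := by
  intro K hK hKW r l
  obtain ⟨C, hC⟩ := h K hK hKW (r + 1) l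
  refine ⟨C, fun n u hu => ?_⟩
  rw [norm_iteratedFDeriv_fderiv]
  exact hC n u hu

theorem Rapid.dir {c : ℤ → E → ℂ} (h : Rapid W c) (hW : IsOpen W)
    (hc : ∀ n, ContDiffOn ℝ ∞ (c n) W) (w : E) : Rapid W (fun n u => fderiv ℝ (c n) u w) :=
  h.fderiv'.clm_comp hW (fun n => ((contDiffOn_infty_iff_fderiv_of_isOpen hW).1 (hc n)).2)
    (ContinuousLinearMap.apply ℝ ℂ w)

/-- A factor `n` is absorbed by requesting one more power of decay. It arises when a series is
differentiated along the fibre. -/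
theorem Rapid.mul_int {c : ℤ → E → ℂ} (h : Rapid W c) (hW : IsOpen W)
    (hc : ∀ n, ContDiffOn ℝ ∞ (c n) W) :
    Rapid W (fun n u => (n : ℂ) * c n u) := by
  intro K hK hKW r l
  obtain ⟨C, hC⟩ := h K hK hKW r (l + 1)
  refine ⟨C, fun n u hu => ?_⟩
  have h1 : iteratedFDeriv ℝ r (fun u => (n : ℂ) * c n u) u
      = (n : ℂ) • iteratedFDeriv ℝ r (c n) u := by
    simp only [← smul_eq_mul]
    exact iteratedFDeriv_const_smul_apply (𝕜 := ℝ) (a := (n : ℂ)) (((hc n).contDiffAt (hW.mem_nhds (hKW hu))).of_le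
      (by exact_mod_cast le_top))
  rw [h1, norm_smul, Complex.norm_intCast]
  refine le_trans ?_ (hC n u hu)
  rw [pow_succ, mul_assoc]
  gcongr
  linarith

/-- The exponent `l = 2` already gives a summable majorant on compact sets, as the Weierstrass test
requires. -/
theorem Rapid.bound {F : Type*} [NormedAddCommGroup F] [NormedSpace ℝ F] {c : ℤ → E → F}
    (h : Rapid W c) {K : Set E} (hK : IsCompact K) (hKW : K ⊆ W) :
    ∃ a : ℤ → ℝ, Summable a ∧ ∀ n, ∀ u ∈ K, ‖c n u‖ ≤ a n := by
  obtain ⟨C, hC⟩ := h K hK hKW 0 2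
  refine ⟨fun n => |C| * (1 / (1 + |(n : ℝ)|) ^ 2), ?_, fun n u hu => ?_⟩
  · refine Summable.mul_left _ ?_
    refine Summable.of_norm_bounded_eventually (Real.summable_one_div_int_pow.2 one_lt_two) ?_
    filter_upwards [(Set.finite_singleton (0 : ℤ)).compl_mem_cofinite] with n hn
    have hn' : 0 < |(n : ℝ)| := abs_pos.2 (by exact_mod_cast hn)
    rw [Real.norm_of_nonneg (by positivity), ← sq_abs (n : ℝ)]
    gcongr
    linarith
  · have := hC n u hu
    rw [norm_iteratedFDeriv_zero] at this
    beta_reduce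
    rw [mul_one_div, le_div_iff₀ (by positivity), mul_comm]
    exact this.trans (le_abs_self C)

theorem Rapid.summable {c : ℤ → E → ℂ} (h : Rapid W c) {u : E} (hu : u ∈ W) :
    Summable fun n => ‖c n u‖ := by
  obtain ⟨a, ha, hle⟩ := h.bound (isCompact_singleton (x := u)) (singleton_subset_iff.2 hu)
  exact Summable.of_nonneg_of_le (fun _ => norm_nonneg _) (fun n => hle n u rfl) ha

/-- The function `∑ c_n(u) e^{-int}`. -/
def fseries (c : ℤ → E → ℂ) (y : E × ℝ) : ℂ := ∑' n, c n y.1 * expI (-n) y.2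

/-- Termwise differentiation on the convex set `ball × ℝ`, with majorants supplied by the decay of
`d c_n` and of `n c_n`. The derivative is expressed through series of the same kind, which makes the
argument repeatable. -/
theorem Rapid.hasFDerivAt_fseries [FiniteDimensional ℝ E] {c : ℤ → E → ℂ} (h : Rapid W c)
    (hW : IsOpen W) (hc : ∀ n, ContDiffOn ℝ ∞ (c n) W) {y : E × ℝ} (hy : y.1 ∈ W) :
    ∃ L : E × ℝ →L[ℝ] ℂ, HasFDerivAt (fseries c) L y ∧ ∀ w, L w =
      fseries (fun n u => fderiv ℝ (c n) u w.1) y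
        - Complex.I * w.2 * fseries (fun n u => (n : ℂ) * c n u) y := by
  obtain ⟨ε, hε, hball⟩ := Metric.nhds_basis_closedBall.mem_iff.1 (hW.mem_nhds hy)
  obtain ⟨a, ha, hale⟩ := h.fderiv'.bound (isCompact_closedBall y.1 ε) hball
  obtain ⟨a', ha', hale'⟩ := (h.mul_int hW hc).bound (isCompact_closedBall y.1 ε) hball
  let f' : ℤ → E × ℝ → (E × ℝ →L[ℝ] ℂ) := fun n z =>
    c n z.1 • (ContinuousLinearMap.smulRight (ContinuousLinearMap.snd ℝ E ℝ)
        (((-n : ℤ) : ℂ) * Complex.I * expI (-n) z.2))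
      + expI (-n) z.2 • (fderiv ℝ (c n) z.1 ∘L ContinuousLinearMap.fst ℝ E ℝ)
  have hf'a : ∀ n z w, f' n z w = fderiv ℝ (c n) z.1 w.1 * expI (-n) z.2
      - Complex.I * w.2 * ((n : ℂ) * c n z.1 * expI (-n) z.2) := by
    intro n z w
    simp only [f', add_apply, smul_apply,
      ContinuousLinearMap.smulRight_apply, ContinuousLinearMap.comp_apply,
      ContinuousLinearMap.coe_snd', ContinuousLinearMap.coe_fst', smul_eq_mul, Complex.real_smul]
    push_cast
    ring
  have hf : ∀ n, ∀ z ∈ Metric.ball y.1 ε ×ˢ (univ : Set ℝ),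
      HasFDerivAt (fun z : E × ℝ => c n z.1 * expI (-n) z.2) (f' n z) z := by
    intro n z hz
    have h1 : HasFDerivAt (fun z : E × ℝ => c n z.1)
        (fderiv ℝ (c n) z.1 ∘L ContinuousLinearMap.fst ℝ E ℝ) z :=
      ((((hc n).contDiffAt (hW.mem_nhds (hball (Metric.ball_subset_closedBall hz.1))))
        |>.differentiableAt (by simp)).hasFDerivAt).comp z hasFDerivAt_fst
    have h2 : HasFDerivAt (fun z : E × ℝ => expI (-n) z.2)
        ((ContinuousLinearMap.smulRight (1 : ℝ →L[ℝ] ℝ)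
          (((-n : ℤ) : ℂ) * Complex.I * expI (-n) z.2)) ∘L ContinuousLinearMap.snd ℝ E ℝ) z :=
      (hasDerivAt_expI (-n) z.2).hasFDerivAt.comp z hasFDerivAt_snd
    refine (h1.mul h2).congr_fderiv ?_
    ext <;> simp [f']
  have hf'b : ∀ n, ∀ z ∈ Metric.ball y.1 ε ×ˢ (univ : Set ℝ), ‖f' n z‖ ≤ a n + a' n := by
    intro n z hz
    have hzb := Metric.ball_subset_closedBall hz.1
    refine ContinuousLinearMap.opNorm_le_bound _ ?_ fun w => ?_
    · exact add_nonneg ((norm_nonneg _).trans (hale n _ hzb)) ((norm_nonneg _).trans (hale' n _ hzb))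
    · rw [hf'a]
      refine (norm_sub_le _ _).trans ?_
      simp only [norm_mul, norm_expI, mul_one, Complex.norm_I, one_mul, Complex.norm_real]
      have h1 := hale n _ hzb
      have h2 := hale' n _ hzb
      rw [norm_mul] at h2
      have h3 : ‖fderiv ℝ (c n) z.1 w.1‖ ≤ a n * ‖w‖ :=
        ((fderiv ℝ (c n) z.1).le_opNorm _).trans (mul_le_mul h1 (norm_fst_le w) (norm_nonneg _)
          ((norm_nonneg _).trans h1))
      have h4 : ‖w.2‖ * (‖(n : ℂ)‖ * ‖c n z.1‖) ≤ ‖w‖ * a' n :=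
        mul_le_mul (norm_snd_le w) h2 (by positivity) (norm_nonneg _)
      linarith
  have hyb : y ∈ Metric.ball y.1 ε ×ˢ (univ : Set ℝ) := ⟨Metric.mem_ball_self hε, mem_univ _⟩
  have key := hasFDerivAt_tsum_of_isPreconnected (𝕜 := ℝ) (ha.add ha')
    (Metric.isOpen_ball.prod isOpen_univ)
    (((convex_ball y.1 ε).prod convex_univ).isPreconnected) hf hf'b hyb
    (Summable.of_norm (by simpa using h.summable hy)) hyb
  refine ⟨_, key, fun w => ?_⟩
  have hs : Summable fun n => f' n y :=
    Summable.of_norm_bounded (ha.add ha') fun n => hf'b n y hyb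
  have hs1 : Summable fun n => fderiv ℝ (c n) y.1 w.1 * expI (-n) y.2 :=
    Summable.of_norm (by simpa using (h.dir hW hc w.1).summable hy)
  have hs2 : Summable fun n : ℤ => (n : ℂ) * c n y.1 * expI (-n) y.2 :=
    Summable.of_norm (by simpa using (h.mul_int hW hc).summable hy)
  have h1 := (ContinuousLinearMap.apply ℝ ℂ w).map_tsum hs
  simp only [ContinuousLinearMap.apply_apply, hf'a] at h1
  rw [h1, hs1.tsum_sub (hs2.mul_left _), tsum_mul_left]
  rfl

/-- Induction on the order: the derivative in direction `w` is a combination of the series of `∂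
c_n` and of `n c_n`, and both families are again rapidly decreasing. -/
theorem Rapid.contDiffOn_fseries [FiniteDimensional ℝ E] {c : ℤ → E → ℂ} (h : Rapid W c)
    (hW : IsOpen W) (hc : ∀ n, ContDiffOn ℝ ∞ (c n) W) :
    ContDiffOn ℝ ∞ (fseries c) (W ×ˢ univ) := by
  rw [contDiffOn_infty]
  intro m
  have hO : IsOpen (W ×ˢ (univ : Set ℝ)) := hW.prod isOpen_univ
  induction m generalizing c with
  | zero =>
    refine contDiffOn_zero.2 fun y hy => ?_
    obtain ⟨L, hL, -⟩ := h.hasFDerivAt_fseries hW hc hy.1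
    exact hL.continuousAt.continuousWithinAt
  | succ m ih =>
    push_cast
    rw [contDiffOn_succ_iff_fderiv_apply hO.uniqueDiffOn]
    refine ⟨fun y hy => ?_, by simp, fun w => ?_⟩
    · obtain ⟨L, hL, -⟩ := h.hasFDerivAt_fseries hW hc hy.1
      exact hL.differentiableAt.differentiableWithinAt
    · have h1 := ih (h.dir hW hc w.1) (fun n =>
        ((contDiffOn_infty_iff_fderiv_of_isOpen hW).1 (hc n)).2.clm_apply contDiffOn_const)
      have h2 := ih (h.mul_int hW hc) (fun n => contDiffOn_const.mul (hc n))
      refine (h1.sub (contDiffOn_const (c := Complex.I * w.2) |>.mul h2)).congr fun y hy => ?_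
      obtain ⟨L, hL, hLw⟩ := h.hasFDerivAt_fseries hW hc hy.1
      rw [fderivWithin_of_isOpen hO hy, hL.fderiv, hLw]

theorem Rapid.hasSum_fseries {c : ℤ → E → ℂ} (h : Rapid W c) {y : E × ℝ} (hy : y.1 ∈ W) :
    HasSum (fun n => c n y.1 * expI (-n) y.2) (fseries c y) :=
  (Summable.of_norm (by simpa using h.summable hy)).hasSum

theorem Rapid.fcp_fseries {c : ℤ → E → ℂ} (h : Rapid W c) {u : E} (hu : u ∈ W) (n : ℤ) :
    fcp n (fseries c) u = c n u :=
  fc_hasSum (h.summable hu) n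

end Parametric

end

/-! ### Differentials as maps between model spaces. -/

section
variable (E : Type*) [NormedAddCommGroup E] [NormedSpace ℝ E]
  {N : Type*} [TopologicalSpace N] [ChartedSpace E N]
  (E' : Type*) [NormedAddCommGroup E'] [NormedSpace ℝ E']
  {N' : Type*} [TopologicalSpace N'] [ChartedSpace E' N']

/-- The differential of a map of manifolds, as a map of the model spaces. -/
def dM (f : N → N') (q : N) : E →L[ℝ] E' := mfderiv 𝓘(ℝ, E) 𝓘(ℝ, E') f q

theorem dM_congr {f f' : N → N'} {q : N} (h : f =ᶠ[𝓝 q] f') : dM E E' f q = dM E E' f' q :=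
  h.mfderiv_eq

theorem dM_id (q : N) : dM E E (fun p : N => p) q = ContinuousLinearMap.id ℝ E :=
  mfderiv_id (I := 𝓘(ℝ, E))

theorem dM_eq_fderiv (f : E → E') (u : E) : dM E E' f u = fderiv ℝ f u := mfderiv_eq_fderiv

theorem dM_comp (E'' : Type*) [NormedAddCommGroup E''] [NormedSpace ℝ E'']
    {N'' : Type*} [TopologicalSpace N''] [ChartedSpace E'' N''] {g : N' → N''} {f : N → N'} {q : N}
    (hg : MDifferentiableAt 𝓘(ℝ, E') 𝓘(ℝ, E'') g (f q))
    (hf : MDifferentiableAt 𝓘(ℝ, E) 𝓘(ℝ, E') f q) :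
    dM E E'' (fun p => g (f p)) q = dM E' E'' g (f q) ∘L dM E E' f q :=
  mfderiv_comp (I := 𝓘(ℝ, E)) (I' := 𝓘(ℝ, E')) (I'' := 𝓘(ℝ, E'')) q hg hf

end

section Param

variable {E : Type*} [NormedAddCommGroup E] [NormedSpace ℝ E]
  {N : Type*} [TopologicalSpace N] [ChartedSpace E N]
  {D : Type*} [NormedAddCommGroup D] [NormedSpace ℝ D]
  {F : Type*} [NormedAddCommGroup F] [NormedSpace ℝ F]

/-! ### Smoothness in charts -/

/-- The pullback of a vector field by a map with invertible differential. -/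
def vpull (Ψ : D → N) (x : N → E) (y : D) : D := (dM D E Ψ y).inverse (x (Ψ y))

/-- The pullback of a 1-form. -/
def cpull (Ψ : D → N) (α : N → E →L[ℝ] F) (y : D) : D →L[ℝ] F := α (Ψ y) ∘L dM D E Ψ y

variable [IsManifold 𝓘(ℝ, E) ∞ N]

theorem contMDiffAt_iff_chart {f : N → F} {p₀ q : N} (hq : q ∈ (extChartAt 𝓘(ℝ, E) p₀).source) :
    ContMDiffAt 𝓘(ℝ, E) 𝓘(ℝ, F) ∞ f q ↔
      ContDiffAt ℝ ∞ (f ∘ (extChartAt 𝓘(ℝ, E) p₀).symm) (extChartAt 𝓘(ℝ, E) p₀ q) := by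
  rw [extChartAt_source] at hq
  rw [contMDiffAt_iff_source_of_mem_source hq]
  simp [contMDiffWithinAt_univ, contMDiffAt_iff_contDiffAt]

/-- The tangent trivialization is the differential of the chart, which is inverse to the
differential of the inverse chart. This translates both smoothness and rapid decrease of vector
fields into statements about `vpull`. -/
theorem vec_trivialization (p₀ : N) {u : E} (hu : u ∈ (extChartAt 𝓘(ℝ, E) p₀).target)
    (x : N → E) :
    (trivializationAt E (TangentSpace 𝓘(ℝ, E) : N → Type _) p₀
      ⟨(extChartAt 𝓘(ℝ, E) p₀).symm u, x ((extChartAt 𝓘(ℝ, E) p₀).symm u)⟩).2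
      = vpull (extChartAt 𝓘(ℝ, E) p₀).symm x u := by
  have hs : (extChartAt 𝓘(ℝ, E) p₀).symm u ∈ (chartAt E p₀).source := by
    rw [← extChartAt_source 𝓘(ℝ, E)]; exact (extChartAt 𝓘(ℝ, E) p₀).map_target hu
  have h1 := TangentBundle.continuousLinearMapAt_trivializationAt (I := 𝓘(ℝ, E)) hs
  have h2 := mfderiv_extChartAt_comp_mfderivWithin_extChartAt_symm (I := 𝓘(ℝ, E)) hu
  have h3 := mfderivWithin_extChartAt_symm_comp_mfderiv_extChartAt (I := 𝓘(ℝ, E)) hu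
  simp only [modelWithCornersSelf_coe, range_id, mfderivWithin_univ] at h2 h3
  have h4 : (dM E E (extChartAt 𝓘(ℝ, E) p₀).symm u).inverse
      = mfderiv 𝓘(ℝ, E) 𝓘(ℝ, E) (extChartAt 𝓘(ℝ, E) p₀) ((extChartAt 𝓘(ℝ, E) p₀).symm u) :=
    ContinuousLinearMap.inverse_eq h3 h2
  rw [vpull, h4, ← h1]
  exact ((trivializationAt E (TangentSpace 𝓘(ℝ, E) : N → Type _) p₀).coe_linearMapAt_of_mem
    (R := ℝ) hs ▸ rfl)

/-- The counterpart for 1-forms: the trivialization of the dual bundle precomposes with the inverse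
tangent trivialization, that is, with the differential of the inverse chart. -/
theorem cov_trivialization (p₀ : N) {u : E} (hu : u ∈ (extChartAt 𝓘(ℝ, E) p₀).target)
    (α : N → E →L[ℝ] F) :
    (trivializationAt (E →L[ℝ] F)
      (fun x : N => TangentSpace 𝓘(ℝ, E) x →L[ℝ] Bundle.Trivial N F x) p₀
      ⟨(extChartAt 𝓘(ℝ, E) p₀).symm u, α ((extChartAt 𝓘(ℝ, E) p₀).symm u)⟩).2
      = cpull (extChartAt 𝓘(ℝ, E) p₀).symm α u := by
  have hs : (extChartAt 𝓘(ℝ, E) p₀).symm u ∈ (chartAt E p₀).source := by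
    rw [← extChartAt_source 𝓘(ℝ, E)]; exact (extChartAt 𝓘(ℝ, E) p₀).map_target hu
  have h1 := TangentBundle.symmL_trivializationAt (I := 𝓘(ℝ, E)) hs
  rw [(extChartAt 𝓘(ℝ, E) p₀).right_inv hu] at h1
  simp only [modelWithCornersSelf_coe, range_id, mfderivWithin_univ] at h1
  rw [hom_trivializationAt_apply]
  ext v
  simp only [ContinuousLinearMap.inCoordinates, cpull, dM]
  rw [h1]
  simp
  rfl

theorem contDiffAt_congr {f g : D → F} {y : D} (h : f =ᶠ[𝓝 y] g) :
    ContDiffAt ℝ ∞ f y ↔ ContDiffAt ℝ ∞ g y :=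
  ⟨fun hf => hf.congr_of_eventuallyEq h.symm, fun hg => hg.congr_of_eventuallyEq h⟩

variable (E) in
/-- Smoothness at a point of a real vector field. -/
def SmoothVecAt (x : ∀ p : N, TangentSpace 𝓘(ℝ, E) p) (q : N) : Prop :=
  ContMDiffAt 𝓘(ℝ, E) (𝓘(ℝ, E).prod 𝓘(ℝ, E)) ∞
    (fun p => (⟨p, x p⟩ : Bundle.TotalSpace E (TangentSpace 𝓘(ℝ, E) : N → Type _))) q

/-- Smoothness at a point of a 1-form. -/
def SmoothFormAt (α : ∀ p : N, TangentSpace 𝓘(ℝ, E) p →L[ℝ] F) (q : N) : Prop :=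
  ContMDiffAt 𝓘(ℝ, E) (𝓘(ℝ, E).prod 𝓘(ℝ, E →L[ℝ] F)) ∞
    (fun p => (⟨p, α p⟩ : Bundle.TotalSpace (E →L[ℝ] F)
      (fun p : N => TangentSpace 𝓘(ℝ, E) p →L[ℝ] Bundle.Trivial N F p))) q

theorem smoothVecAt_iff_chart {x : ∀ p : N, TangentSpace 𝓘(ℝ, E) p} {p₀ q : N}
    (hq : q ∈ (extChartAt 𝓘(ℝ, E) p₀).source) :
    SmoothVecAt E x q ↔
      ContDiffAt ℝ ∞ (vpull (E := E) (extChartAt 𝓘(ℝ, E) p₀).symm x) (extChartAt 𝓘(ℝ, E) p₀ q) := by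
  have hs : q ∈ (trivializationAt E (TangentSpace 𝓘(ℝ, E) : N → Type _) p₀).baseSet := by
    rw [TangentBundle.trivializationAt_baseSet, ← extChartAt_source 𝓘(ℝ, E)]; exact hq
  refine (Bundle.Trivialization.contMDiffAt_section_iff _ hs).trans
    ((contMDiffAt_iff_chart hq).trans (contDiffAt_congr ?_))
  filter_upwards [extChartAt_target_mem_nhds' (I := 𝓘(ℝ, E)) ((extChartAt 𝓘(ℝ, E) p₀).map_source hq)]
    with u hu
  exact vec_trivialization p₀ hu x

theorem smoothFormAt_iff_chart {α : ∀ p : N, TangentSpace 𝓘(ℝ, E) p →L[ℝ] F} {p₀ q : N}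
    (hq : q ∈ (extChartAt 𝓘(ℝ, E) p₀).source) :
    SmoothFormAt α q ↔
      ContDiffAt ℝ ∞ (cpull (E := E) (extChartAt 𝓘(ℝ, E) p₀).symm α) (extChartAt 𝓘(ℝ, E) p₀ q) := by
  have hs : q ∈ (trivializationAt (E →L[ℝ] F)
      (fun x : N => TangentSpace 𝓘(ℝ, E) x →L[ℝ] Bundle.Trivial N F x) p₀).baseSet := by
    rw [hom_trivializationAt_baseSet]
    refine ⟨?_, mem_univ _⟩
    rw [TangentBundle.trivializationAt_baseSet, ← extChartAt_source 𝓘(ℝ, E)]; exact hq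
  refine (Bundle.Trivialization.contMDiffAt_section_iff _ hs).trans
    ((contMDiffAt_iff_chart hq).trans (contDiffAt_congr ?_))
  filter_upwards [extChartAt_target_mem_nhds' (I := 𝓘(ℝ, E)) ((extChartAt 𝓘(ℝ, E) p₀).map_source hq)]
    with u hu
  exact cov_trivialization p₀ hu α

/-! ### Local parametrizations -/

/-- A smooth map from an open subset of a normed space to a manifold with smooth local inverses. -/
structure IsParam (E : Type*) [NormedAddCommGroup E] [NormedSpace ℝ E]
    {N : Type*} [TopologicalSpace N] [ChartedSpace E N]
    {D : Type*} [NormedAddCommGroup D] [NormedSpace ℝ D] (Ψ : D → N) (Ω : Set D) : Prop where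
  isOpen : IsOpen Ω
  smooth : ∀ y ∈ Ω, ContMDiffAt 𝓘(ℝ, D) 𝓘(ℝ, E) ∞ Ψ y
  exists_inv : ∀ y ∈ Ω, ∃ Θ : N → D, ContMDiffAt 𝓘(ℝ, E) 𝓘(ℝ, D) ∞ Θ (Ψ y) ∧ Θ (Ψ y) = y ∧
    (∀ᶠ y' in 𝓝 y, Θ (Ψ y') = y') ∧ ∀ᶠ q in 𝓝 (Ψ y), Ψ (Θ q) = q

theorem isParam_chart (p₀ : N) : IsParam E (extChartAt 𝓘(ℝ, E) p₀).symm
    (extChartAt 𝓘(ℝ, E) p₀).target where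
  isOpen := isOpen_extChartAt_target p₀
  smooth u hu := (contMDiffOn_extChartAt_symm p₀).contMDiffAt (extChartAt_target_mem_nhds' hu)
  exists_inv u hu := by
    have hs := (extChartAt 𝓘(ℝ, E) p₀).map_target hu
    refine ⟨extChartAt 𝓘(ℝ, E) p₀, contMDiffAt_extChartAt' ?_, (extChartAt 𝓘(ℝ, E) p₀).right_inv hu,
      ?_, ?_⟩
    · rwa [← extChartAt_source 𝓘(ℝ, E)]
    · filter_upwards [extChartAt_target_mem_nhds' (I := 𝓘(ℝ, E)) hu] with u' hu'
      exact (extChartAt 𝓘(ℝ, E) p₀).right_inv hu'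
    · filter_upwards [extChartAt_source_mem_nhds' (I := 𝓘(ℝ, E)) hs] with q hq
      exact (extChartAt 𝓘(ℝ, E) p₀).left_inv hq

theorem IsParam.mono {Ψ : D → N} {Ω Ω' : Set D} (h : IsParam E Ψ Ω) (ho : IsOpen Ω') (hs : Ω' ⊆ Ω) :
    IsParam E Ψ Ω' :=
  ⟨ho, fun y hy => h.smooth y (hs hy), fun y hy => h.exists_inv y (hs hy)⟩

namespace IsParam

variable {Ψ : D → N} {Ω : Set D} (h : IsParam E Ψ Ω)

include h in
theorem mdifferentiableAt {y : D} (hy : y ∈ Ω) : MDifferentiableAt 𝓘(ℝ, D) 𝓘(ℝ, E) Ψ y :=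
  (h.smooth y hy).mdifferentiableAt (by simp)

-- The chain rule applied to `Ψ` and its local inverse, in both orders.
include h in
theorem isInvertible {y : D} (hy : y ∈ Ω) : (dM D E Ψ y).IsInvertible := by
  obtain ⟨Θ, hΘ, hy0, h1, h2⟩ := h.exists_inv y hy
  have hΘd := hΘ.mdifferentiableAt (by simp)
  have hΨd := h.mdifferentiableAt hy
  have a1 : dM E D Θ (Ψ y) ∘L dM D E Ψ y = ContinuousLinearMap.id ℝ D := by
    rw [← dM_comp D E D hΘd hΨd, ← dM_id D y]
    exact dM_congr D D h1
  have a2 : dM D E Ψ y ∘L dM E D Θ (Ψ y) = ContinuousLinearMap.id ℝ E := by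
    have h3 := dM_comp E D E (g := Ψ) (f := Θ) (q := Ψ y) (by rwa [hy0]) hΘd
    rw [hy0] at h3
    rw [← h3, ← dM_id E (Ψ y)]
    exact dM_congr E E h2
  exact ContinuousLinearMap.IsInvertible.of_inverse a2 a1

include h in
/-- Passage from a parametrization to a chart. -/
theorem exists_chart (p₀ : N) {y : D} (hy : y ∈ Ω) (hp : Ψ y ∈ (extChartAt 𝓘(ℝ, E) p₀).source) :
    ∃ (g : D → E) (k : E → D), ContDiffAt ℝ ∞ g y ∧ ContDiffAt ℝ ∞ k (g y) ∧
      g y = extChartAt 𝓘(ℝ, E) p₀ (Ψ y) ∧ k (g y) = y ∧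
      (Ψ =ᶠ[𝓝 y] (extChartAt 𝓘(ℝ, E) p₀).symm ∘ g) ∧
      ((extChartAt 𝓘(ℝ, E) p₀).symm =ᶠ[𝓝 (g y)] Ψ ∘ k) ∧
      (∀ᶠ y' in 𝓝 y, g y' ∈ (extChartAt 𝓘(ℝ, E) p₀).target) ∧
      (∀ᶠ y' in 𝓝 y, k (g y') = y') ∧ (∀ᶠ u in 𝓝 (g y), g (k u) = u) := by
  obtain ⟨Θ, hΘ, hy0, h1, h2⟩ := h.exists_inv y hy
  set φ := extChartAt 𝓘(ℝ, E) p₀ with hφ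
  have hg : ContDiffAt ℝ ∞ (φ ∘ Ψ) y := by
    rw [← contMDiffAt_iff_contDiffAt]
    refine ContMDiffAt.comp y (contMDiffAt_extChartAt' ?_) (h.smooth y hy)
    rwa [← extChartAt_source 𝓘(ℝ, E)]
  have hk : ContDiffAt ℝ ∞ (Θ ∘ φ.symm) (φ (Ψ y)) := by
    rw [← contMDiffAt_iff_chart hp]
    exact hΘ
  have hsrc : ∀ᶠ y' in 𝓝 y, Ψ y' ∈ φ.source :=
    (h.smooth y hy).continuousAt.eventually (extChartAt_source_mem_nhds' hp)
  have hcs : ContinuousAt φ.symm (φ (Ψ y)) := continuousAt_extChartAt_symm' hp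
  have hback : φ.symm (φ (Ψ y)) = Ψ y := φ.left_inv hp
  have hevt : ∀ᶠ u in 𝓝 (φ (Ψ y)), Ψ (Θ (φ.symm u)) = φ.symm u := by
    have : Tendsto φ.symm (𝓝 (φ (Ψ y))) (𝓝 (Ψ y)) := by
      have := hcs.tendsto; rwa [hback] at this
    exact this.eventually h2
  refine ⟨φ ∘ Ψ, Θ ∘ φ.symm, hg, hk, rfl, ?_, ?_, ?_, ?_, ?_, ?_⟩
  · simp only [Function.comp_apply, hback, hy0]
  · filter_upwards [hsrc] with y' hy'
    exact (φ.left_inv hy').symm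
  · filter_upwards [hevt] with u hu
    exact hu.symm
  · filter_upwards [hsrc] with y' hy'
    exact φ.map_source hy'
  · filter_upwards [hsrc, h1] with y' hy' h1'
    simp only [Function.comp_apply, φ.left_inv hy', h1']
  · filter_upwards [hevt, extChartAt_target_mem_nhds' (I := 𝓘(ℝ, E)) (φ.map_source hp)] with u hu hut
    simp only [Function.comp_apply, hu]
    exact φ.right_inv hut

include h in
theorem contMDiffAt_iff {f : N → F} {y : D} (hy : y ∈ Ω) :
    ContMDiffAt 𝓘(ℝ, E) 𝓘(ℝ, F) ∞ f (Ψ y) ↔ ContDiffAt ℝ ∞ (f ∘ Ψ) y := by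
  obtain ⟨Θ, hΘ, hy0, h1, h2⟩ := h.exists_inv y hy
  rw [← contMDiffAt_iff_contDiffAt]
  refine ⟨fun hf => hf.comp y (h.smooth y hy), fun hf => ?_⟩
  have h3 : ContMDiffAt 𝓘(ℝ, E) 𝓘(ℝ, F) ∞ ((f ∘ Ψ) ∘ Θ) (Ψ y) := by
    refine ContMDiffAt.comp (Ψ y) ?_ hΘ
    rwa [hy0]
  refine h3.congr_of_eventuallyEq ?_
  filter_upwards [h2] with q hq
  simp [hq]

end IsParam

end Param

/-! ### Change of parametrization. -/

section Change

variable {E : Type*} [NormedAddCommGroup E] [NormedSpace ℝ E]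
  {N : Type*} [TopologicalSpace N] [ChartedSpace E N] [IsManifold 𝓘(ℝ, E) ∞ N]
  {D : Type*} [NormedAddCommGroup D] [NormedSpace ℝ D]
  {D' : Type*} [NormedAddCommGroup D'] [NormedSpace ℝ D']
  {F : Type*} [NormedAddCommGroup F] [NormedSpace ℝ F]

/-- Two local parametrizations `Ψ` and `Φ` related by mutually inverse germs `g` and `k`. -/
structure ParamChange (E : Type*) [NormedAddCommGroup E] [NormedSpace ℝ E]
    {N : Type*} [TopologicalSpace N] [ChartedSpace E N]
    (n : WithTop ℕ∞) (Ψ : D → N) (Φ : D' → N) (g : D → D') (k : D' → D) (y : D) : Prop where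
  contDiffAt : ContDiffAt ℝ n g y
  contDiffAt_symm : ContDiffAt ℝ n k (g y)
  eq : Ψ =ᶠ[𝓝 y] Φ ∘ g
  eq_symm : Φ =ᶠ[𝓝 (g y)] Ψ ∘ k
  left_inv : ∀ᶠ y' in 𝓝 y, k (g y') = y'
  right_inv : ∀ᶠ u in 𝓝 (g y), g (k u) = u
  contMDiffAt_left : ContMDiffAt 𝓘(ℝ, D) 𝓘(ℝ, E) n Ψ y
  contMDiffAt_right : ContMDiffAt 𝓘(ℝ, D') 𝓘(ℝ, E) n Φ (g y)

namespace ParamChange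

variable {n : WithTop ℕ∞} {Ψ : D → N} {Φ : D' → N} {g : D → D'} {k : D' → D} {y : D}

theorem symm (h : ParamChange E n Ψ Φ g k y) : ParamChange E n Φ Ψ k g (g y) := by
  have hk := h.left_inv.self_of_nhds
  exact ⟨h.contDiffAt_symm, by rw [hk]; exact h.contDiffAt, h.eq_symm, by rw [hk]; exact h.eq,
    h.right_inv, by rw [hk]; exact h.left_inv, h.contMDiffAt_right,
    by rw [hk]; exact h.contMDiffAt_left⟩

theorem of_le {m : WithTop ℕ∞} (h : ParamChange E n Ψ Φ g k y) (hm : m ≤ n) :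
    ParamChange E m Ψ Φ g k y :=
  ⟨h.1.of_le hm, h.2.of_le hm, h.3, h.4, h.5, h.6, h.7.of_le hm, h.8.of_le hm⟩

/-- The transformation rules are pointwise, while smoothness needs them near the point. Order 1
suffices for the rules, and being `C^n` at a point spreads to a neighbourhood for finite `n`; this
is why the relation is lowered from `∞` to 1. -/
theorem eventually (h : ParamChange E 1 Ψ Φ g k y) :
    ∀ᶠ y' in 𝓝 y, ParamChange E 1 Ψ Φ g k y' := by
  have hc := h.contDiffAt.continuousAt
  have : IsManifold 𝓘(ℝ, E) 1 N := IsManifold.of_le (n := ∞) (by exact_mod_cast le_top)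
  filter_upwards [h.contDiffAt.eventually (by simp), hc.eventually
    (h.contDiffAt_symm.eventually (by simp)), eventually_eventuallyEq_nhds.2 h.eq,
    hc.eventually (eventually_eventuallyEq_nhds.2 h.eq_symm),
    eventually_eventually_nhds.2 h.left_inv,
    hc.eventually (eventually_eventually_nhds.2 h.right_inv),
    (contMDiffAt_iff_contMDiffAt_nhds (n := 1) (by simp)).1 h.contMDiffAt_left,
    hc.eventually ((contMDiffAt_iff_contMDiffAt_nhds (n := 1) (by simp)).1 h.contMDiffAt_right)]
    with y' h1 h2 h3 h4 h5 h6 h7 h8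
  exact ⟨h1, h2, h3, h4, h5, h6, h7, h8⟩

theorem fderiv_comp_left (h : ParamChange E 1 Ψ Φ g k y) :
    fderiv ℝ k (g y) ∘L fderiv ℝ g y = ContinuousLinearMap.id ℝ D := by
  rw [← fderiv_comp y (h.contDiffAt_symm.differentiableAt (by simp))
    (h.contDiffAt.differentiableAt (by simp)), ← fderiv_id (x := y)]
  exact Filter.EventuallyEq.fderiv_eq h.left_inv

theorem fderiv_comp_right (h : ParamChange E 1 Ψ Φ g k y) :
    fderiv ℝ g y ∘L fderiv ℝ k (g y) = ContinuousLinearMap.id ℝ D' := by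
  have := h.symm.fderiv_comp_left
  rwa [h.left_inv.self_of_nhds] at this

theorem dM_eq (h : ParamChange E 1 Ψ Φ g k y) :
    dM D E Ψ y = dM D' E Φ (g y) ∘L fderiv ℝ g y := by
  rw [← dM_eq_fderiv, ← dM_comp D D' E (h.contMDiffAt_right.mdifferentiableAt (by simp))
    (h.contDiffAt.differentiableAt (by simp)).mdifferentiableAt]
  exact dM_congr D E h.eq

theorem cpull_eq (h : ParamChange E 1 Ψ Φ g k y) (α : N → E →L[ℝ] F) :
    cpull Ψ α y = cpull Φ α (g y) ∘L fderiv ℝ g y := by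
  rw [cpull, h.dM_eq, h.eq.eq_of_nhds]; rfl

/-- Inverts the chain rule `dΨ = dΦ ∘ dg`, with `dk` as the inverse of `dg`. -/
theorem vpull_eq (h : ParamChange E 1 Ψ Φ g k y) (x : N → E) :
    vpull Ψ x y = fderiv ℝ k (g y) (vpull Φ x (g y)) := by
  have hinv : (fderiv ℝ g y).IsInvertible :=
    ContinuousLinearMap.IsInvertible.of_inverse h.fderiv_comp_right h.fderiv_comp_left
  rw [vpull, h.dM_eq, hinv.inverse_comp_apply_of_right,
    ContinuousLinearMap.inverse_eq h.fderiv_comp_right h.fderiv_comp_left, h.eq.eq_of_nhds]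
  rfl

theorem contDiffAt_vpull (h : ParamChange E ∞ Ψ Φ g k y) {x : N → E}
    (hx : ContDiffAt ℝ ∞ (vpull Φ x) (g y)) : ContDiffAt ℝ ∞ (vpull Ψ x) y := by
  have h1 := (h.of_le (m := 1) (by exact_mod_cast le_top)).eventually
  have h2 : ContDiffAt ℝ ∞ (fun y' => fderiv ℝ k (g y') (vpull Φ x (g y'))) y :=
    ((h.contDiffAt_symm.fderiv_right (m := ∞) (by simp)).comp y h.contDiffAt).clm_apply
      (hx.comp y h.contDiffAt)
  refine h2.congr_of_eventuallyEq ?_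
  filter_upwards [h1] with y' hy' using hy'.vpull_eq x

theorem contDiffAt_cpull (h : ParamChange E ∞ Ψ Φ g k y) {α : N → E →L[ℝ] F}
    (hα : ContDiffAt ℝ ∞ (cpull Φ α) (g y)) : ContDiffAt ℝ ∞ (cpull Ψ α) y := by
  have h1 := (h.of_le (m := 1) (by exact_mod_cast le_top)).eventually
  have h2 : ContDiffAt ℝ ∞ (fun y' => cpull Φ α (g y') ∘L fderiv ℝ g y') y :=
    (hα.comp y h.contDiffAt).clm_comp (h.contDiffAt.fderiv_right (m := ∞) (by simp))
  refine h2.congr_of_eventuallyEq ?_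
  filter_upwards [h1] with y' hy' using hy'.cpull_eq α

end ParamChange

namespace IsParam

variable {Ψ : D → N} {Ω : Set D}

theorem exists_change (h : IsParam E Ψ Ω) (p₀ : N) {y : D} (hy : y ∈ Ω)
    (hp : Ψ y ∈ (extChartAt 𝓘(ℝ, E) p₀).source) :
    ∃ (g : D → E) (k : E → D), g y = extChartAt 𝓘(ℝ, E) p₀ (Ψ y) ∧
      ParamChange E ∞ Ψ (extChartAt 𝓘(ℝ, E) p₀).symm g k y := by
  obtain ⟨g, k, h1, h2, h3, h4, h5, h6, h7, h8, h9⟩ := h.exists_chart p₀ hy hp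
  refine ⟨g, k, h3, h1, h2, h5, h6, h8, h9, h.smooth y hy, ?_⟩
  exact (isParam_chart p₀).smooth _ h7.self_of_nhds

/-- Compares `Ψ` with the chart centred at `Ψ y`; the two implications are one transformation lemma
applied to the change and to its inverse. -/
theorem smoothVecAt_iff (h : IsParam E Ψ Ω) {x : ∀ p : N, TangentSpace 𝓘(ℝ, E) p} {y : D}
    (hy : y ∈ Ω) : SmoothVecAt E x (Ψ y) ↔ ContDiffAt ℝ ∞ (vpull (E := E) Ψ x) y := by
  have hs := mem_extChartAt_source (I := 𝓘(ℝ, E)) (Ψ y)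
  obtain ⟨g, k, hg, hc⟩ := h.exists_change (Ψ y) hy hs
  rw [smoothVecAt_iff_chart hs, ← hg]
  refine ⟨fun hx => hc.contDiffAt_vpull hx, fun hx => hc.symm.contDiffAt_vpull ?_⟩
  rwa [hc.left_inv.self_of_nhds]

theorem smoothFormAt_iff (h : IsParam E Ψ Ω) {α : ∀ p : N, TangentSpace 𝓘(ℝ, E) p →L[ℝ] F} {y : D}
    (hy : y ∈ Ω) : SmoothFormAt α (Ψ y) ↔ ContDiffAt ℝ ∞ (cpull (E := E) Ψ α) y := by
  have hs := mem_extChartAt_source (I := 𝓘(ℝ, E)) (Ψ y)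
  obtain ⟨g, k, hg, hc⟩ := h.exists_change (Ψ y) hy hs
  rw [smoothFormAt_iff_chart hs, ← hg]
  refine ⟨fun hx => hc.contDiffAt_cpull hx, fun hx => hc.symm.contDiffAt_cpull ?_⟩
  rwa [hc.left_inv.self_of_nhds]

end IsParam

end Change

/-! ### Linear algebra of the complexification. -/

namespace Cplx

section
variable {V W : Type*} [AddCommGroup V] [Module ℝ V] [TopologicalSpace V]
  [AddCommGroup W] [Module ℝ W] [TopologicalSpace W]

theorem eval_def (α : V →L[ℝ] ℂ) (u : Cplx V) : eval α u = α u.re + Complex.I * α u.im := rfl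

theorem eval_add (α : V →L[ℝ] ℂ) (u w : Cplx V) : eval α (u + w) = eval α u + eval α w := by
  simp only [eval_def, re_add, im_add, map_add]; ring

theorem eval_smul (α : V →L[ℝ] ℂ) (c : ℂ) (u : Cplx V) : eval α (c • u) = c * eval α u := by
  simp only [eval_def, re_smul, im_smul, map_add, map_sub, map_smul, Complex.real_smul]
  conv_rhs => rw [← Complex.re_add_im c]
  linear_combination (-(c.im * α u.im)) * Complex.I_sq

theorem eval_zero (α : V →L[ℝ] ℂ) : eval α (0 : Cplx V) = 0 := by
  simp [eval_def]

theorem eval_sub (α : V →L[ℝ] ℂ) (u w : Cplx V) : eval α (u - w) = eval α u - eval α w := by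
  have : u - w = u + (-1 : ℂ) • w := by simp [sub_eq_add_neg]
  rw [this, eval_add, eval_smul]; ring

theorem add_eval (α β : V →L[ℝ] ℂ) (u : Cplx V) : eval (α + β) u = eval α u + eval β u := by
  simp only [eval_def, add_apply]; ring

theorem smul_eval (c : ℂ) (α : V →L[ℝ] ℂ) (u : Cplx V) : eval (c • α) u = c * eval α u := by
  simp only [eval_def, smul_apply, smul_eq_mul]; ring

theorem map_add' (T : V →L[ℝ] W) (u w : Cplx V) : map T (u + w) = map T u + map T w := by
  apply ext' <;> simp [map]

theorem map_smul' (T : V →L[ℝ] W) (c : ℂ) (u : Cplx V) : map T (c • u) = c • map T u := by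
  apply ext' <;> simp [map]

theorem contract₂_apply (η : V [⋀^Fin 2]→L[ℝ] ℂ) (u : Cplx V) (w : V) :
    contract₂ η u w = η ![u.re, w] + Complex.I * η ![u.im, w] := by
  simp only [contract₂, add_apply, smul_apply, smul_eq_mul]
  have h : ∀ v : V, η.toContinuousLinearMap ![v, 0] 1 w = η ![v, w] := fun v =>
    congrArg η (by ext i; fin_cases i <;> rfl)
  rw [h, h]

theorem contractReal_apply (H : V [⋀^Fin 3]→L[ℝ] ℝ) (u w z : V) :
    contractReal H u w z = H ![u, w, z] := by
  simp only [contractReal, ContinuousLinearMap.comp_apply, Complex.ofRealCLM_apply]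
  exact congrArg (fun r : ℝ => (r : ℂ)) (congrArg H (by ext i; fin_cases i <;> rfl))

end

end Cplx

/-! ### Components of complex vector fields and 1-forms in a parametrization. -/

section Components

variable {E : Type*} [NormedAddCommGroup E] [NormedSpace ℝ E]
  {N : Type*} [TopologicalSpace N] [ChartedSpace E N]
  {D : Type*} [NormedAddCommGroup D] [NormedSpace ℝ D] [FiniteDimensional ℝ D]
  {κ : Type*} [Fintype κ] (b : Module.Basis κ ℝ D) (Ψ : D → N)

/-- The coframe on the manifold dual to the frame given by a parametrization and a basis. -/
def coframe (i : κ) (y : D) : E →L[ℝ] ℂ :=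
  Complex.ofRealCLM ∘L (LinearMap.toContinuousLinearMap (b.coord i)) ∘L (dM D E Ψ y).inverse

/-- Components of a complex vector field. -/
def vco (x : N → Cplx E) (i : κ) (y : D) : ℂ := Cplx.eval (coframe b Ψ i y) (x (Ψ y))

/-- Components of a complex 1-form. -/
def fco (α : N → E →L[ℝ] ℂ) (i : κ) (y : D) : ℂ := α (Ψ y) (dM D E Ψ y (b i))

theorem vco_eq (x : N → Cplx E) (i : κ) (y : D) :
    vco b Ψ x i y = ((b.coord i (vpull Ψ (fun q => (x q).re) y) : ℝ) : ℂ)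
      + Complex.I * ((b.coord i (vpull Ψ (fun q => (x q).im) y) : ℝ) : ℂ) := rfl

theorem fco_eq (α : N → E →L[ℝ] ℂ) (i : κ) (y : D) :
    fco b Ψ α i y = cpull Ψ α y (b i) := rfl

variable {b Ψ} {y : D} (hinv : (dM D E Ψ y).IsInvertible)

include hinv in
theorem coframe_frame [DecidableEq κ] (i j : κ) :
    coframe (E := E) b Ψ i y (dM D E Ψ y (b j)) = if j = i then 1 else 0 := by
  obtain ⟨e, he⟩ := hinv
  simp only [coframe, ← he, ContinuousLinearMap.inverse_equiv]
  by_cases h : j = i <;> simp [h]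

include hinv in
theorem sum_coframe (α : E →L[ℝ] ℂ) (v : E) :
    α v = ∑ i, α (dM D E Ψ y (b i)) * coframe b Ψ i y v := by
  obtain ⟨e, he⟩ := hinv
  have hv : v = ∑ i, b.coord i (e.symm v) • e (b i) := by
    simp only [← map_smul, ← map_sum, Module.Basis.coord_apply, b.sum_repr, e.apply_symm_apply]
  conv_lhs => rw [hv]
  simp only [map_sum, map_smul, coframe, ← he, ContinuousLinearMap.inverse_equiv]
  refine Finset.sum_congr rfl fun i _ => ?_
  simp [Complex.real_smul, mul_comm]

include hinv in
theorem eval_eq_sum (α : E →L[ℝ] ℂ) (u : Cplx E) :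
    Cplx.eval α u = ∑ i, α (dM D E Ψ y (b i)) * Cplx.eval (coframe b Ψ i y) u := by
  simp only [Cplx.eval_def, mul_add, Finset.sum_add_distrib]
  rw [sum_coframe hinv (b := b) α u.re, sum_coframe hinv (b := b) α u.im, Finset.mul_sum]
  congr 1
  exact Finset.sum_congr rfl fun i _ => by ring

-- The coframe is real, so the real and imaginary parts of a complex component are the coordinates
-- of the real and imaginary parts of the vector.
include hinv in
theorem vec_ext {u w : Cplx E}
    (h : ∀ i, Cplx.eval (coframe (E := E) b Ψ i y) u = Cplx.eval (coframe b Ψ i y) w) : u = w := by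
  obtain ⟨e, he⟩ := hinv
  have key : ∀ i, ((b.coord i (e.symm u.re) : ℝ) : ℂ) + Complex.I * (b.coord i (e.symm u.im) : ℝ)
      = ((b.coord i (e.symm w.re) : ℝ) : ℂ) + Complex.I * (b.coord i (e.symm w.im) : ℝ) := by
    intro i
    have := h i
    simp only [Cplx.eval_def, coframe, ← he, ContinuousLinearMap.inverse_equiv] at this
    exact this
  apply Cplx.ext'
  · apply e.symm.injective
    refine b.ext_elem fun i => ?_
    simpa using congrArg Complex.re (key i)
  · apply e.symm.injective
    refine b.ext_elem fun i => ?_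
    simpa using congrArg Complex.im (key i)

include hinv in
theorem cov_ext {α β : E →L[ℝ] ℂ} (h : ∀ i, α (dM D E Ψ y (b i)) = β (dM D E Ψ y (b i))) :
    α = β := by
  ext v
  rw [sum_coframe hinv (b := b) α v, sum_coframe hinv (b := b) β v]
  simp only [h]

variable [IsManifold 𝓘(ℝ, E) ∞ N] {Ω : Set D}

/-! ### Coordinate expressions of the operators -/

theorem vpull_re (x : N → Cplx E) (y : D) :
    vpull Ψ (fun p => (x p).re) y = ∑ i, (vco b Ψ x i y).re • b i := by
  conv_lhs => rw [← b.sum_repr (vpull Ψ (fun p => (x p).re) y)]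
  refine Finset.sum_congr rfl fun i _ => ?_
  rw [vco_eq]
  simp

theorem vpull_im (x : N → Cplx E) (y : D) :
    vpull Ψ (fun p => (x p).im) y = ∑ i, (vco b Ψ x i y).im • b i := by
  conv_lhs => rw [← b.sum_repr (vpull Ψ (fun p => (x p).im) y)]
  refine Finset.sum_congr rfl fun i _ => ?_
  rw [vco_eq]
  simp

theorem contDiffAt_vco_iff (x : N → Cplx E) :
    (ContDiffAt ℝ ∞ (vpull Ψ (fun p => (x p).re)) y ∧
      ContDiffAt ℝ ∞ (vpull Ψ (fun p => (x p).im)) y) ↔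
      ∀ i, ContDiffAt ℝ ∞ (vco b Ψ x i) y := by
  constructor
  · rintro ⟨h1, h2⟩ i
    have hc : ContDiff ℝ ∞ (fun v : D => ((b.coord i v : ℝ) : ℂ)) :=
      Complex.ofRealCLM.contDiff.comp (LinearMap.toContinuousLinearMap (b.coord i)).contDiff
    exact (hc.contDiffAt.comp y h1).add (contDiffAt_const.mul (hc.contDiffAt.comp y h2))
  · intro hx
    constructor
    · rw [show vpull Ψ (fun p => (x p).re) = fun y => ∑ i, (vco b Ψ x i y).re • b i from
        funext fun y => vpull_re x y]
      exact ContDiffAt.sum fun i _ =>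
        (Complex.reCLM.contDiff.contDiffAt.comp y (hx i)).smul contDiffAt_const
    · rw [show vpull Ψ (fun p => (x p).im) = fun y => ∑ i, (vco b Ψ x i y).im • b i from
        funext fun y => vpull_im x y]
      exact ContDiffAt.sum fun i _ =>
        (Complex.imCLM.contDiff.contDiffAt.comp y (hx i)).smul contDiffAt_const

theorem IsParam.smooth_vco_iff (h : IsParam E Ψ Ω) (hy : y ∈ Ω)
    (x : ∀ p : N, Cplx (TangentSpace 𝓘(ℝ, E) p)) :
    (SmoothVecAt E (fun p => (x p).re) (Ψ y) ∧ SmoothVecAt E (fun p => (x p).im) (Ψ y)) ↔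
      ∀ i, ContDiffAt ℝ ∞ (vco (E := E) b Ψ x i) y :=
  (and_congr (h.smoothVecAt_iff hy) (h.smoothVecAt_iff hy)).trans (contDiffAt_vco_iff x)

theorem contDiffAt_fco_iff (α : N → E →L[ℝ] ℂ) :
    ContDiffAt ℝ ∞ (cpull Ψ α) y ↔ ∀ i, ContDiffAt ℝ ∞ (fco b Ψ α i) y := by
  constructor
  · intro h1 i
    exact h1.clm_apply contDiffAt_const
  · intro h1
    have h2 : cpull Ψ α = fun y => ∑ i, fco b Ψ α i y •
        (Complex.ofRealCLM ∘L LinearMap.toContinuousLinearMap (b.coord i)) := by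
      ext y v
      conv_lhs => rw [← b.sum_repr v]
      simp only [map_sum, map_smul, sum_apply, smul_apply]
      refine Finset.sum_congr rfl fun i _ => ?_
      rw [fco_eq]
      simp [Complex.real_smul, mul_comm]
    rw [h2]
    exact ContDiffAt.sum fun i _ => (h1 i).smul contDiffAt_const

theorem IsParam.smooth_fco_iff (h : IsParam E Ψ Ω) (hy : y ∈ Ω)
    (α : ∀ p : N, TangentSpace 𝓘(ℝ, E) p →L[ℝ] ℂ) :
    SmoothFormAt α (Ψ y) ↔ ∀ i, ContDiffAt ℝ ∞ (fco (E := E) b Ψ α i) y :=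
  (h.smoothFormAt_iff hy).trans (contDiffAt_fco_iff α)

/-- Naturality of the Lie bracket under pullback, followed by the formula `dW(V) - dV(W)` on a
vector space. -/
theorem IsParam.vpull_mlieBracket [CompleteSpace E] (h : IsParam E Ψ Ω) (hy : y ∈ Ω)
    {x z : ∀ p : N, TangentSpace 𝓘(ℝ, E) p} (hx : SmoothVecAt E x (Ψ y))
    (hz : SmoothVecAt E z (Ψ y)) :
    vpull (E := E) Ψ (VectorField.mlieBracket 𝓘(ℝ, E) x z) y
      = fderiv ℝ (vpull (E := E) Ψ z) y (vpull (E := E) Ψ x y)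
        - fderiv ℝ (vpull (E := E) Ψ x) y (vpull (E := E) Ψ z y) := by
  have : CompleteSpace D := FiniteDimensional.complete ℝ D
  have : IsManifold 𝓘(ℝ, E) (minSmoothness ℝ 3) N := IsManifold.of_le (n := ∞) (by
    simp only [minSmoothness_of_isRCLikeNormedField]; exact WithTop.coe_le_coe.2 le_top)
  have key := VectorField.mpullback_mlieBracket (I := 𝓘(ℝ, D)) (I' := 𝓘(ℝ, E)) (f := Ψ)
    (V := x) (W := z) (x₀ := y) (n := ∞) (ContMDiffAt.mdifferentiableAt hx (by simp))
    (ContMDiffAt.mdifferentiableAt hz (by simp)) (h.smooth y hy) (by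
    simp only [minSmoothness_of_isRCLikeNormedField]; exact WithTop.coe_le_coe.2 le_top)
  have k2 := VectorField.mlieBracketWithin_eq_lieBracketWithin (𝕜 := ℝ) (E := D)
    (V := VectorField.mpullback 𝓘(ℝ, D) 𝓘(ℝ, E) Ψ x)
    (W := VectorField.mpullback 𝓘(ℝ, D) 𝓘(ℝ, E) Ψ z) (s := univ)
  rw [VectorField.mlieBracketWithin_univ] at k2
  rw [k2] at key
  have k3 : ∀ V W : D → D, VectorField.lieBracketWithin ℝ V W univ y
      = fderiv ℝ W y (V y) - fderiv ℝ V y (W y) := fun V W => by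
    rw [VectorField.lieBracketWithin_univ]; rfl
  exact key.trans (k3 _ _)

theorem fderiv_complex_coord {X1 X2 : D → D} (h1 : ContDiffAt ℝ ∞ X1 y) (h2 : ContDiffAt ℝ ∞ X2 y)
    (i : κ) (w : D) :
    fderiv ℝ (fun y => ((b.coord i (X1 y) : ℝ) : ℂ) + Complex.I * (b.coord i (X2 y) : ℝ)) y w
      = ((b.coord i (fderiv ℝ X1 y w) : ℝ) : ℂ)
        + Complex.I * ((b.coord i (fderiv ℝ X2 y w) : ℝ) : ℂ) := by
  let c : D →L[ℝ] ℂ := Complex.ofRealCLM ∘L LinearMap.toContinuousLinearMap (b.coord i)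
  have e1 := (c.hasFDerivAt.comp y (h1.differentiableAt (by simp)).hasFDerivAt)
  have e2 := (c.hasFDerivAt.comp y (h2.differentiableAt (by simp)).hasFDerivAt).const_mul Complex.I
  have e3 := (e1.add e2).fderiv
  have e4 : (fun y => ((b.coord i (X1 y) : ℝ) : ℂ) + Complex.I * (b.coord i (X2 y) : ℝ)) =
    (c ∘ X1) + fun y => Complex.I * (c ∘ X2) y := rfl
  rw [e4, e3]
  rfl

/-- The complex-bilinear extension consists of four real brackets. Expanding each vector in the
basis, they recombine into the usual coordinate formula with complex components, the cross terms
matching through `I² = -1`. -/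
theorem complex_bracket_coord {X1 X2 Z1 Z2 : D → D} (hX1 : ContDiffAt ℝ ∞ X1 y)
    (hX2 : ContDiffAt ℝ ∞ X2 y) (hZ1 : ContDiffAt ℝ ∞ Z1 y) (hZ2 : ContDiffAt ℝ ∞ Z2 y) (j : κ) :
    ((b.coord j ((fderiv ℝ Z1 y (X1 y) - fderiv ℝ X1 y (Z1 y))
        - (fderiv ℝ Z2 y (X2 y) - fderiv ℝ X2 y (Z2 y))) : ℝ) : ℂ)
      + Complex.I * ((b.coord j ((fderiv ℝ Z2 y (X1 y) - fderiv ℝ X1 y (Z2 y))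
        + (fderiv ℝ Z1 y (X2 y) - fderiv ℝ X2 y (Z1 y))) : ℝ) : ℂ)
    = ∑ i, ((((b.coord i (X1 y) : ℝ) : ℂ) + Complex.I * (b.coord i (X2 y) : ℝ)) *
          fderiv ℝ (fun y => ((b.coord j (Z1 y) : ℝ) : ℂ) + Complex.I * (b.coord j (Z2 y) : ℝ)) y
            (b i)
        - (((b.coord i (Z1 y) : ℝ) : ℂ) + Complex.I * (b.coord i (Z2 y) : ℝ)) *
          fderiv ℝ (fun y => ((b.coord j (X1 y) : ℝ) : ℂ) + Complex.I * (b.coord j (X2 y) : ℝ)) y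
            (b i)) := by
  have exp : ∀ (T : D →L[ℝ] D) (v : D),
      b.coord j (T v) = ∑ i, b.coord i v * b.coord j (T (b i)) := by
    intro T v
    conv_lhs => rw [← b.sum_repr v]
    simp only [map_sum, map_smul, smul_eq_mul]
    rfl
  simp only [fderiv_complex_coord hX1 hX2, fderiv_complex_coord hZ1 hZ2]
  simp only [map_sub, map_add, exp _ (X1 y), exp _ (X2 y), exp _ (Z1 y), exp _ (Z2 y)]
  push_cast
  simp only [← Finset.sum_sub_distrib, ← Finset.sum_add_distrib, Finset.mul_sum]
  refine Finset.sum_congr rfl fun i _ => ?_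
  linear_combination (-((b.coord i (X2 y) : ℝ) : ℂ) * (b.coord j (fderiv ℝ Z2 y (b i)) : ℝ)
    + ((b.coord i (Z2 y) : ℝ) : ℂ) * (b.coord j (fderiv ℝ X2 y (b i)) : ℝ)) * Complex.I_sq

theorem IsParam.vco_lieC [CompleteSpace E] (h : IsParam E Ψ Ω) (hy : y ∈ Ω)
    {x z : ∀ p : N, Cplx (TangentSpace 𝓘(ℝ, E) p)}
    (hx : SmoothVecAt E (fun p => (x p).re) (Ψ y) ∧ SmoothVecAt E (fun p => (x p).im) (Ψ y))
    (hz : SmoothVecAt E (fun p => (z p).re) (Ψ y) ∧ SmoothVecAt E (fun p => (z p).im) (Ψ y))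
    (j : κ) :
    vco (E := E) b Ψ (lieC x z) j y = ∑ i,
      (vco (E := E) b Ψ x i y * fderiv ℝ (vco (E := E) b Ψ z j) y (b i)
        - vco (E := E) b Ψ z i y * fderiv ℝ (vco (E := E) b Ψ x j) y (b i)) := by
  have l1 := h.vpull_mlieBracket hy hx.1 hz.1
  have l2 := h.vpull_mlieBracket hy hx.2 hz.2
  have l3 := h.vpull_mlieBracket hy hx.1 hz.2
  have l4 := h.vpull_mlieBracket hy hx.2 hz.1
  have x1 := (h.smoothVecAt_iff hy).1 hx.1
  have x2 := (h.smoothVecAt_iff hy).1 hx.2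
  have z1 := (h.smoothVecAt_iff hy).1 hz.1
  have z2 := (h.smoothVecAt_iff hy).1 hz.2
  have key := complex_bracket_coord (b := b) x1 x2 z1 z2 j
  rw [← l1, ← l2, ← l3, ← l4] at key
  refine Eq.trans ?_ key
  have lin : ∀ (T : E →L[ℝ] D) (v w v' w' : E),
      ((b.coord j (T (v - w)) : ℝ) : ℂ) + Complex.I * ((b.coord j (T (v' + w')) : ℝ) : ℂ)
        = ((b.coord j (T v - T w) : ℝ) : ℂ) + Complex.I * ((b.coord j (T v' + T w') : ℝ) : ℂ) := by
    intro T v w v' w'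
    rw [map_sub T, map_add T]
  exact lin (dM D E Ψ y).inverse _ _ _ _

end Components

/-! ### Exterior derivatives and alternating forms in a parametrization. -/

section Forms

variable {E : Type*} [NormedAddCommGroup E] [NormedSpace ℝ E]
  {N : Type*} [TopologicalSpace N] [ChartedSpace E N]
  {D : Type*} [NormedAddCommGroup D] [NormedSpace ℝ D]
  {D' : Type*} [NormedAddCommGroup D'] [NormedSpace ℝ D']
  {F : Type*} [NormedAddCommGroup F] [NormedSpace ℝ F] {k : ℕ}

/-- The pullback of a `k`-form. -/
def apull (Ψ : D → N) (θ : N → E [⋀^Fin k]→L[ℝ] F) (y : D) : D [⋀^Fin k]→L[ℝ] F :=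
  (θ (Ψ y)).compContinuousLinearMap (dM D E Ψ y)

variable [IsManifold 𝓘(ℝ, E) ∞ N]

theorem ParamChange.apull_eq {Ψ : D → N} {Φ : D' → N} {g : D → D'} {l : D' → D} {y : D}
    (h : ParamChange E 1 Ψ Φ g l y) (θ : N → E [⋀^Fin k]→L[ℝ] F) :
    apull Ψ θ y = (apull Φ θ (g y)).compContinuousLinearMap (fderiv ℝ g y) := by
  rw [apull, h.dM_eq, h.eq.eq_of_nhds]; rfl

/-- `extD` is computed in the chart at `Ψ y`. The exterior derivative commutes with pullback by the
transition map `g` from the parametrization to that chart. -/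
theorem IsParam.extD_eq {Ψ : D → N} {Ω : Set D} (h : IsParam E Ψ Ω) {y : D} (hy : y ∈ Ω)
    (θ : N → E [⋀^Fin k]→L[ℝ] F)
    (hθ : DifferentiableAt ℝ (apull (extChartAt 𝓘(ℝ, E) (Ψ y)).symm θ)
      (extChartAt 𝓘(ℝ, E) (Ψ y) (Ψ y))) :
    apull Ψ (fun p => extD (E := E) θ p) y = extDeriv (apull Ψ θ) y := by
  have hs := mem_extChartAt_source (I := 𝓘(ℝ, E)) (Ψ y)
  obtain ⟨g, l, hg, hc⟩ := h.exists_change (Ψ y) hy hs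
  have hc1 := hc.of_le (m := 1) (by exact_mod_cast le_top)
  have e1 : extDeriv (apull Ψ θ) y = extDeriv (fun y' =>
      (apull (extChartAt 𝓘(ℝ, E) (Ψ y)).symm θ (g y')).compContinuousLinearMap (fderiv ℝ g y')) y :=
    Filter.EventuallyEq.extDeriv_eq (by
      filter_upwards [hc1.eventually] with y' hy' using hy'.apull_eq θ)
  rw [← hg] at hθ
  rw [e1, extDeriv_pullback hθ hc.contDiffAt (by
    simp only [minSmoothness_of_isRCLikeNormedField]; exact WithTop.coe_le_coe.2 le_top)]
  -- Near `y` the map `g` is the chart after `Ψ`, so the chart differential occurring in `extD`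
  -- combines with `dΨ` to `dg`.
  have e2 : dM E E (extChartAt 𝓘(ℝ, E) (Ψ y)) (Ψ y) ∘L dM D E Ψ y = fderiv ℝ g y := by
    have hφ : ContMDiffAt 𝓘(ℝ, E) 𝓘(ℝ, E) ∞ (extChartAt 𝓘(ℝ, E) (Ψ y)) (Ψ y) :=
      contMDiffAt_extChartAt
    have h4 : g =ᶠ[𝓝 y] fun y' => extChartAt 𝓘(ℝ, E) (Ψ y) (Ψ y') := by
      have ht : ∀ᶠ y' in 𝓝 y, g y' ∈ (extChartAt 𝓘(ℝ, E) (Ψ y)).target :=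
        hc.contDiffAt.continuousAt.eventually (by
          rw [hg]; exact extChartAt_target_mem_nhds (Ψ y))
      filter_upwards [hc.eq, ht] with y' h5 h6
      rw [h5, Function.comp_apply, PartialEquiv.right_inv _ h6]
    rw [← dM_eq_fderiv, dM_congr D E h4]
    exact (dM_comp D E E (hφ.mdifferentiableAt (by simp)) (h.mdifferentiableAt hy)).symm
  rw [← e2]
  ext v
  change extDeriv _ _ _ = extDeriv _ _ _
  rw [hg]
  rfl

/-- The formula `dα(∂_v, ∂_w) = ∂_v α_w - ∂_w α_v` for constant directions `v` and `w`; the bracket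
term is absent because coordinate fields commute. -/
theorem IsParam.dForm_apply {Ψ : D → N} {Ω : Set D} (h : IsParam E Ψ Ω) {y : D} (hy : y ∈ Ω)
    {α : ∀ p : N, TangentSpace 𝓘(ℝ, E) p →L[ℝ] ℂ} (hα : SmoothFormAt α (Ψ y)) (v w : D) :
    (dForm (E := E) α (Ψ y) : E [⋀^Fin 2]→L[ℝ] ℂ) ![dM D E Ψ y v, dM D E Ψ y w]
      = fderiv ℝ (fun y => cpull (E := E) Ψ α y w) y v
        - fderiv ℝ (fun y => cpull (E := E) Ψ α y v) y w := by
  have hs := mem_extChartAt_source (I := 𝓘(ℝ, E)) (Ψ y)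
  let L := ContinuousAlternatingMap.ofSubsingletonLIE (𝕜 := ℝ) (E := D) (F := ℂ) (0 : Fin 1)
  let L' := ContinuousAlternatingMap.ofSubsingletonLIE (𝕜 := ℝ) (E := E) (F := ℂ) (0 : Fin 1)
  have h1 : DifferentiableAt ℝ (fun u => L' (cpull (E := E) (extChartAt 𝓘(ℝ, E) (Ψ y)).symm α u))
      (extChartAt 𝓘(ℝ, E) (Ψ y) (Ψ y)) :=
    L'.toContinuousLinearEquiv.differentiableAt.comp _
      (((smoothFormAt_iff_chart hs).1 hα).differentiableAt (by simp))
  have h2 : DifferentiableAt ℝ (fun u => L (cpull (E := E) Ψ α u)) y :=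
    L.toContinuousLinearEquiv.differentiableAt.comp _
      (((h.smoothFormAt_iff hy).1 hα).differentiableAt (by simp))
  have key := h.extD_eq hy
    (fun q => ContinuousAlternatingMap.ofSubsingleton ℝ _ ℂ (0 : Fin 1) (α q)) h1
  have k2 := congrArg (fun η => η ![v, w]) key
  have k3 := extDeriv_apply h2 ![v, w]
  have k4 := k2.trans k3
  rw [Fin.sum_univ_two] at k4
  have k5 : (dForm (E := E) α (Ψ y) : E [⋀^Fin 2]→L[ℝ] ℂ) ![dM D E Ψ y v, dM D E Ψ y w]
    = apull Ψ (fun p => extD (E := E) (fun q =>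
      ContinuousAlternatingMap.ofSubsingleton ℝ _ ℂ (0 : Fin 1) (α q)) p) y ![v, w] :=
    congrArg (dForm (E := E) α (Ψ y) : E [⋀^Fin 2]→L[ℝ] ℂ) (by ext i; fin_cases i <;> rfl)
  refine (k5.trans k4).trans ?_
  simp only [Fin.val_zero, pow_zero, one_smul, Fin.val_one, pow_one, neg_smul, ← sub_eq_add_neg]
  rfl

theorem IsParam.dFun_apply {Ψ : D → N} {Ω : Set D} (h : IsParam E Ψ Ω) {y : D} (hy : y ∈ Ω)
    {f : N → ℂ} (hf : ContMDiffAt 𝓘(ℝ, E) 𝓘(ℝ, ℂ) ∞ f (Ψ y)) (w : D) :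
    (dFun (E := E) f (Ψ y) : E →L[ℝ] ℂ) (dM D E Ψ y w) = fderiv ℝ (f ∘ Ψ) y w := by
  have h1 := dM_comp D E ℂ (hf.mdifferentiableAt (by simp)) (h.mdifferentiableAt hy)
  rw [dM_eq_fderiv] at h1
  exact (congrArg (fun T : D →L[ℝ] ℂ => T w) h1).symm

/-- Expanding every argument in a basis turns the value into a finite sum of products of coordinates
with values on basis vectors, each of which is smooth. -/
theorem contDiffAt_alternating_apply [FiniteDimensional ℝ E] {η : D → E [⋀^Fin k]→L[ℝ] F}
    {v : Fin k → D → E} {y : D} (hη : ContDiffAt ℝ ∞ η y) (hv : ∀ i, ContDiffAt ℝ ∞ (v i) y) :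
    ContDiffAt ℝ ∞ (fun y => η y (fun i => v i y)) y := by
  let c := Module.finBasis ℝ E
  have e : (fun y => η y (fun i => v i y)) = fun y => ∑ l : Fin k → Fin (Module.finrank ℝ E),
      (∏ i, c.coord (l i) (v i y)) • η y (fun i => c (l i)) := by
    funext y
    have : (fun i => v i y) = fun i => ∑ j, c.coord j (v i y) • c j := by
      funext i; exact (c.sum_repr _).symm
    rw [this, ContinuousAlternatingMap.map_sum]
    refine Finset.sum_congr rfl fun l _ => ?_
    exact (η y).toMultilinearMap.map_smul_univ _ _
  rw [e]
  refine ContDiffAt.sum fun l _ => ContDiffAt.smul (contDiffAt_prod fun i _ => ?_) ?_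
  · exact (LinearMap.toContinuousLinearMap (c.coord (l i))).contDiff.contDiffAt.comp y (hv i)
  · exact (ContinuousAlternatingMap.apply ℝ E F (fun i => c (l i))).contDiff.contDiffAt.comp y hη

theorem IsParam.contDiffAt_apull_apply [FiniteDimensional ℝ E] {Ψ : D → N} {Ω : Set D}
    (h : IsParam E Ψ Ω) {y : D} (hy : y ∈ Ω)
    {θ : ∀ p : N, TangentSpace 𝓘(ℝ, E) p [⋀^Fin k]→L[ℝ] F}
    (hθ : ∀ p₀ : N, ContDiffOn ℝ ∞ (chartForm p₀ θ) (extChartAt 𝓘(ℝ, E) p₀).target)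
    (v : Fin k → D) :
    ContDiffAt ℝ ∞ (fun y => apull (E := E) Ψ θ y v) y := by
  have hs := mem_extChartAt_source (I := 𝓘(ℝ, E)) (Ψ y)
  obtain ⟨g, l, hg, hc⟩ := h.exists_change (Ψ y) hy hs
  have hc1 := hc.of_le (m := 1) (by exact_mod_cast le_top)
  have h1 : ContDiffAt ℝ ∞ (apull (E := E) (extChartAt 𝓘(ℝ, E) (Ψ y)).symm θ) (g y) := by
    rw [hg]
    exact (hθ (Ψ y)).contDiffAt (extChartAt_target_mem_nhds (Ψ y))
  have h2 : ContDiffAt ℝ ∞ (fun y' => apull (E := E) (extChartAt 𝓘(ℝ, E) (Ψ y)).symm θ (g y')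
      (fun i => fderiv ℝ g y' (v i))) y :=
    contDiffAt_alternating_apply (h1.comp y hc.contDiffAt) fun i =>
      (hc.contDiffAt.fderiv_right (m := ∞) (by simp)).clm_apply contDiffAt_const
  refine h2.congr_of_eventuallyEq ?_
  filter_upwards [hc1.eventually] with y' hy'
  exact congrArg (fun η => η v) (hy'.apull_eq (F := F) θ)

end Forms

/-! ### The bracket as a polynomial in components and derivatives. -/

section Algebra

variable {κ : Type*} [Fintype κ]

/-- The vector part of the bracket in terms of components and their derivatives. -/
def bracketVec (x : κ → ℂ) (dx : κ → κ → ℂ) (z : κ → ℂ) (dz : κ → κ → ℂ) (j : κ) : ℂ :=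
  ∑ i, (x i * dz i j - z i * dx i j)

/-- The form part of the bracket in terms of components and their derivatives. -/
def bracketForm (h : κ → κ → κ → ℂ) (x : κ → ℂ) (dx dα : κ → κ → ℂ)
    (z β : κ → ℂ) (dβ : κ → κ → ℂ) (j : κ) : ℂ :=
  ∑ i, (x i * dβ i j + β i * dx j i - z i * (dα i j - dα j i))
    + ∑ i, ∑ k, z i * x k * h i k j

end Algebra

/-! ### Coordinate formulas for the Dorfman and derived brackets. -/

section Components

variable {E : Type*} [NormedAddCommGroup E] [NormedSpace ℝ E]
  {N : Type*} [TopologicalSpace N] [ChartedSpace E N]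
  {D : Type*} [NormedAddCommGroup D] [NormedSpace ℝ D] [FiniteDimensional ℝ D]
  {κ : Type*} [Fintype κ] {b : Module.Basis κ ℝ D} {Ψ : D → N} {y : D}

theorem vec_eq_sum (hinv : (dM D E Ψ y).IsInvertible) (u : Cplx E) :
    u.re = ∑ i, (Cplx.eval (coframe (E := E) b Ψ i y) u).re • dM D E Ψ y (b i) ∧
    u.im = ∑ i, (Cplx.eval (coframe (E := E) b Ψ i y) u).im • dM D E Ψ y (b i) := by
  obtain ⟨e, he⟩ := hinv
  have hv : ∀ v : E, v = ∑ i, b.coord i (e.symm v) • e (b i) := fun v => by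
    simp only [← map_smul, ← map_sum, Module.Basis.coord_apply, b.sum_repr, e.apply_symm_apply]
  constructor
  · conv_lhs => rw [hv u.re]
    refine Finset.sum_congr rfl fun i _ => ?_
    simp [Cplx.eval_def, coframe, ← he, ContinuousLinearMap.inverse_equiv]
  · conv_lhs => rw [hv u.im]
    refine Finset.sum_congr rfl fun i _ => ?_
    simp [Cplx.eval_def, coframe, ← he, ContinuousLinearMap.inverse_equiv]

theorem alternating_three_sum (H : E [⋀^Fin 3]→L[ℝ] ℝ) (c d : κ → ℝ) (f : κ → E) (w : E) :
    H ![∑ i, c i • f i, ∑ j, d j • f j, w] = ∑ i, ∑ j, c i * d j * H ![f i, f j, w] := by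
  have e1 : ∀ v v' : E, H ![v, v', w] = H.toContinuousLinearMap ![0, v', w] 0 v := fun v v' =>
    congrArg H (by ext i; fin_cases i <;> rfl)
  have e2 : ∀ v v' : E, H ![v, v', w] = H.toContinuousLinearMap ![v, 0, w] 1 v' := fun v v' =>
    congrArg H (by ext i; fin_cases i <;> rfl)
  rw [e1]
  simp only [map_sum, map_smul, smul_eq_mul]
  refine Finset.sum_congr rfl fun i _ => ?_
  rw [← e1, e2]
  simp only [map_sum, map_smul, smul_eq_mul, Finset.mul_sum]
  simp only [← e2]
  exact Finset.sum_congr rfl fun j _ => by ring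

/-- Components of a real 3-form. -/
def hco (b : Module.Basis κ ℝ D) (Ψ : D → N) (H : N → E [⋀^Fin 3]→L[ℝ] ℝ) (y : D) (i j k : κ) : ℂ :=
  ((H (Ψ y) ![dM D E Ψ y (b i), dM D E Ψ y (b j), dM D E Ψ y (b k)] : ℝ) : ℂ)

theorem contract₃_frame (hinv : (dM D E Ψ y).IsInvertible) (H : N → E [⋀^Fin 3]→L[ℝ] ℝ)
    (u w : Cplx E) (k : κ) :
    Cplx.contract₃ (H (Ψ y)) u w (dM D E Ψ y (b k)) = ∑ i, ∑ j,
      Cplx.eval (coframe (E := E) b Ψ i y) u * Cplx.eval (coframe (E := E) b Ψ j y) w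
        * hco b Ψ H y i j k := by
  obtain ⟨u1, u2⟩ := vec_eq_sum (b := b) hinv u
  obtain ⟨w1, w2⟩ := vec_eq_sum (b := b) hinv w
  simp only [Cplx.contract₃, add_apply, sub_apply, smul_apply, Cplx.contractReal_apply, smul_eq_mul]
  rw [u1, u2, w1, w2]
  simp only [alternating_three_sum]
  push_cast
  simp only [← Finset.sum_sub_distrib, ← Finset.sum_add_distrib, Finset.mul_sum]
  refine Finset.sum_congr rfl fun i _ => Finset.sum_congr rfl fun j _ => ?_
  rw [hco]
  generalize Cplx.eval (coframe b Ψ i y) u = z1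
  generalize Cplx.eval (coframe b Ψ j y) w = z2
  conv_rhs => rw [← Complex.re_add_im z1, ← Complex.re_add_im z2]
  generalize (H (Ψ y) ![dM D E Ψ y (b i), dM D E Ψ y (b j), dM D E Ψ y (b k)]) = r
  linear_combination (-(z1.im * z2.im * r : ℂ)) * Complex.I_sq

variable [IsManifold 𝓘(ℝ, E) ∞ N] {Ω : Set D}

theorem IsParam.contract₂_dForm (h : IsParam E Ψ Ω) (hy : y ∈ Ω)
    {α : ∀ p : N, TangentSpace 𝓘(ℝ, E) p →L[ℝ] ℂ} (hα : SmoothFormAt α (Ψ y))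
    (u : Cplx E) (j : κ) (η : E [⋀^Fin 2]→L[ℝ] ℂ) (hη : η = dForm (E := E) α (Ψ y)) :
    Cplx.contract₂ η u (dM D E Ψ y (b j)) =
      ∑ i, Cplx.eval (coframe (E := E) b Ψ i y) u *
        (fderiv ℝ (fco (E := E) b Ψ α j) y (b i) - fderiv ℝ (fco (E := E) b Ψ α i) y (b j)) := by
  let T : E →L[ℝ] ℂ := η.toContinuousLinearMap ![0, dM D E Ψ y (b j)] 0
  have e : ∀ v : E, η ![v, dM D E Ψ y (b j)] = T v := fun v =>
    congrArg η (by ext i; fin_cases i <;> rfl)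
  have e1 : Cplx.contract₂ (V := E) η u (dM D E Ψ y (b j)) = Cplx.eval T u := by
    rw [Cplx.contract₂_apply, e, e]; rfl
  refine e1.trans ?_
  rw [eval_eq_sum (b := b) (h.isInvertible hy)]
  refine Finset.sum_congr rfl fun i _ => ?_
  rw [← e, mul_comm]
  congr 1
  rw [hη]
  exact h.dForm_apply hy hα (b i) (b j)

/-- Smoothness at a point of a section of the generalized tangent bundle. -/
structure SmoothGAt (a : ∀ p : N, GTan E p) (q : N) : Prop where
  re : SmoothVecAt E (fun p => (a p).1.re) q
  im : SmoothVecAt E (fun p => (a p).1.im) q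
  form : SmoothFormAt (fun p => (a p).2) q

theorem eval_comp (h : IsParam E Ψ Ω) (α : N → E →L[ℝ] ℂ) (x : N → Cplx E) (hy : y ∈ Ω) :
    Cplx.eval (α (Ψ y)) (x (Ψ y)) = ∑ i, fco b Ψ α i y * vco b Ψ x i y :=
  eval_eq_sum (b := b) (h.isInvertible hy) _ _

theorem IsParam.dFun_eval (h : IsParam E Ψ Ω) (hy : y ∈ Ω)
    {α : ∀ p : N, TangentSpace 𝓘(ℝ, E) p →L[ℝ] ℂ} {x : ∀ p : N, Cplx (TangentSpace 𝓘(ℝ, E) p)}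
    (hα : SmoothFormAt α (Ψ y))
    (hx : SmoothVecAt E (fun p => (x p).re) (Ψ y) ∧ SmoothVecAt E (fun p => (x p).im) (Ψ y))
    (j : κ) :
    (dFun (E := E) (fun q => Cplx.eval (α q) (x q)) (Ψ y) : E →L[ℝ] ℂ) (dM D E Ψ y (b j)) =
      ∑ i, (fderiv ℝ (fco (E := E) b Ψ α i) y (b j) * vco (E := E) b Ψ x i y
        + fco (E := E) b Ψ α i y * fderiv ℝ (vco (E := E) b Ψ x i) y (b j)) := by
  have ha := (h.smooth_fco_iff (b := b) hy α).1 hα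
  have hz := (h.smooth_vco_iff (b := b) hy x).1 hx
  have e1 : ((fun q => Cplx.eval (V := E) (α q) (x q)) ∘ Ψ) =ᶠ[𝓝 y]
      fun y => ∑ i, fco (E := E) b Ψ α i y * vco (E := E) b Ψ x i y := by
    filter_upwards [h.isOpen.mem_nhds hy] with y' hy'
    exact eval_comp h α x hy'
  have hs : ContDiffAt ℝ ∞ (fun y => ∑ i, fco (E := E) b Ψ α i y * vco (E := E) b Ψ x i y) y :=
    ContDiffAt.sum fun i _ => (ha i).mul (hz i)
  have hf := (h.contMDiffAt_iff hy).2 (hs.congr_of_eventuallyEq e1)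
  refine (h.dFun_apply hy hf (b j)).trans ?_
  rw [e1.fderiv_eq]
  have hd := HasFDerivAt.fun_sum (u := Finset.univ) fun i _ =>
    ((ha i).differentiableAt (by simp)).hasFDerivAt.mul
      ((hz i).differentiableAt (by simp)).hasFDerivAt
  have hd' := hd.fderiv
  refine (congrArg (fun T : D →L[ℝ] ℂ => T (b j)) hd').trans ?_
  simp only [sum_apply, add_apply, smul_apply, smul_eq_mul]
  exact Finset.sum_congr rfl fun i _ => by ring

/-- The correction `m τ(x) z - n τ(z) x` has components `∑ x_i (m τ_i z_j) - z_i (n τ_i x_j)`. Hence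
twisting by the line bundle only replaces partial derivatives by covariant ones. -/
theorem IsParam.derivedBracket_vec [CompleteSpace E] (h : IsParam E Ψ Ω) (hy : y ∈ Ω)
    (H : ∀ p : N, TangentSpace 𝓘(ℝ, E) p [⋀^Fin 3]→L[ℝ] ℝ)
    (τ : ∀ p : N, TangentSpace 𝓘(ℝ, E) p →L[ℝ] ℂ) (n m : ℤ) {a c : ∀ p : N, GTan E p}
    (ha : SmoothGAt a (Ψ y)) (hc : SmoothGAt c (Ψ y)) (j : κ) :
    vco (E := E) b Ψ (fun p => (derivedBracket H τ n m a c p).1) j y =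
      bracketVec (fun i => vco (E := E) b Ψ (fun p => (a p).1) i y)
        (fun i k => fderiv ℝ (vco (E := E) b Ψ (fun p => (a p).1) k) y (b i)
          + n * fco (E := E) b Ψ τ i y * vco (E := E) b Ψ (fun p => (a p).1) k y)
        (fun i => vco (E := E) b Ψ (fun p => (c p).1) i y)
        (fun i k => fderiv ℝ (vco (E := E) b Ψ (fun p => (c p).1) k) y (b i)
          + m * fco (E := E) b Ψ τ i y * vco (E := E) b Ψ (fun p => (c p).1) k y) j := by
  have h1 := h.vco_lieC (b := b) hy (x := fun p => (a p).1) (z := fun p => (c p).1)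
    ⟨ha.re, ha.im⟩ ⟨hc.re, hc.im⟩ j
  have lin : ∀ (γ : E →L[ℝ] ℂ) (u v w : Cplx E) (r s : ℂ),
      Cplx.eval γ (u + r • v - s • w) = Cplx.eval γ u + r * Cplx.eval γ v - s * Cplx.eval γ w := by
    intros; rw [Cplx.eval_sub, Cplx.eval_add, Cplx.eval_smul, Cplx.eval_smul]
  refine (lin (coframe b Ψ j y) _ _ _ _ _).trans ?_
  have e1 := eval_comp (b := b) h τ (fun p => (a p).1) hy
  have e2 := eval_comp (b := b) h τ (fun p => (c p).1) hy
  refine (congrArg₂ (fun s t : ℂ => s + (m * t) * _ - _) h1 e1).trans ?_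
  refine (congrArg (fun t : ℂ => _ - (n * t) * _) e2).trans ?_
  change _ + _ * vco (E := E) b Ψ (fun p => (c p).1) j y
    - _ * vco (E := E) b Ψ (fun p => (a p).1) j y = _
  simp only [bracketVec, Finset.mul_sum, Finset.sum_mul]
  rw [← Finset.sum_add_distrib, ← Finset.sum_sub_distrib]
  exact Finset.sum_congr rfl fun i _ => by ring

/-- The same principle for the form part. The term `-m β(x) τ` from contracting `τ ∧ β` cancels
against part of `(n + m) β(x) τ`; the remaining `n β(x) τ` turns the derivative of `x` in the Lie
derivative into a covariant one. -/
theorem IsParam.derivedBracket_form (h : IsParam E Ψ Ω) (hy : y ∈ Ω)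
    (H : ∀ p : N, TangentSpace 𝓘(ℝ, E) p [⋀^Fin 3]→L[ℝ] ℝ)
    (τ : ∀ p : N, TangentSpace 𝓘(ℝ, E) p →L[ℝ] ℂ) (n m : ℤ) {a c : ∀ p : N, GTan E p}
    (ha : SmoothGAt a (Ψ y)) (hc : SmoothGAt c (Ψ y)) (j : κ) :
    fco (E := E) b Ψ (fun p => (derivedBracket H τ n m a c p).2) j y =
      bracketForm (hco (E := E) b Ψ H y)
        (fun i => vco (E := E) b Ψ (fun p => (a p).1) i y)
        (fun i k => fderiv ℝ (vco (E := E) b Ψ (fun p => (a p).1) k) y (b i)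
          + n * fco (E := E) b Ψ τ i y * vco (E := E) b Ψ (fun p => (a p).1) k y)
        (fun i k => fderiv ℝ (fco (E := E) b Ψ (fun p => (a p).2) k) y (b i)
          + n * fco (E := E) b Ψ τ i y * fco (E := E) b Ψ (fun p => (a p).2) k y)
        (fun i => vco (E := E) b Ψ (fun p => (c p).1) i y)
        (fun i => fco (E := E) b Ψ (fun p => (c p).2) i y)
        (fun i k => fderiv ℝ (fco (E := E) b Ψ (fun p => (c p).2) k) y (b i)
          + m * fco (E := E) b Ψ τ i y * fco (E := E) b Ψ (fun p => (c p).2) k y) j := by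
  have h1 := h.contract₂_dForm (b := b) hy hc.form (a (Ψ y)).1 j _ rfl
  have h2 := h.dFun_eval (b := b) hy (x := fun p => (a p).1) hc.form ⟨ha.re, ha.im⟩ j
  have h3 := h.contract₂_dForm (b := b) hy ha.form (c (Ψ y)).1 j _ rfl
  have h4 := contract₃_frame (b := b) (h.isInvertible hy) H (c (Ψ y)).1 (a (Ψ y)).1 j
  have e1 := eval_comp (b := b) h τ (fun p => (a p).1) hy
  have e2 := eval_comp (b := b) h τ (fun p => (c p).1) hy
  have e3 := eval_comp (b := b) h (fun p => (c p).2) (fun p => (a p).1) hy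
  have e4 := eval_comp (b := b) h (fun p => (a p).2) (fun p => (c p).1) hy
  have lin : ∀ (P Q R S β α t : E →L[ℝ] ℂ) (r r' s s' q : ℂ) (v : E) {P' Q' R' S' u1 u2 u3 u4 : ℂ},
      P v = P' → Q v = Q' → R v = R' → S v = S' → r = u1 → s = u2 → r' = u3 → s' = u4 → q = u3 →
      ((P + (m : ℂ) • (r • β - r' • t) + (Q + (((n + m : ℤ) : ℂ) * q) • t)
        - (R + (n : ℂ) • (s • α - s' • t)) + S : E →L[ℝ] ℂ)) v
      = P' + m * (u1 * β v - u3 * t v) + (Q' + (n + m) * u3 * t v)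
        - (R' + n * (u2 * α v - u4 * t v)) + S' := by
    intro P Q R S β α t r r' s s' q v P' Q' R' S' u1 u2 u3 u4 g1 g2 g3 g4 g5 g6 g7 g8 g9
    subst g1 g2 g3 g4 g5 g6 g7 g8
    rw [g9]
    simp only [add_apply, sub_apply, smul_apply, smul_eq_mul]
    push_cast
    rfl
  refine (lin _ _ _ _ (c (Ψ y)).2 (a (Ψ y)).2 (τ (Ψ y)) _ _ _ _ _ (dM D E Ψ y (b j))
    h1 h2 h3 h4 e1 e2 e3 e4 e3).trans ?_
  change _ + m * (_ * fco (E := E) b Ψ (fun p => (c p).2) j y - _ * fco (E := E) b Ψ τ j y)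
    + (_ + _ * fco (E := E) b Ψ τ j y)
    - (_ + n * (_ * fco (E := E) b Ψ (fun p => (a p).2) j y - _ * fco (E := E) b Ψ τ j y))
    + ∑ i, ∑ k, vco (E := E) b Ψ (fun p => (c p).1) i y
      * vco (E := E) b Ψ (fun p => (a p).1) k y * hco (E := E) b Ψ H y i k j = _
  change ∑ i, vco (E := E) b Ψ (fun p => (a p).1) i y * _ + _ + _
    - (∑ i, vco (E := E) b Ψ (fun p => (c p).1) i y * _ + _) + _ = _
  rw [bracketForm]
  congr 1
  simp only [Finset.mul_sum, Finset.sum_mul, ← Finset.sum_sub_distrib, ← Finset.sum_add_distrib]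
  exact Finset.sum_congr rfl fun i _ => by ring

/-- Makes the Dorfman bracket the untwisted case `τ = 0`, `n = m = 0`, so a single coordinate
formula serves both brackets. -/
theorem derivedBracket_zero (H : ∀ p : N, TangentSpace 𝓘(ℝ, E) p [⋀^Fin 3]→L[ℝ] ℝ)
    (a c : ∀ p : N, GTan E p) (p : N) :
    derivedBracket H (fun _ => 0) 0 0 a c p = dorfman H a c p := by
  have l1 : ∀ (u v w : Cplx E) (r s : ℂ),
      u + (((0 : ℤ) : ℂ) * r) • v - (((0 : ℤ) : ℂ) * s) • w = u := by
    intros; simp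
  have l2 : ∀ (P Q R S β α t : E →L[ℝ] ℂ) (r r' s s' q : ℂ),
      P + ((0 : ℤ) : ℂ) • (r • β - r' • t) + (Q + (((0 + 0 : ℤ) : ℂ) * q) • t)
        - (R + ((0 : ℤ) : ℂ) • (s • α - s' • t)) + S = P + Q - R + S := by
    intros
    ext v
    simp
  exact Prod.ext (l1 _ _ _ _ _) (l2 _ _ _ _ _ _ 0 _ _ _ _ _)

end Components

/-! ### Local sections and tube coordinates on the total space. -/

namespace PrincipalCircleBundle

variable {EM M EZ Z : Type*}
  [NormedAddCommGroup EM] [NormedSpace ℝ EM] [TopologicalSpace M] [ChartedSpace EM M]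
  [NormedAddCommGroup EZ] [NormedSpace ℝ EZ] [TopologicalSpace Z] [ChartedSpace EZ Z]
  [MulAction Circle Z] (B : PrincipalCircleBundle EM M EZ Z)

include B in
theorem contMDiff_const_smul (z : Circle) : ContMDiff 𝓘(ℝ, EZ) 𝓘(ℝ, EZ) ∞ (fun q : Z => z • q) :=
  B.contMDiff_smul.comp (contMDiff_const.prodMk contMDiff_id)

theorem isLocalSection_smul {σ : M → Z} {U : Set M} (hσ : B.IsLocalSection σ U) (z : Circle) :
    B.IsLocalSection (fun x => z • σ x) U where
  isOpen := hσ.isOpen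
  smooth := (B.contMDiff_const_smul z).comp_contMDiffOn hσ.smooth
  proj_eq x hx := (B.proj_smul z _).trans (hσ.proj_eq x hx)

theorem exists_smul_eq {p q : Z} (h : B.proj p = B.proj q) : ∃ z : Circle, z • p = q := by
  obtain ⟨U, σ, θ, -, hx, -, -, -, -, h6⟩ := B.locally_trivial (B.proj p)
  have hp := h6 p hx
  have hq := h6 q (by rw [mem_preimage, ← h]; exact hx)
  refine ⟨θ q * (θ p)⁻¹, ?_⟩
  rw [← h] at hq
  calc (θ q * (θ p)⁻¹) • p = (θ q * (θ p)⁻¹) • (θ p • σ (B.proj p)) := by rw [hp]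
    _ = q := by rw [smul_smul, inv_mul_cancel_right, hq]

/-- A section of a local trivialization, rotated by the constant `θ p`, passes through `p`. -/
theorem exists_localSection (p : Z) :
    ∃ (σ : M → Z) (U : Set M), B.IsLocalSection σ U ∧ B.proj p ∈ U ∧ σ (B.proj p) = p := by
  obtain ⟨U, σ, θ, h1, hx, h2, h3, h4, h5, h6⟩ := B.locally_trivial (B.proj p)
  exact ⟨fun x => θ p • σ x, U, B.isLocalSection_smul ⟨h1, h2, h4⟩ _, hx, h6 p hx⟩

/-- Near the fibre over a point of `U`, a local section gives a smooth fibre coordinate. -/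
theorem exists_fibreCoord {σ : M → Z} {U : Set M} (hσ : B.IsLocalSection σ U) {x₀ : M}
    (hx₀ : x₀ ∈ U) : ∃ (V : Set M) (θ : Z → Circle), IsOpen V ∧ x₀ ∈ V ∧ V ⊆ U ∧
      ContMDiffOn 𝓘(ℝ, EZ) (𝓡 1) ∞ θ (B.proj ⁻¹' V) ∧
      (∀ x ∈ V, ∀ z : Circle, θ (z • σ x) = z) ∧ ∀ q ∈ B.proj ⁻¹' V, θ q • σ (B.proj q) = q := by
  obtain ⟨U', σ', θ', h1, hx, h2, h3, h4, h5, h6⟩ := B.locally_trivial x₀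
  have hθ : ∀ q ∈ B.proj ⁻¹' U', ∀ z : Circle, θ' (z • q) = z * θ' q := by
    intro q hq z
    conv_lhs => rw [← h6 q hq, smul_smul]
    exact h5 _ hq _
  refine ⟨U ∩ U', fun q => θ' q / θ' (σ (B.proj q)), hσ.isOpen.inter h1, ⟨hx₀, hx⟩,
    inter_subset_left, ?_, ?_, ?_⟩
  · have hs : ContMDiffOn 𝓘(ℝ, EZ) 𝓘(ℝ, EZ) ∞ (fun q => σ (B.proj q)) (B.proj ⁻¹' (U ∩ U')) :=
      (hσ.smooth.mono inter_subset_left).comp B.contMDiff_proj.contMDiffOn (fun q hq => hq)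
    exact (h3.mono (preimage_mono inter_subset_right)).div
      (h3.comp hs fun q hq => by
        have h := hσ.proj_eq _ hq.1
        exact (congrArg (· ∈ U') h).mpr hq.2)
  · intro x hx z
    have hp : B.proj (σ x) = x := hσ.proj_eq x hx.1
    simp only [B.proj_smul, hp]
    rw [hθ _ (by rw [mem_preimage, hp]; exact hx.2), mul_div_cancel_right]
  · intro q hq
    have hp : B.proj (σ (B.proj q)) = B.proj q := hσ.proj_eq _ hq.1
    have e1 := h6 (σ (B.proj q)) (by rw [mem_preimage, hp]; exact hq.2)
    rw [hp] at e1
    have e2 := h6 q hq.2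
    calc (θ' q / θ' (σ (B.proj q))) • σ (B.proj q)
        = (θ' q / θ' (σ (B.proj q))) • (θ' (σ (B.proj q)) • σ' (B.proj q)) := by rw [e1]
      _ = q := by rw [smul_smul, div_mul_cancel, e2]

variable (EM) in
/-- The domain of the coordinates on the base. -/
def chartDom (p₀ : M) (U : Set M) : Set EM :=
  (extChartAt 𝓘(ℝ, EM) p₀).target ∩ (extChartAt 𝓘(ℝ, EM) p₀).symm ⁻¹' U

variable (EM) in
/-- Coordinates on `Z` given by a chart of the base, a local section and the circle action. -/
def tube (σ : M → Z) (p₀ : M) (y : EM × ℝ) : Z :=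
  Circle.exp y.2 • σ ((extChartAt 𝓘(ℝ, EM) p₀).symm y.1)

variable {B} {σ : M → Z} {U : Set M} (hσ : B.IsLocalSection σ U) (p₀ : M)

include hσ in
theorem isOpen_chartDom : IsOpen (chartDom EM p₀ U) :=
  (continuousOn_extChartAt_symm p₀).isOpen_inter_preimage (isOpen_extChartAt_target p₀) hσ.isOpen

include hσ in
theorem isParam_base [IsManifold 𝓘(ℝ, EM) ∞ M] :
    IsParam EM (extChartAt 𝓘(ℝ, EM) p₀).symm (chartDom EM p₀ U) :=
  (isParam_chart p₀).mono (isOpen_chartDom hσ p₀) inter_subset_left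

include hσ in
theorem proj_tube {y : EM × ℝ} (hy : y.1 ∈ chartDom EM p₀ U) :
    B.proj (tube EM σ p₀ y) = (extChartAt 𝓘(ℝ, EM) p₀).symm y.1 :=
  (B.proj_smul _ _).trans (hσ.proj_eq _ hy.2)

theorem tube_add_two_pi (u : EM) (t : ℝ) :
    tube EM σ p₀ (u, t + 2 * Real.pi) = tube EM σ p₀ (u, t) := by
  simp [tube, Circle.exp_add, Circle.exp_two_pi]

theorem tube_eq_smul (u : EM) (t : ℝ) :
    tube EM σ p₀ (u, t) = Circle.exp t • tube EM σ p₀ (u, 0) := by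
  simp [tube]

theorem tube_add (u : EM) (t s : ℝ) :
    tube EM σ p₀ (u, t + s) = Circle.exp t • tube EM σ p₀ (u, s) := by
  simp [tube, Circle.exp_add, smul_smul]

include hσ in
theorem exists_tube_eq {p : Z} (hp : B.proj p ∈ U)
    (hs : B.proj p ∈ (extChartAt 𝓘(ℝ, EM) p₀).source) :
    extChartAt 𝓘(ℝ, EM) p₀ (B.proj p) ∈ chartDom EM p₀ U ∧
      ∃ t : ℝ, tube EM σ p₀ (extChartAt 𝓘(ℝ, EM) p₀ (B.proj p), t) = p := by
  have h1 := (extChartAt 𝓘(ℝ, EM) p₀).left_inv hs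
  refine ⟨⟨(extChartAt 𝓘(ℝ, EM) p₀).map_source hs, by rw [mem_preimage, h1]; exact hp⟩, ?_⟩
  obtain ⟨z, hz⟩ := B.exists_smul_eq (hσ.proj_eq _ hp)
  refine ⟨(z : ℂ).arg, ?_⟩
  simp only [tube, h1, Circle.exp_arg, hz]

include hσ in
theorem contMDiffAt_tube [IsManifold 𝓘(ℝ, EM) ∞ M] {y : EM × ℝ} (hy : y.1 ∈ chartDom EM p₀ U) :
    ContMDiffAt 𝓘(ℝ, EM × ℝ) 𝓘(ℝ, EZ) ∞ (tube EM σ p₀) y := by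
  have h1 : ContMDiffAt 𝓘(ℝ, EM × ℝ) (𝓡 1) ∞ (fun y : EM × ℝ => Circle.exp y.2) y :=
    contMDiff_circleExp.contMDiffAt.comp y contDiff_snd.contMDiff.contMDiffAt
  have h2 : ContMDiffAt 𝓘(ℝ, EM × ℝ) 𝓘(ℝ, EM) ∞
      (fun y : EM × ℝ => (extChartAt 𝓘(ℝ, EM) p₀).symm y.1) y :=
    ((isParam_base hσ p₀).smooth y.1 hy).comp y contDiff_fst.contMDiff.contMDiffAt
  have h3 : ContMDiffAt 𝓘(ℝ, EM × ℝ) 𝓘(ℝ, EZ) ∞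
      (fun y : EM × ℝ => σ ((extChartAt 𝓘(ℝ, EM) p₀).symm y.1)) y :=
    (hσ.smooth.contMDiffAt (hσ.isOpen.mem_nhds hy.2)).comp y h2
  exact (B.contMDiff_smul.contMDiffAt).comp y (h1.prodMk h3)

theorem contMDiffAt_circle_arg {z : Circle} (hz : (z : ℂ) ∈ Complex.slitPlane) :
    ContMDiffAt (𝓡 1) 𝓘(ℝ, ℝ) ∞ (fun z : Circle => (z : ℂ).arg) z := by
  have := finrank_real_complex_fact'
  have h1 : ContMDiff (𝓡 1) 𝓘(ℝ, ℂ) ∞ (fun z : Circle => (z : ℂ)) := contMDiff_coe_sphere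
  have h2 : ContDiffAt ℝ ∞ (fun w : ℂ => w.arg) (z : ℂ) := by
    have := Complex.imCLM.contDiff.contDiffAt.comp (z : ℂ)
      ((Complex.contDiffAt_log hz (n := ∞)).restrict_scalars ℝ)
    refine this.congr_of_eventuallyEq (Eventually.of_forall fun w => ?_)
    simp [Complex.log_im]
  exact h2.contMDiffAt.comp z h1.contMDiffAt

-- The local inverse consists of the base chart and a continuous branch of the angle. The angle is
-- known only in the circle, so `tube` is a local, not a global, diffeomorphism; `IsParam` asks for
-- no more.
include hσ in
theorem isParam_tube [IsManifold 𝓘(ℝ, EM) ∞ M] :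
    IsParam EZ (tube EM σ p₀) (chartDom EM p₀ U ×ˢ (univ : Set ℝ)) where
  isOpen := (isOpen_chartDom hσ p₀).prod isOpen_univ
  smooth y hy := contMDiffAt_tube hσ p₀ hy.1
  exists_inv := by
    rintro ⟨u, t⟩ ⟨hu, -⟩
    dsimp only at hu
    obtain ⟨V, θ, hV, hxV, hVU, hθ, hθ1, hθ2⟩ := B.exists_fibreCoord hσ hu.2
    have hp : B.proj (tube EM σ p₀ (u, t)) = (extChartAt 𝓘(ℝ, EM) p₀).symm u := proj_tube hσ p₀ hu
    have hsrc := (extChartAt 𝓘(ℝ, EM) p₀).map_target hu.1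
    have hmem : B.proj ⁻¹' V ∈ 𝓝 (tube EM σ p₀ (u, t)) :=
      (hV.preimage B.contMDiff_proj.continuous).mem_nhds (by rw [mem_preimage, hp]; exact hxV)
    have hθt : ∀ y : EM × ℝ, (extChartAt 𝓘(ℝ, EM) p₀).symm y.1 ∈ V →
        θ (tube EM σ p₀ y) = Circle.exp y.2 := fun y hy => hθ1 _ hy _
    have h0 : θ (tube EM σ p₀ (u, t)) * Circle.exp (-t) = 1 := by
      rw [hθt (u, t) hxV, ← Circle.exp_add]; simp
    -- Multiplying by `e^{-it}` moves the angle to `1`, away from the cut of the argument; adding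
    -- `t` back gives the smooth branch with value `t` at the point.
    have hc : ContMDiffAt 𝓘(ℝ, EZ) 𝓘(ℝ, ℝ) ∞
        (fun q => t + ((θ q * Circle.exp (-t) : Circle) : ℂ).arg) (tube EM σ p₀ (u, t)) := by
      have h1 : ContMDiffAt 𝓘(ℝ, EZ) (𝓡 1) ∞ (fun q => θ q * Circle.exp (-t))
          (tube EM σ p₀ (u, t)) := (hθ.contMDiffAt hmem).mul contMDiffAt_const
      have h2 := (contMDiffAt_circle_arg (z := θ (tube EM σ p₀ (u, t)) * Circle.exp (-t))
        (by rw [h0]; simp)).comp (tube EM σ p₀ (u, t)) h1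
      exact contMDiffAt_const.add h2
    have hφ : ContMDiffAt 𝓘(ℝ, EZ) 𝓘(ℝ, EM) ∞ (fun q => extChartAt 𝓘(ℝ, EM) p₀ (B.proj q))
        (tube EM σ p₀ (u, t)) := by
      have h1 : ContMDiffAt 𝓘(ℝ, EM) 𝓘(ℝ, EM) ∞ (extChartAt 𝓘(ℝ, EM) p₀)
          (B.proj (tube EM σ p₀ (u, t))) :=
        contMDiffAt_extChartAt' (by rw [hp, ← extChartAt_source 𝓘(ℝ, EM)]; exact hsrc)
      exact h1.comp (tube EM σ p₀ (u, t)) B.contMDiff_proj.contMDiffAt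
    refine ⟨fun q => (extChartAt 𝓘(ℝ, EM) p₀ (B.proj q),
      t + ((θ q * Circle.exp (-t) : Circle) : ℂ).arg), hφ.prodMk_space hc, ?_, ?_, ?_⟩
    · simp only [hp, h0, (extChartAt 𝓘(ℝ, EM) p₀).right_inv hu.1]
      simp
    · have e1 : ∀ᶠ y' : EM × ℝ in 𝓝 (u, t), y'.1 ∈ chartDom EM p₀ V :=
        continuous_fst.continuousAt.eventually
          ((((continuousOn_extChartAt_symm p₀).isOpen_inter_preimage
            (isOpen_extChartAt_target p₀) hV).mem_nhds ⟨hu.1, hxV⟩))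
      -- Keeps the shifted angle in the interval on which `arg` inverts `exp`.
      have e2 : ∀ᶠ y' : EM × ℝ in 𝓝 (u, t), y'.2 - t ∈ Ioo (-Real.pi) Real.pi :=
        (continuous_snd.sub continuous_const).continuousAt.eventually
          (isOpen_Ioo.mem_nhds (by simp [Real.pi_pos]))
      filter_upwards [e1, e2] with y' h1 h2
      rw [proj_tube hσ p₀ ⟨h1.1, hVU h1.2⟩, hθt y' h1.2, ← Circle.exp_add, ← sub_eq_add_neg,
        Circle.arg_exp h2.1 h2.2.le, (extChartAt 𝓘(ℝ, EM) p₀).right_inv h1.1]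
      ext <;> simp
    · have e1 : ∀ᶠ q in 𝓝 (tube EM σ p₀ (u, t)), B.proj q ∈ (extChartAt 𝓘(ℝ, EM) p₀).source :=
        B.contMDiff_proj.continuous.continuousAt.eventually (by
          rw [hp]; exact extChartAt_source_mem_nhds' (I := 𝓘(ℝ, EM)) hsrc)
      filter_upwards [hmem, e1] with q h1 h2
      simp only [tube, (extChartAt 𝓘(ℝ, EM) p₀).left_inv h2, Circle.exp_add, Circle.exp_arg,
        Circle.exp_neg]
      rw [mul_comm, inv_mul_cancel_right]
      exact hθ2 q h1

end PrincipalCircleBundle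

/-! ### Invariant tensors in tube coordinates. -/

namespace PrincipalCircleBundle

variable {EM M EZ Z : Type*}
  [NormedAddCommGroup EM] [NormedSpace ℝ EM] [TopologicalSpace M] [ChartedSpace EM M]
  [NormedAddCommGroup EZ] [NormedSpace ℝ EZ] [TopologicalSpace Z] [ChartedSpace EZ Z]
  [MulAction Circle Z] {B : PrincipalCircleBundle EM M EZ Z}
  [IsManifold 𝓘(ℝ, EM) ∞ M] [IsManifold 𝓘(ℝ, EZ) ∞ Z]
  {σ : M → Z} {U : Set M} (hσ : B.IsLocalSection σ U) (p₀ : M)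

/-- The connection as a function with values in the model space. -/
def _root_.ExoticCourant.Connection.cov (A : Connection EZ Z) : Z → EZ →L[ℝ] ℝ := A.form

/-- The flux as a function with values in the model space. -/
def _root_.ExoticCourant.Flux.alt (H : Flux EZ Z) : Z → EZ [⋀^Fin 3]→L[ℝ] ℝ := H.form

variable (EZ) in
/-- The generator as a function with values in the model space. -/
def gen : Z → EZ := generator EZ

include hσ in
theorem mdifferentiableAt_tube {y : EM × ℝ} (hy : y.1 ∈ chartDom EM p₀ U) :
    MDifferentiableAt 𝓘(ℝ, EM × ℝ) 𝓘(ℝ, EZ) (tube EM σ p₀) y :=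
  (contMDiffAt_tube hσ p₀ hy).mdifferentiableAt (by simp)

-- Differentiates `tube (y + (0, t)) = e^{it} • tube y`. Through this identity, invariance under the
-- action becomes independence of `t` in coordinates.
include hσ in
theorem dM_tube_shift {u : EM} (hu : u ∈ chartDom EM p₀ U) (t : ℝ) :
    dM (EM × ℝ) EZ (tube EM σ p₀) (u, t) =
      dM EZ EZ (fun q : Z => Circle.exp t • q) (tube EM σ p₀ (u, 0)) ∘L
        dM (EM × ℝ) EZ (tube EM σ p₀) (u, 0) := by
  have h1 : (fun y : EM × ℝ => tube EM σ p₀ (y + (0, t)))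
      = fun y => Circle.exp t • tube EM σ p₀ y := by
    funext y
    rw [show y + (0, t) = (y.1, t + y.2) from Prod.ext (by simp) (by simp [add_comm])]
    exact tube_add p₀ _ _ _
  have hd : DifferentiableAt ℝ (fun y : EM × ℝ => y + (0, t)) (u, 0) :=
    differentiableAt_id.add_const _
  have e2 : dM (EM × ℝ) (EM × ℝ) (fun y : EM × ℝ => y + (0, t)) (u, 0)
      = ContinuousLinearMap.id ℝ _ := by
    rw [dM_eq_fderiv, fderiv_add_const]; exact fderiv_id
  have e0 : ((u, 0) : EM × ℝ) + (0, t) = (u, t) := by simp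
  have h2 := dM_comp (EM × ℝ) (EM × ℝ) EZ (f := fun y : EM × ℝ => y + (0, t)) (q := (u, 0))
    (g := tube EM σ p₀) (by rw [e0]; exact mdifferentiableAt_tube hσ p₀ hu) hd.mdifferentiableAt
  rw [e2, e0, h1] at h2
  rw [ContinuousLinearMap.comp_id] at h2
  rw [← h2]
  exact dM_comp (EM × ℝ) EZ EZ ((B.contMDiff_const_smul _).contMDiffAt.mdifferentiableAt (by simp))
    (mdifferentiableAt_tube hσ p₀ hu)

-- The fibre coordinate field is the generator of the action; with `v = -i ∂_t` this is what links
-- weights to Fourier indices.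
include hσ in
theorem dM_tube_snd {u : EM} (hu : u ∈ chartDom EM p₀ U) (t : ℝ) :
    dM (EM × ℝ) EZ (tube EM σ p₀) (u, t) (0, 1) = gen EZ (tube EM σ p₀ (u, t)) := by
  have hd : HasFDerivAt (fun s : ℝ => (u, t + s)) (ContinuousLinearMap.inr ℝ EM ℝ) 0 := by
    exact (hasFDerivAt_const u (0 : ℝ)).prodMk ((hasFDerivAt_id (0 : ℝ)).const_add t)
  have h1 := dM_comp ℝ (EM × ℝ) EZ (f := fun s : ℝ => (u, t + s)) (q := 0)
    (g := tube EM σ p₀) (mdifferentiableAt_tube hσ p₀ hu) hd.differentiableAt.mdifferentiableAt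
  rw [dM_eq_fderiv, hd.fderiv, add_zero] at h1
  have h2 : (fun s : ℝ => tube EM σ p₀ (u, t + s))
      = fun s => Circle.exp s • tube EM σ p₀ (u, t) := by
    funext s; rw [add_comm]; exact tube_add p₀ _ _ _
  rw [h2] at h1
  exact (congrArg (fun T : ℝ →L[ℝ] EZ => T 1) h1).symm

include hσ in
theorem dM_proj_tube {y : EM × ℝ} (hy : y.1 ∈ chartDom EM p₀ U) :
    dM EZ EM B.proj (tube EM σ p₀ y) ∘L dM (EM × ℝ) EZ (tube EM σ p₀) y =
      dM EM EM (extChartAt 𝓘(ℝ, EM) p₀).symm y.1 ∘L ContinuousLinearMap.fst ℝ EM ℝ := by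
  have h1 := dM_comp (EM × ℝ) EZ EM (B.contMDiff_proj.contMDiffAt.mdifferentiableAt (by simp))
    (mdifferentiableAt_tube hσ p₀ hy)
  have h2 := dM_comp (EM × ℝ) EM EM (f := fun y : EM × ℝ => y.1) (q := y)
    ((isParam_base hσ p₀).mdifferentiableAt hy) differentiableAt_fst.mdifferentiableAt
  rw [dM_eq_fderiv, fderiv_fst] at h2
  rw [← h1, ← h2]
  refine dM_congr _ _ ?_
  filter_upwards [((isOpen_chartDom hσ p₀).preimage continuous_fst).mem_nhds hy] with y' hy'
  exact proj_tube hσ p₀ hy'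

include hσ in
theorem dM_section {u : EM} (hu : u ∈ chartDom EM p₀ U) (w : EM) :
    dM EM EZ σ ((extChartAt 𝓘(ℝ, EM) p₀).symm u) (dM EM EM (extChartAt 𝓘(ℝ, EM) p₀).symm u w)
      = dM (EM × ℝ) EZ (tube EM σ p₀) (u, 0) (w, 0) := by
  have h1 := dM_comp EM EM EZ (f := (extChartAt 𝓘(ℝ, EM) p₀).symm) (q := u) (g := σ)
    ((hσ.smooth.contMDiffAt (hσ.isOpen.mem_nhds hu.2)).mdifferentiableAt (by simp))
    ((isParam_base hσ p₀).mdifferentiableAt hu)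
  have hd : HasFDerivAt (fun u : EM => (u, (0 : ℝ))) (ContinuousLinearMap.inl ℝ EM ℝ) u :=
    (hasFDerivAt_id u).prodMk (hasFDerivAt_const (0 : ℝ) u)
  have h2 := dM_comp EM (EM × ℝ) EZ (f := fun u : EM => (u, (0 : ℝ))) (q := u)
    (g := tube EM σ p₀) (mdifferentiableAt_tube hσ p₀ hu) hd.differentiableAt.mdifferentiableAt
  rw [dM_eq_fderiv, hd.fderiv] at h2
  have h3 : (fun u : EM => tube EM σ p₀ (u, 0)) = fun u => σ ((extChartAt 𝓘(ℝ, EM) p₀).symm u) := by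
    funext u; simp [tube]
  rw [h3, h1] at h2
  exact congrArg (fun T : EM →L[ℝ] EZ => T w) h2

/-! ### The connection and the flux in tube coordinates -/

variable (A : Connection EZ Z)

include hσ in
theorem cpull_form_shift {u : EM} (hu : u ∈ chartDom EM p₀ U) (t : ℝ) :
    cpull (E := EZ) (tube EM σ p₀) A.cov (u, t) = cpull (E := EZ) (tube EM σ p₀) A.cov (u, 0) := by
  have h1 : (A.cov (Circle.exp t • tube EM σ p₀ (u, 0))) ∘L
      dM EZ EZ (fun q : Z => Circle.exp t • q) (tube EM σ p₀ (u, 0))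
        = (A.cov (tube EM σ p₀ (u, 0))) :=
    A.invariant (Circle.exp t) (tube EM σ p₀ (u, 0))
  rw [cpull, cpull, dM_tube_shift hσ p₀ hu t, ← ContinuousLinearMap.comp_assoc, tube_eq_smul]
  exact congrArg (fun T : EZ →L[ℝ] ℝ => T ∘L dM (EM × ℝ) EZ (tube EM σ p₀) (u, 0)) h1

-- Invariance of the flux. Its components are constants for the Fourier transform in `t`, so the
-- flux term introduces no extra convolution.
include hσ in
theorem hco_shift {κ : Type*} [Fintype κ] (b : Module.Basis κ ℝ (EM × ℝ)) (H : Flux EZ Z) {u : EM}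
    (hu : u ∈ chartDom EM p₀ U) (t : ℝ) (i j k : κ) :
    hco (E := EZ) b (tube EM σ p₀) H.alt (u, t) i j k
      = hco (E := EZ) b (tube EM σ p₀) H.alt (u, 0) i j k := by
  have h1 : (H.alt (Circle.exp t • tube EM σ p₀ (u, 0))).compContinuousLinearMap
      (dM EZ EZ (fun q : Z => Circle.exp t • q) (tube EM σ p₀ (u, 0)))
        = (H.alt (tube EM σ p₀ (u, 0))) :=
    H.invariant (Circle.exp t) (tube EM σ p₀ (u, 0))
  rw [hco, hco, dM_tube_shift hσ p₀ hu t, tube_eq_smul, ← h1]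
  refine congrArg (fun r : ℝ => (r : ℂ)) ?_
  refine congrArg (H.alt (Circle.exp t • tube EM σ p₀ (u, 0))) ?_
  ext l; fin_cases l <;> rfl

/-- The connection in tube coordinates. -/
def tubeForm (σ : M → Z) (u w : EM) : ℝ := cpull (E := EZ) (tube EM σ p₀) A.cov (u, 0) (w, 0)

-- In tube coordinates the real connection form is `ℓ + dt`, with `ℓ` a form in the base variables:
-- invariance removes `t` and normalization fixes the coefficient of `dt`.
include hσ in
theorem form_dM_tube {u : EM} (hu : u ∈ chartDom EM p₀ U) (t : ℝ) (w : EM) (s : ℝ) :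
    (A.cov (tube EM σ p₀ (u, t))) (dM (EM × ℝ) EZ (tube EM σ p₀) (u, t) (w, s))
      = tubeForm p₀ A σ u w + s := by
  have h0 : ((w, s) : EM × ℝ) = (w, 0) + s • (0, 1) := by ext <;> simp
  have h1 := congrArg (fun T : (EM × ℝ) →L[ℝ] ℝ => T (w, 0)) (cpull_form_shift hσ p₀ A hu t)
  have h2 : (A.cov (tube EM σ p₀ (u, t)))
      (dM (EM × ℝ) EZ (tube EM σ p₀) (u, t) (0, 1)) = 1 := by
    rw [dM_tube_snd hσ p₀ hu t]; exact A.normalized _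
  rw [h0, map_add, map_add, map_smul, map_smul, h2, smul_eq_mul, mul_one]
  exact congrArg (· + s) h1

include hσ in
theorem contDiffOn_tubeForm (w : EM) :
    ContDiffOn ℝ ∞ (fun u => tubeForm p₀ A σ u w) (chartDom EM p₀ U) := by
  intro u hu
  refine ContDiffAt.contDiffWithinAt ?_
  have h1 : SmoothFormAt A.form (tube EM σ p₀ (u, 0)) := A.smooth.contMDiffAt univ_mem
  have h2 := ((isParam_tube hσ p₀).smoothFormAt_iff (y := (u, 0)) ⟨hu, mem_univ _⟩).1 h1
  have h3 := h2.comp u (contDiffAt_id.prodMk contDiffAt_const)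
  exact h3.clm_apply contDiffAt_const

include hσ in
theorem contDiffAt_hco [FiniteDimensional ℝ EZ] {κ : Type*} [Fintype κ]
    (b : Module.Basis κ ℝ (EM × ℝ)) (H : Flux EZ Z) {y : EM × ℝ}
    (hy : y.1 ∈ chartDom EM p₀ U) (i j k : κ) :
    ContDiffAt ℝ ∞ (fun y => hco (E := EZ) b (tube EM σ p₀) H.alt y i j k) y := by
  have h1 := (isParam_tube hσ p₀).contDiffAt_apull_apply (y := y) ⟨hy, mem_univ _⟩ H.smooth
    ![b i, b j, b k]
  have h2 := Complex.ofRealCLM.contDiff.contDiffAt.comp y h1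
  refine h2.congr_of_eventuallyEq (Eventually.of_forall fun y' => ?_)
  refine congrArg (fun r : ℝ => (r : ℂ)) ?_
  refine congrArg (H.alt (tube EM σ p₀ y')) ?_
  ext l; fin_cases l <;> rfl

-- Here `π^*A_σ` is `i ℓ` and `A` is `i (ℓ + dt)`, so the connection cancels and `τ_σ = -i dt`. This
-- makes `n τ_σ` act as differentiation of `e^{-int}`.
include hσ in
theorem tau_dM_tube {u : EM} (hu : u ∈ chartDom EM p₀ U) (t : ℝ) (w : EM) (s : ℝ) :
    (B.tau A σ (tube EM σ p₀ (u, t)) : EZ →L[ℝ] ℂ) (dM (EM × ℝ) EZ (tube EM σ p₀) (u, t) (w, s))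
      = -(Complex.I * s) := by
  have e1 := congrArg (fun T : (EM × ℝ) →L[ℝ] EM => T (w, s)) (dM_proj_tube hσ p₀ (y := (u, t)) hu)
  have e2 := form_dM_tube hσ p₀ A hu t w s
  have e3 := form_dM_tube hσ p₀ A hu 0 w 0
  have e4 := dM_section hσ p₀ hu w
  have e5 := proj_tube hσ p₀ (y := (u, t)) hu
  have key : (B.tau A σ (tube EM σ p₀ (u, t)) : EZ →L[ℝ] ℂ)
      (dM (EM × ℝ) EZ (tube EM σ p₀) (u, t) (w, s))
      = Complex.I * (A.cov (σ (B.proj (tube EM σ p₀ (u, t))))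
        (dM EM EZ σ (B.proj (tube EM σ p₀ (u, t))) (dM EZ EM B.proj (tube EM σ p₀ (u, t))
          (dM (EM × ℝ) EZ (tube EM σ p₀) (u, t) (w, s)))) : ℝ)
        - Complex.I * ((A.cov (tube EM σ p₀ (u, t)))
          (dM (EM × ℝ) EZ (tube EM σ p₀) (u, t) (w, s)) : ℝ) := rfl
  have e6 : dM EZ EM B.proj (tube EM σ p₀ (u, t)) (dM (EM × ℝ) EZ (tube EM σ p₀) (u, t) (w, s))
      = dM EM EM (extChartAt 𝓘(ℝ, EM) p₀).symm u w := e1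
  rw [key, e2, e6, e5, e4]
  have e7 : tube EM σ p₀ (u, 0) = σ ((extChartAt 𝓘(ℝ, EM) p₀).symm u) := by simp [tube]
  rw [e7] at e3
  rw [e3]
  push_cast
  ring

/-! ### The horizontal lift -/

/-- In tube coordinates the pair `(dπ, a)` is triangular, `(w, s) ↦ (f w, c w + s)` with `f`
invertible. Without this the `inverse` in the definition of `horizontal` would be a default value.
-/
theorem isInvertible_proj_form (p : Z) :
    ((dM EZ EM B.proj p).prod (A.cov p)).IsInvertible := by
  obtain ⟨σ, U, hσ, hp, hpσ⟩ := B.exists_localSection p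
  obtain ⟨hu, t, ht⟩ := exists_tube_eq hσ (B.proj p) hp (mem_extChartAt_source _)
  set u := extChartAt 𝓘(ℝ, EM) (B.proj p) (B.proj p) with hu_def
  obtain ⟨e, he⟩ := (isParam_tube hσ (B.proj p)).isInvertible (y := (u, t)) ⟨hu, mem_univ _⟩
  obtain ⟨f, hf⟩ := (isParam_base hσ (B.proj p)).isInvertible hu
  have hl : ∀ w : EM, tubeForm (B.proj p) A σ u w
      = (cpull (E := EZ) (tube EM σ (B.proj p)) A.cov (u, 0) ∘L ContinuousLinearMap.inl ℝ EM ℝ) w :=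
    fun w => rfl
  let c : EM →L[ℝ] ℝ :=
    cpull (E := EZ) (tube EM σ (B.proj p)) A.cov (u, 0) ∘L ContinuousLinearMap.inl ℝ EM ℝ
  rw [← ht]
  have h1 : ∀ v : EM × ℝ, ((dM EZ EM B.proj (tube EM σ (B.proj p) (u, t))).prod
      (A.cov (tube EM σ (B.proj p) (u, t)))) (e v) = (f v.1, c v.1 + v.2) := by
    intro v
    have e1 := congrArg (fun T : (EM × ℝ) →L[ℝ] EM => T v)
      (dM_proj_tube hσ (B.proj p) (y := (u, t)) hu)
    have e2 := form_dM_tube hσ (B.proj p) A hu t v.1 v.2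
    have e3 : e v = dM (EM × ℝ) EZ (tube EM σ (B.proj p)) (u, t) v := by rw [← he]; rfl
    have e4 : f v.1 = dM EM EM (extChartAt 𝓘(ℝ, EM) (B.proj p)).symm u v.1 := by rw [← hf]; rfl
    rw [e3, e4]
    exact Prod.ext e1 e2
  -- The inverse of the triangular map, followed by the tube differential: `(w, r) ↦ e (f⁻¹ w, r - c
  -- (f⁻¹ w))`.
  refine ContinuousLinearMap.IsInvertible.of_inverse
    (g := (e : (EM × ℝ) →L[ℝ] EZ) ∘L ((f.symm : EM →L[ℝ] EM) ∘L ContinuousLinearMap.fst ℝ EM ℝ).prod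
      (ContinuousLinearMap.snd ℝ EM ℝ - c ∘L (f.symm : EM →L[ℝ] EM) ∘L ContinuousLinearMap.fst ℝ EM ℝ))
    ?_ ?_
  · refine ContinuousLinearMap.ext fun v => ?_
    refine (h1 _).trans ?_
    simp
  · refine ContinuousLinearMap.ext fun v => ?_
    obtain ⟨v', rfl⟩ := e.surjective v
    change e (f.symm (((dM EZ EM B.proj (tube EM σ (B.proj p) (u, t))).prod
      (A.cov (tube EM σ (B.proj p) (u, t)))) (e v')).1,
      (((dM EZ EM B.proj (tube EM σ (B.proj p) (u, t))).prod
      (A.cov (tube EM σ (B.proj p) (u, t)))) (e v')).2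
      - c (f.symm (((dM EZ EM B.proj (tube EM σ (B.proj p) (u, t))).prod
      (A.cov (tube EM σ (B.proj p) (u, t)))) (e v')).1)) = e v'
    rw [h1]
    simp

variable (B) in
/-- The horizontal lift on model spaces. -/
def hlift (p : Z) : EM →L[ℝ] EZ := B.horizontal A p

theorem proj_hlift (p : Z) (w : EM) : dM EZ EM B.proj p (hlift B A p w) = w := by
  obtain ⟨e, he⟩ := isInvertible_proj_form (B := B) A p
  have h1 : hlift B A p w = ((dM EZ EM B.proj p).prod (A.cov p)).inverse (w, 0) := rfl
  have h2 : ((dM EZ EM B.proj p).prod (A.cov p)) (hlift B A p w) = (w, 0) := by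
    rw [h1, ← he, ContinuousLinearMap.inverse_equiv]
    exact e.apply_symm_apply _
  exact congrArg Prod.fst h2

theorem form_hlift (p : Z) (w : EM) : (A.cov p) (hlift B A p w) = 0 := by
  obtain ⟨e, he⟩ := isInvertible_proj_form (B := B) A p
  have h1 : hlift B A p w = ((dM EZ EM B.proj p).prod (A.cov p)).inverse (w, 0) := rfl
  have h2 : ((dM EZ EM B.proj p).prod (A.cov p)) (hlift B A p w) = (w, 0) := by
    rw [h1, ← he, ContinuousLinearMap.inverse_equiv]
    exact e.apply_symm_apply _
  exact congrArg Prod.snd h2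

variable (B) in
include B in
theorem proj_generator (p : Z) : dM EZ EM B.proj p (gen EZ p) = 0 := by
  obtain ⟨σ, U, hσ, hp, hpσ⟩ := B.exists_localSection p
  obtain ⟨hu, t, ht⟩ := exists_tube_eq hσ (B.proj p) hp (mem_extChartAt_source _)
  have e1 := congrArg (fun T : (EM × ℝ) →L[ℝ] EM => T (0, 1))
    (dM_proj_tube hσ (B.proj p) (y := (extChartAt 𝓘(ℝ, EM) (B.proj p) (B.proj p), t)) hu)
  have e2 := dM_tube_snd hσ (B.proj p) hu t
  rw [ht] at e1 e2
  have e3 := e1.trans (map_zero (dM EM EM (extChartAt 𝓘(ℝ, EM) (B.proj p)).symm _))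
  exact (congrArg (dM EZ EM B.proj p) e2).symm.trans e3

-- The splitting into horizontal and vertical parts. Both sides have the same image under the
-- injective pair `(dπ, a)`.
variable (B) in
theorem hlift_proj_add (p : Z) (v : EZ) :
    hlift B A p (dM EZ EM B.proj p v) + (A.cov p) v • (gen EZ p : EZ) = v := by
  obtain ⟨e, he⟩ := isInvertible_proj_form (B := B) A p
  have hinj : Function.Injective ((dM EZ EM B.proj p).prod (A.cov p)) := by
    rw [← he]; exact e.injective
  apply hinj
  have hn : (A.cov p) (gen EZ p) = 1 := A.normalized p
  refine Prod.ext ?_ ?_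
  · change dM EZ EM B.proj p _ = dM EZ EM B.proj p v
    rw [map_add, map_smul, proj_hlift, B.proj_generator, smul_zero, add_zero]
  · change (A.cov p) _ = (A.cov p) v
    rw [map_add, map_smul, form_hlift, hn]
    simp

-- The horizontal lift of `∂_w` is `∂_w - ℓ(w) ∂_t`, the lift annihilated by `ℓ + dt`.
include hσ in
theorem hlift_dM_base {u : EM} (hu : u ∈ chartDom EM p₀ U) (t : ℝ) (w : EM) :
    hlift B A (tube EM σ p₀ (u, t)) (dM EM EM (extChartAt 𝓘(ℝ, EM) p₀).symm u w)
      = dM (EM × ℝ) EZ (tube EM σ p₀) (u, t) (w, -tubeForm p₀ A σ u w) := by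
  have h1 := hlift_proj_add B A (tube EM σ p₀ (u, t))
    (dM (EM × ℝ) EZ (tube EM σ p₀) (u, t) (w, -tubeForm p₀ A σ u w))
  rw [form_dM_tube hσ p₀ A hu] at h1
  have e1 := congrArg (fun T : (EM × ℝ) →L[ℝ] EM => T (w, -tubeForm p₀ A σ u w))
    (dM_proj_tube hσ p₀ (y := (u, t)) hu)
  have e2 : dM EZ EM B.proj (tube EM σ p₀ (u, t)) (dM (EM × ℝ) EZ (tube EM σ p₀) (u, t)
    (w, -tubeForm p₀ A σ u w)) = dM EM EM (extChartAt 𝓘(ℝ, EM) p₀).symm u w := e1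
  rw [e2, add_neg_cancel, zero_smul, add_zero] at h1
  exact h1

end PrincipalCircleBundle

/-! ### Frames of the generalized tangent bundle. -/

section Frames

variable {E : Type*} [NormedAddCommGroup E] [NormedSpace ℝ E]
  {N : Type*} [TopologicalSpace N] [ChartedSpace E N]
  {D : Type*} [NormedAddCommGroup D] [NormedSpace ℝ D] [FiniteDimensional ℝ D]
  {κ : Type*} [Fintype κ] (b : Module.Basis κ ℝ D) (Ψ : D → N) (y : D)

/-- Components of a generalized tangent vector. -/
def gcoL : κ ⊕ κ → Cplx E × (E →L[ℝ] ℂ) →ₗ[ℂ] ℂ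
  | .inl k => { toFun := fun g => Cplx.eval (coframe b Ψ k y) g.1
                map_add' := fun _ _ => Cplx.eval_add _ _ _
                map_smul' := fun _ _ => Cplx.eval_smul _ _ _ }
  | .inr k => { toFun := fun g => g.2 (dM D E Ψ y (b k))
                map_add' := fun _ _ => rfl
                map_smul' := fun _ _ => rfl }

/-- Components of a section of the generalized tangent bundle. -/
def gco (a : N → Cplx E × (E →L[ℝ] ℂ)) (k : κ ⊕ κ) (y : D) : ℂ := gcoL b Ψ y k (a (Ψ y))

/-- The generalized tangent vector with given components. -/
def gmk (E : Type*) [NormedAddCommGroup E] [NormedSpace ℝ E]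
    {N : Type*} [TopologicalSpace N] [ChartedSpace E N] (Ψ : D → N) (y : D) :
    (κ ⊕ κ → ℂ) →+ Cplx E × (E →L[ℝ] ℂ) :=
  AddMonoidHom.mk' (fun c =>
    (Cplx.mk (∑ k, (c (.inl k)).re • dM D E Ψ y (b k)) (∑ k, (c (.inl k)).im • dM D E Ψ y (b k)),
      ∑ k, c (.inr k) • coframe b Ψ k y)) (by
    intro c d
    refine Prod.ext (Cplx.ext' ?_ ?_) ?_
    · simp [add_smul, Finset.sum_add_distrib]
    · simp [add_smul, Finset.sum_add_distrib]
    · ext v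
      simp [add_mul, Finset.sum_add_distrib])

theorem continuous_gmk : Continuous (gmk b E Ψ y) := by
  refine Continuous.prodMk (Continuous.prodMk (f := fun c : κ ⊕ κ → ℂ =>
    ∑ k, (c (.inl k)).re • dM D E Ψ y (b k)) (g := fun c : κ ⊕ κ → ℂ =>
    ∑ k, (c (.inl k)).im • dM D E Ψ y (b k)) ?_ ?_) ?_
  · exact continuous_finsetSum _ fun k _ =>
      (Complex.continuous_re.comp (continuous_apply _)).smul continuous_const
  · exact continuous_finsetSum _ fun k _ =>
      (Complex.continuous_im.comp (continuous_apply _)).smul continuous_const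
  · exact continuous_finsetSum _ fun k _ => (continuous_apply _).smul continuous_const

theorem continuous_gcoL (k : κ ⊕ κ) : Continuous (gcoL (E := E) b Ψ y k) := by
  rcases k with k | k
  · have h1 : Continuous fun g : (E × E) × (E →L[ℝ] ℂ) =>
        coframe b Ψ k y g.1.1 + Complex.I * coframe b Ψ k y g.1.2 := by fun_prop
    exact h1
  · have h1 : Continuous fun g : (E × E) × (E →L[ℝ] ℂ) => g.2 (dM D E Ψ y (b k)) := by fun_prop
    exact h1

variable {b Ψ y} (hinv : (dM D E Ψ y).IsInvertible)

include hinv in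
theorem gmk_gcoL (g : Cplx E × (E →L[ℝ] ℂ)) : gmk b E Ψ y (fun k => gcoL b Ψ y k g) = g := by
  obtain ⟨h1, h2⟩ := vec_eq_sum (b := b) hinv g.1
  refine Prod.ext (Cplx.ext' h1.symm h2.symm) ?_
  ext v
  rw [sum_coframe hinv (b := b) g.2 v]
  simp [gmk, gcoL]

include hinv in
theorem gco_ext {g g' : Cplx E × (E →L[ℝ] ℂ)} (h : ∀ k, gcoL b Ψ y k g = gcoL b Ψ y k g') :
    g = g' := by
  rw [← gmk_gcoL (b := b) hinv g, ← gmk_gcoL (b := b) hinv g']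
  simp only [h]

-- The component maps and the reassembly map `gmk` are continuous, so convergence may be tested on
-- components. Every sum over weights reduces to scalar sums in this way.
include hinv in
theorem hasSum_iff_gcoL {s : ℤ → Cplx E × (E →L[ℝ] ℂ)} {g : Cplx E × (E →L[ℝ] ℂ)} :
    HasSum s g ↔ ∀ k, HasSum (fun n => gcoL b Ψ y k (s n)) (gcoL b Ψ y k g) := by
  constructor
  · intro h k
    exact h.map (gcoL b Ψ y k) (continuous_gcoL b Ψ y k)
  · intro h
    have h1 := (Pi.hasSum.2 h).map (gmk b E Ψ y) (continuous_gmk b Ψ y)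
    rw [gmk_gcoL hinv] at h1
    refine h1.congr_fun ?_
    intro n
    exact (gmk_gcoL hinv (s n)).symm

variable [IsManifold 𝓘(ℝ, E) ∞ N] {Ω : Set D}

theorem IsParam.smoothGAt_iff (h : IsParam E Ψ Ω) (hy : y ∈ Ω) (a : ∀ p : N, GTan E p) :
    SmoothGAt a (Ψ y) ↔ ∀ k, ContDiffAt ℝ ∞ (gco (E := E) b Ψ a k) y := by
  have h1 := h.smooth_vco_iff (b := b) hy (fun p => (a p).1)
  have h2 := h.smooth_fco_iff (b := b) hy (fun p => (a p).2)
  constructor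
  · rintro ⟨k1, k2, k3⟩ (k | k)
    · exact h1.1 ⟨k1, k2⟩ k
    · exact h2.1 k3 k
  · intro h
    have k1 := h1.2 fun k => h (.inl k)
    exact ⟨k1.1, k1.2, h2.2 fun k => h (.inr k)⟩

end Frames

/-- The model fibre of `TM ⊕ 1 ⊕ T^*M ⊕ 1`. -/
abbrev EF (EM : Type*) [NormedAddCommGroup EM] [NormedSpace ℝ EM] : Type _ :=
  Cplx EM × ℂ × (EM →L[ℝ] ℂ) × ℂ

/-! ### Frames of the bundle `E` over the base. -/

section EFrames

variable {EM : Type*} [NormedAddCommGroup EM] [NormedSpace ℝ EM] [FiniteDimensional ℝ EM]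
  {M : Type*} [TopologicalSpace M] [ChartedSpace EM M]
  {ι : Type*} [Fintype ι] (bM : Module.Basis ι ℝ EM) (Φ : EM → M) (u : EM)

/-- Components of an element of `TM ⊕ 1 ⊕ T^*M ⊕ 1`. -/
def ecoL : (ι ⊕ Unit) ⊕ (ι ⊕ Unit) → EF EM →ₗ[ℂ] ℂ
  | .inl (.inl i) => { toFun := fun e => Cplx.eval (coframe bM Φ i u) e.1
                       map_add' := fun _ _ => Cplx.eval_add _ _ _
                       map_smul' := fun _ _ => Cplx.eval_smul _ _ _ }
  | .inl (.inr _) => { toFun := fun e => e.2.1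
                       map_add' := fun _ _ => rfl
                       map_smul' := fun _ _ => rfl }
  | .inr (.inl i) => { toFun := fun e => e.2.2.1 (dM EM EM Φ u (bM i))
                       map_add' := fun _ _ => rfl
                       map_smul' := fun _ _ => rfl }
  | .inr (.inr _) => { toFun := fun e => e.2.2.2
                       map_add' := fun _ _ => rfl
                       map_smul' := fun _ _ => rfl }

variable {bM Φ u} (hinv : (dM EM EM Φ u).IsInvertible)

include hinv in
theorem eco_ext {e e' : EF EM} (h : ∀ k, ecoL bM Φ u k e = ecoL bM Φ u k e') : e = e' :=
  Prod.ext (vec_ext hinv fun i => h (.inl (.inl i))) (Prod.ext (h (.inl (.inr ())))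
    (Prod.ext (cov_ext hinv fun i => h (.inr (.inl i))) (h (.inr (.inr ())))))

variable (bM Φ u) in
/-- The frame dual to the components `ecoL`. -/
def eframe : (ι ⊕ Unit) ⊕ (ι ⊕ Unit) → EF EM
  | .inl (.inl i) => (Cplx.mk (dM EM EM Φ u (bM i)) 0, 0, 0, 0)
  | .inl (.inr _) => (0, 1, 0, 0)
  | .inr (.inl i) => (0, 0, coframe bM Φ i u, 0)
  | .inr (.inr _) => (0, 0, 0, 1)

include hinv in
theorem sum_eframe (e : EF EM) : e = ∑ k, ecoL bM Φ u k e • eframe bM Φ u k := by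
  classical
  apply eco_ext (bM := bM) hinv
  intro k
  have hmk : ∀ (α : EM →L[ℝ] ℂ) (v : EM), Cplx.eval α (Cplx.mk v 0) = α v := by
    intro α v; simp [Cplx.eval_def]
  have hj : ∀ j, ecoL bM Φ u k (eframe bM Φ u j) = if j = k then 1 else 0 := by
    intro j
    rcases k with (i | i) | (i | i) <;> rcases j with (j | j) | (j | j) <;>
      simp [ecoL, eframe, hmk, Cplx.eval_zero, coframe_frame hinv]
    exact if_congr eq_comm rfl rfl
  simp only [map_sum, map_smul, hj, smul_eq_mul, mul_ite, mul_one, mul_zero, Finset.sum_ite_eq',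
    Finset.mem_univ, if_true]

end EFrames

/-! ### The fibrewise isomorphism `ψ` and its inverse. -/

namespace PrincipalCircleBundle

variable {EM M EZ Z : Type*}
  [NormedAddCommGroup EM] [NormedSpace ℝ EM] [TopologicalSpace M] [ChartedSpace EM M]
  [NormedAddCommGroup EZ] [NormedSpace ℝ EZ] [TopologicalSpace Z] [ChartedSpace EZ Z]
  [MulAction Circle Z] (B : PrincipalCircleBundle EM M EZ Z)
  [IsManifold 𝓘(ℝ, EM) ∞ M] [IsManifold 𝓘(ℝ, EZ) ∞ Z] (A : Connection EZ Z)

/-- The map `psi` on model spaces. -/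
def mpsi (p : Z) : EF EM →ₗ[ℂ] Cplx EZ × (EZ →L[ℝ] ℂ) where
  toFun e := (Cplx.map (hlift B A p) e.1 + e.2.1 • Cplx.mk 0 (-gen EZ p),
    e.2.2.1 ∘L dM EZ EM B.proj p + e.2.2.2 • (Complex.I • (Complex.ofRealCLM ∘L A.cov p)))
  map_add' e e' := by
    refine Prod.ext ?_ ?_
    · simp only [Prod.fst_add, Prod.snd_add, Cplx.map_add', add_smul]; abel
    · ext v
      simp only [Prod.fst_add, Prod.snd_add, ContinuousLinearMap.add_comp, add_apply, smul_apply,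
        smul_eq_mul]
      ring
  map_smul' c e := by
    refine Prod.ext ?_ ?_
    · simp only [Prod.smul_fst, Prod.smul_snd, Cplx.map_smul', smul_add, smul_smul, smul_eq_mul,
        RingHom.id_apply]
    · ext v
      simp only [Prod.smul_fst, Prod.smul_snd, ContinuousLinearMap.smul_comp, add_apply, smul_apply,
        smul_eq_mul, RingHom.id_apply]
      ring

/-- The inverse of `psi`. -/
def psiInv (p : Z) : Cplx EZ × (EZ →L[ℝ] ℂ) →ₗ[ℂ] EF EM where
  toFun g := (Cplx.map (dM EZ EM B.proj p) g.1, Complex.I * Cplx.eval (Complex.ofRealCLM ∘L A.cov p) g.1,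
    g.2 ∘L hlift B A p, Cplx.eval g.2 (Cplx.mk 0 (-gen EZ p)))
  map_add' g g' := by
    refine Prod.ext (Cplx.map_add' _ _ _) (Prod.ext ?_ (Prod.ext ?_ (Cplx.add_eval _ _ _)))
    · simp only [Prod.fst_add, Prod.snd_add, Cplx.eval_add, mul_add]
    · simp only [Prod.fst_add, Prod.snd_add, ContinuousLinearMap.add_comp]
  map_smul' c g := by
    refine Prod.ext (Cplx.map_smul' _ _ _) (Prod.ext ?_ (Prod.ext ?_ (Cplx.smul_eval _ _ _)))
    · simp only [Prod.smul_fst, Prod.smul_snd, Cplx.eval_smul, smul_eq_mul, RingHom.id_apply]; ring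
    · simp only [Prod.smul_fst, Prod.smul_snd, ContinuousLinearMap.smul_comp, RingHom.id_apply]

theorem cov_gen (p : Z) : A.cov p (gen EZ p) = 1 := A.normalized p

/-- Uses `dπ ∘ h = id`, `a ∘ h = 0`, `dπ(gen) = 0` and `a(gen) = 1`. The two factors of `I` come
from `A = i a` and `v = -i gen`, so that `A(v) = 1`. -/
theorem psiInv_mpsi (p : Z) (e : EF EM) : psiInv B A p (mpsi B A p e) = e := by
  have hg := cov_gen A p
  have hpg : dM EZ EM B.proj p (gen EZ p) = 0 := B.proj_generator p
  refine Prod.ext (Cplx.ext' ?_ ?_) (Prod.ext ?_ (Prod.ext ?_ ?_))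
  · simp [psiInv, mpsi, Cplx.map, proj_hlift, hpg]
  · simp [psiInv, mpsi, Cplx.map, proj_hlift, hpg]
  · simp [psiInv, mpsi, Cplx.map, Cplx.eval_def, form_hlift, hg]
    conv_rhs => rw [← Complex.re_add_im e.2.1]
    linear_combination (-(e.2.1.re : ℂ)) * Complex.I_sq
  · ext w
    simp [psiInv, mpsi, proj_hlift, form_hlift]
  · simp [psiInv, mpsi, Cplx.eval_def, hpg, hg]
    linear_combination (-e.2.2.2) * Complex.I_sq

/-- Tests everything on the splitting `w = h(dπ w) + a(w) gen` of tangent vectors. -/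
theorem mpsi_psiInv (p : Z) (g : Cplx EZ × (EZ →L[ℝ] ℂ)) : mpsi B A p (psiInv B A p g) = g := by
  have h := hlift_proj_add B A p
  refine Prod.ext (Cplx.ext' ?_ ?_) ?_
  · conv_rhs => rw [← h g.1.re]
    simp [psiInv, mpsi, Cplx.map, Cplx.eval_def]
  · conv_rhs => rw [← h g.1.im]
    simp [psiInv, mpsi, Cplx.map, Cplx.eval_def]
  · ext v
    conv_rhs => rw [← h v]
    simp [psiInv, mpsi, Cplx.eval_def, Complex.real_smul]
    linear_combination (-(g.2 (gen EZ p)) * (A.cov p v)) * Complex.I_sq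

end PrincipalCircleBundle

/-! ### Change between components on `Z` and components on `M`. -/

section Transition

variable {ι : Type*} [Fintype ι]

/-- From components on the total space to components on the base; `l` is the connection. -/
def toM (l : ι → ℂ) (c : (ι ⊕ Unit) ⊕ (ι ⊕ Unit) → ℂ) : (ι ⊕ Unit) ⊕ (ι ⊕ Unit) → ℂ
  | .inl (.inl i) => c (.inl (.inl i))
  | .inl (.inr _) => Complex.I * (∑ i, l i * c (.inl (.inl i)) + c (.inl (.inr ())))
  | .inr (.inl i) => c (.inr (.inl i)) - l i * c (.inr (.inr ()))
  | .inr (.inr _) => -Complex.I * c (.inr (.inr ()))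

/-- From components on the base to components on the total space; `l` is the connection. -/
def toZ (l : ι → ℂ) (c : (ι ⊕ Unit) ⊕ (ι ⊕ Unit) → ℂ) : (ι ⊕ Unit) ⊕ (ι ⊕ Unit) → ℂ
  | .inl (.inl i) => c (.inl (.inl i))
  | .inl (.inr _) => -Complex.I * c (.inl (.inr ())) - ∑ i, l i * c (.inl (.inl i))
  | .inr (.inl i) => c (.inr (.inl i)) + Complex.I * l i * c (.inr (.inr ()))
  | .inr (.inr _) => Complex.I * c (.inr (.inr ()))

theorem toZ_toM (l : ι → ℂ) (c : (ι ⊕ Unit) ⊕ (ι ⊕ Unit) → ℂ) : toZ l (toM l c) = c := by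
  funext k
  rcases k with (i | i) | (i | i) <;> simp only [toZ, toM]
  · linear_combination (-(∑ i, l i * c (.inl (.inl i))) - c (.inl (.inr ()))) * Complex.I_sq
  · linear_combination (-(l i * c (.inr (.inr ())))) * Complex.I_sq
  · linear_combination (-c (.inr (.inr ()))) * Complex.I_sq

variable {E : Type*} [NormedAddCommGroup E] [NormedSpace ℝ E]

theorem contDiffOn_toM {l : ι → E → ℂ} {c : (ι ⊕ Unit) ⊕ (ι ⊕ Unit) → E → ℂ} {W : Set E}
    (hl : ∀ i, ContDiffOn ℝ ∞ (l i) W) (hc : ∀ k, ContDiffOn ℝ ∞ (c k) W)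
    (k : (ι ⊕ Unit) ⊕ (ι ⊕ Unit)) :
    ContDiffOn ℝ ∞ (fun y => toM (fun i => l i y) (fun k => c k y) k) W := by
  rcases k with (i | i) | (i | i)
  · exact hc _
  · exact contDiffOn_const.mul ((ContDiffOn.sum fun i _ => (hl i).mul (hc _)).add (hc _))
  · exact (hc _).sub ((hl i).mul (hc _))
  · exact contDiffOn_const.mul (hc _)

theorem contDiffOn_toZ {l : ι → E → ℂ} {c : (ι ⊕ Unit) ⊕ (ι ⊕ Unit) → E → ℂ} {W : Set E}
    (hl : ∀ i, ContDiffOn ℝ ∞ (l i) W) (hc : ∀ k, ContDiffOn ℝ ∞ (c k) W)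
    (k : (ι ⊕ Unit) ⊕ (ι ⊕ Unit)) :
    ContDiffOn ℝ ∞ (fun y => toZ (fun i => l i y) (fun k => c k y) k) W := by
  rcases k with (i | i) | (i | i)
  · exact hc _
  · exact (contDiffOn_const.mul (hc _)).sub (ContDiffOn.sum fun i _ => (hl i).mul (hc _))
  · exact (hc _).add ((contDiffOn_const.mul (hl i)).mul (hc _))
  · exact contDiffOn_const.mul (hc _)

/-- `toZ l` is linear and `l` is constant along the fibre. For this reason Fourier coefficients may
be taken before or after changing frames. -/
theorem fc_toZ (n : ℤ) (l : ι → ℂ) {c : (ι ⊕ Unit) ⊕ (ι ⊕ Unit) → ℝ → ℂ}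
    (hc : ∀ k, Continuous (c k)) (k : (ι ⊕ Unit) ⊕ (ι ⊕ Unit)) :
    fc n (fun t => toZ l (fun k => c k t) k) = toZ l (fun k => fc n (c k)) k := by
  have hsub : ∀ f g : ℝ → ℂ, Continuous f → Continuous g →
      fc n (fun t => f t - g t) = fc n f - fc n g := by
    intro f g hf hg
    have h := fc_add n hf (g := fun t => (-1 : ℂ) * g t) (by fun_prop)
    rw [fc_const_mul] at h
    simpa [sub_eq_add_neg] using h
  rcases k with (i | i) | (i | i) <;> simp only [toZ]
  · rw [hsub (fun t => -Complex.I * c (Sum.inl (Sum.inr ())) t)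
      (fun t => ∑ x, l x * c (Sum.inl (Sum.inl x)) t) (by fun_prop) (by fun_prop), fc_const_mul,
      fc_sum n _ (f := fun x t => l x * c (Sum.inl (Sum.inl x)) t) (fun i => by fun_prop)]
    simp only [fc_const_mul]
  · rw [fc_add n (hc _) (g := fun t => Complex.I * l i * c (Sum.inr (Sum.inr ())) t) (by fun_prop),
      fc_const_mul]
  · rw [fc_const_mul]

end Transition

/-! ### Sections over `Z` in tube coordinates. -/

namespace PrincipalCircleBundle

variable {EM M EZ Z : Type*}
  [NormedAddCommGroup EM] [NormedSpace ℝ EM] [FiniteDimensional ℝ EM]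
  [TopologicalSpace M] [ChartedSpace EM M]
  [NormedAddCommGroup EZ] [NormedSpace ℝ EZ] [TopologicalSpace Z] [ChartedSpace EZ Z]
  [MulAction Circle Z] {B : PrincipalCircleBundle EM M EZ Z}
  [IsManifold 𝓘(ℝ, EM) ∞ M] [IsManifold 𝓘(ℝ, EZ) ∞ Z] (A : Connection EZ Z)
  {σ : M → Z} {U : Set M} (hσ : B.IsLocalSection σ U) (p₀ : M)
  {ι : Type*} [Fintype ι] (bM : Module.Basis ι ℝ EM)

/-- The basis of `EM × ℝ` extending a basis of `EM`. -/
def tubeBasis : Module.Basis (ι ⊕ Unit) ℝ (EM × ℝ) := bM.prod (Module.Basis.singleton Unit ℝ)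

@[simp] theorem tubeBasis_inl (i : ι) : tubeBasis bM (.inl i) = (bM i, 0) := by
  simp [tubeBasis]

@[simp] theorem tubeBasis_inr (i : Unit) : tubeBasis bM (.inr i) = ((0 : EM), (1 : ℝ)) := by
  simp [tubeBasis]

include hσ in
theorem tube_inv {u : EM} (hu : u ∈ chartDom EM p₀ U) (t : ℝ) :
    (dM (EM × ℝ) EZ (tube EM σ p₀) (u, t)).IsInvertible :=
  (isParam_tube hσ p₀).isInvertible ⟨hu, mem_univ _⟩

/-- The components of the connection in a basis. -/
def lform (σ : M → Z) (i : ι) (u : EM) : ℂ := (tubeForm p₀ A σ u (bM i) : ℝ)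

include hσ in
theorem contDiffOn_lform (i : ι) : ContDiffOn ℝ ∞ (lform A p₀ bM σ i) (chartDom EM p₀ U) :=
  Complex.ofRealCLM.contDiff.comp_contDiffOn (contDiffOn_tubeForm hσ p₀ A (bM i))

include hσ in
theorem contDiffOn_lform_fst (i : ι) :
    ContDiffOn ℝ ∞ (fun y : EM × ℝ => lform A p₀ bM σ i y.1) (chartDom EM p₀ U ×ˢ univ) :=
  ContDiffOn.comp (g := lform A p₀ bM σ i) (f := Prod.fst) (contDiffOn_lform A hσ p₀ bM i)
    contDiffOn_fst fun _ hy => hy.1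

-- The four blocks come from the four ingredients of `psiInv`: `dπ` forgets `t`, the connection is
-- `ℓ + dt`, the horizontal lift is `∂_w - ℓ(w) ∂_t`, and `v = -i ∂_t`. The resulting matrix depends
-- on `u` only.
include hσ in
theorem ecoL_psiInv {u : EM} (hu : u ∈ chartDom EM p₀ U) (t : ℝ) (g : Cplx EZ × (EZ →L[ℝ] ℂ))
    (k : (ι ⊕ Unit) ⊕ (ι ⊕ Unit)) :
    ecoL bM (extChartAt 𝓘(ℝ, EM) p₀).symm u k (psiInv B A (tube EM σ p₀ (u, t)) g) =
      toM (fun i => lform A p₀ bM σ i u)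
        (fun k => gcoL (tubeBasis bM) (tube EM σ p₀) (u, t) k g) k := by
  classical
  have hinv := tube_inv hσ p₀ hu t
  have hinvM := (isParam_base hσ p₀).isInvertible hu
  have hgen : gen EZ (tube EM σ p₀ (u, t)) = dM (EM × ℝ) EZ (tube EM σ p₀) (u, t) (0, 1) :=
    (dM_tube_snd hσ p₀ hu t).symm
  have hpr : ∀ v, dM EZ EM B.proj (tube EM σ p₀ (u, t)) (dM (EM × ℝ) EZ (tube EM σ p₀) (u, t) v)
      = dM EM EM (extChartAt 𝓘(ℝ, EM) p₀).symm u v.1 := fun v =>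
    congrArg (fun T : (EM × ℝ) →L[ℝ] EM => T v) (dM_proj_tube hσ p₀ (y := (u, t)) hu)
  rcases k with (i | i) | (i | i)
  -- The base coframe pulled back by `π` is the horizontal part of the tube coframe; it suffices to
  -- compare them on the tube frame.
  · have hc : coframe bM (extChartAt 𝓘(ℝ, EM) p₀).symm i u ∘L
        dM EZ EM B.proj (tube EM σ p₀ (u, t))
          = coframe (tubeBasis bM) (tube EM σ p₀) (.inl i) (u, t) := by
      refine cov_ext (b := tubeBasis bM) hinv fun j => ?_
      rw [coframe_frame hinv, ContinuousLinearMap.comp_apply, hpr]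
      rcases j with j | j
      · simp only [tubeBasis_inl, coframe_frame hinvM, Sum.inl.injEq]
      · simp only [tubeBasis_inr, map_zero, reduceCtorEq, if_false]
    change Cplx.eval (coframe bM (extChartAt 𝓘(ℝ, EM) p₀).symm i u ∘L
        dM EZ EM B.proj (tube EM σ p₀ (u, t))) g.1 = _
    rw [hc]
    rfl
  · change Complex.I * Cplx.eval (Complex.ofRealCLM ∘L A.cov (tube EM σ p₀ (u, t))) g.1 = _
    rw [eval_eq_sum (b := tubeBasis bM) hinv]
    simp only [Fintype.sum_sum_type, ContinuousLinearMap.comp_apply, tubeBasis_inl, tubeBasis_inr,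
      form_dM_tube hσ p₀ A hu t, toM, gcoL]
    have h0 : tubeForm p₀ A σ u 0 = 0 :=
      map_zero (cpull (E := EZ) (tube EM σ p₀) A.cov (u, 0))
    simp [lform, h0]
  · change g.2 (hlift B A (tube EM σ p₀ (u, t))
      (dM EM EM (extChartAt 𝓘(ℝ, EM) p₀).symm u (bM i))) = _
    rw [hlift_dM_base hσ p₀ A hu]
    have h0 : ((bM i, -tubeForm p₀ A σ u (bM i)) : EM × ℝ)
        = (bM i, 0) + (-tubeForm p₀ A σ u (bM i)) • (0, 1) := by ext <;> simp
    rw [h0, map_add, map_add, map_smul, map_smul]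
    simp [toM, gcoL, lform, Complex.real_smul, sub_eq_add_neg]
  · change Cplx.eval g.2 (Cplx.mk 0 (-gen EZ (tube EM σ p₀ (u, t)))) = _
    rw [hgen]
    simp [toM, gcoL, Cplx.eval_def]

include hσ in
theorem gcoL_mpsi {u : EM} (hu : u ∈ chartDom EM p₀ U) (t : ℝ) (e : EF EM)
    (k : (ι ⊕ Unit) ⊕ (ι ⊕ Unit)) :
    gcoL (tubeBasis bM) (tube EM σ p₀) (u, t) k (mpsi B A (tube EM σ p₀ (u, t)) e) =
      toZ (fun i => lform A p₀ bM σ i u)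
        (fun k => ecoL bM (extChartAt 𝓘(ℝ, EM) p₀).symm u k e) k := by
  have h := fun k => ecoL_psiInv A hσ p₀ bM hu t (mpsi B A (tube EM σ p₀ (u, t)) e) k
  rw [psiInv_mpsi] at h
  simp only [h, toZ_toM]

/-- The components on the base of a section of the generalized tangent bundle over `Z`. -/
def ecoZ (B : PrincipalCircleBundle EM M EZ Z) (σ : M → Z) (a : Z → Cplx EZ × (EZ →L[ℝ] ℂ))
    (k : (ι ⊕ Unit) ⊕ (ι ⊕ Unit)) (y : EM × ℝ) : ℂ :=
  ecoL bM (extChartAt 𝓘(ℝ, EM) p₀).symm y.1 k (psiInv B A (tube EM σ p₀ y) (a (tube EM σ p₀ y)))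

include hσ in
theorem ecoZ_eq (a : Z → Cplx EZ × (EZ →L[ℝ] ℂ)) (k : (ι ⊕ Unit) ⊕ (ι ⊕ Unit)) {y : EM × ℝ}
    (hy : y.1 ∈ chartDom EM p₀ U) :
    ecoZ A p₀ bM B σ a k y = toM (fun i => lform A p₀ bM σ i y.1)
      (fun k => gco (tubeBasis bM) (tube EM σ p₀) a k y) k :=
  ecoL_psiInv A hσ p₀ bM hy y.2 _ k

include hσ in
theorem gco_eq (a : Z → Cplx EZ × (EZ →L[ℝ] ℂ)) (k : (ι ⊕ Unit) ⊕ (ι ⊕ Unit)) {y : EM × ℝ}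
    (hy : y.1 ∈ chartDom EM p₀ U) :
    gco (tubeBasis bM) (tube EM σ p₀) a k y = toZ (fun i => lform A p₀ bM σ i y.1)
      (fun k => ecoZ A p₀ bM B σ a k y) k := by
  simp only [ecoZ_eq A hσ p₀ bM a _ hy, toZ_toM]

-- Periodicity of components requires the frame, and not only the point, to return after one turn.
include hσ in
theorem dM_tube_add_two_pi {u : EM} (hu : u ∈ chartDom EM p₀ U) (t : ℝ) :
    dM (EM × ℝ) EZ (tube EM σ p₀) (u, t + 2 * Real.pi) = dM (EM × ℝ) EZ (tube EM σ p₀) (u, t) := by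
  rw [dM_tube_shift hσ p₀ hu, dM_tube_shift hσ p₀ hu t, Circle.exp_add, Circle.exp_two_pi, mul_one]

include hσ in
theorem perSmooth_gco {a : ∀ p : Z, GTan EZ p} (ha : ∀ p, SmoothGAt a p)
    (k : (ι ⊕ Unit) ⊕ (ι ⊕ Unit)) :
    PerSmooth (chartDom EM p₀ U) (gco (E := EZ) (tubeBasis bM) (tube EM σ p₀) a k) where
  smooth := by
    rintro y hy
    exact (((isParam_tube hσ p₀).smoothGAt_iff hy a).1 (ha _) k).contDiffWithinAt
  per u hu t := by
    have h1 : ∀ k g, gcoL (E := EZ) (tubeBasis bM) (tube EM σ p₀) (u, t + 2 * Real.pi) k g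
        = gcoL (tubeBasis bM) (tube EM σ p₀) (u, t) k g := by
      intro k g
      rcases k with k | k <;> simp [gcoL, coframe, dM_tube_add_two_pi hσ p₀ hu]
    have h2 := tube_add_two_pi (EM := EM) (σ := σ) p₀ u t
    refine (h1 k _).trans ?_
    exact congrArg (fun p => gcoL (E := EZ) (tubeBasis bM) (tube EM σ p₀) (u, t) k (a p)) h2

include hσ in
theorem perSmooth_ecoZ {a : ∀ p : Z, GTan EZ p} (ha : ∀ p, SmoothGAt a p)
    (k : (ι ⊕ Unit) ⊕ (ι ⊕ Unit)) :
    PerSmooth (chartDom EM p₀ U) (ecoZ A p₀ bM B σ a k) where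
  smooth := by
    have h1 := contDiffOn_toM (contDiffOn_lform_fst A hσ p₀ bM)
      (fun k => (perSmooth_gco hσ p₀ bM ha k).smooth) k
    refine h1.congr fun y hy => ?_
    exact ecoZ_eq A hσ p₀ bM a k hy.1
  per u hu t := by
    rw [ecoZ_eq A hσ p₀ bM a k (y := (u, t + 2 * Real.pi)) hu,
      ecoZ_eq A hσ p₀ bM a k (y := (u, t)) hu]
    have h : ∀ k, gco (E := EZ) (tubeBasis bM) (tube EM σ p₀) a k (u, t + 2 * Real.pi)
        = gco (E := EZ) (tubeBasis bM) (tube EM σ p₀) a k (u, t) :=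
      fun k => (perSmooth_gco hσ p₀ bM ha k).per u hu t
    exact congrArg (fun c => toM _ c k) (funext h)

include hσ in
theorem smoothGAt_of_ecoZ {a : ∀ p : Z, GTan EZ p}
    (h : ∀ k, ContDiffOn ℝ ∞ (ecoZ A p₀ bM B σ a k) (chartDom EM p₀ U ×ˢ univ)) {y : EM × ℝ}
    (hy : y.1 ∈ chartDom EM p₀ U) : SmoothGAt a (tube EM σ p₀ y) := by
  refine ((isParam_tube hσ p₀).smoothGAt_iff (b := tubeBasis bM) ⟨hy, mem_univ _⟩ a).2 fun k => ?_
  have h1 := contDiffOn_toZ (contDiffOn_lform_fst A hσ p₀ bM) h k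
  have h2 := h1.contDiffAt (((isOpen_chartDom hσ p₀).prod isOpen_univ).mem_nhds ⟨hy, mem_univ y.2⟩)
  refine h2.congr_of_eventuallyEq ?_
  filter_upwards [((isOpen_chartDom hσ p₀).prod isOpen_univ).mem_nhds ⟨hy, mem_univ y.2⟩] with y' hy'
  exact gco_eq A hσ p₀ bM a k hy'.1

end PrincipalCircleBundle

/-! ### Fourier coefficients of vector-valued functions -/

section VectorFourier

variable {V V' : Type*} [AddCommGroup V] [Module ℂ V] [Module.Finite ℂ V]
  [AddCommGroup V'] [Module ℂ V'] [Module.Finite ℂ V']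

/-- Continuity of all scalar components. -/
def WCont (u : ℝ → V) : Prop := ∀ ℓ : V →ₗ[ℂ] ℂ, Continuous fun t => ℓ (u t)

/-- Fourier coefficients of a function with values in a finite dimensional space. -/
def fcV (n : ℤ) (u : ℝ → V) : V :=
  ∑ k, fc n (fun s => (Module.finBasis ℂ V).coord k (u s)) • Module.finBasis ℂ V k

/-- Shows that the coefficient does not depend on the basis used in `fcV`, since it commutes with
every functional. The later properties follow by testing against functionals. -/
theorem apply_fcV (n : ℤ) {u : ℝ → V} (hu : WCont u) (ℓ : V →ₗ[ℂ] ℂ) :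
    ℓ (fcV n u) = fc n (fun s => ℓ (u s)) := by
  have h : (fun s => ℓ (u s)) = fun s => ∑ k, ℓ (Module.finBasis ℂ V k)
      * (Module.finBasis ℂ V).coord k (u s) := by
    funext s
    conv_lhs => rw [← (Module.finBasis ℂ V).sum_repr (u s), map_sum]
    refine Finset.sum_congr rfl fun k _ => ?_
    rw [map_smul, smul_eq_mul, mul_comm]
    rfl
  rw [h, fc_sum n _ (f := fun k s => ℓ (Module.finBasis ℂ V k)
      * (Module.finBasis ℂ V).coord k (u s))
    (fun k => continuous_const.mul (hu ((Module.finBasis ℂ V).coord k)))]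
  simp only [fcV, map_sum, map_smul, fc_const_mul, smul_eq_mul]
  exact Finset.sum_congr rfl fun k _ => mul_comm _ _

theorem dual_ext {v w : V} (h : ∀ ℓ : V →ₗ[ℂ] ℂ, ℓ v = ℓ w) : v = w :=
  (Module.finBasis ℂ V).ext_elem fun k => h ((Module.finBasis ℂ V).coord k)

theorem WCont.map {u : ℝ → V} (hu : WCont u) (P : V →ₗ[ℂ] V') : WCont fun t => P (u t) :=
  fun ℓ => hu (ℓ ∘ₗ P)

theorem fcV_map (n : ℤ) {u : ℝ → V} (hu : WCont u) (P : V →ₗ[ℂ] V') :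
    fcV n (fun t => P (u t)) = P (fcV n u) :=
  dual_ext fun ℓ => (apply_fcV n (hu.map P) ℓ).trans (apply_fcV n hu (ℓ ∘ₗ P)).symm

theorem fcV_add (n : ℤ) {u w : ℝ → V} (hu : WCont u) (hw : WCont w) :
    fcV n (fun t => u t + w t) = fcV n u + fcV n w := by
  refine dual_ext fun ℓ => ?_
  have hs : WCont fun t => u t + w t := fun ℓ => by
    simp only [map_add]; exact (hu ℓ).add (hw ℓ)
  rw [apply_fcV n hs, map_add, apply_fcV n hu, apply_fcV n hw, ← fc_add n (hu ℓ) (hw ℓ)]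
  simp only [map_add]

theorem fcV_smul (n : ℤ) {u : ℝ → V} (hu : WCont u) (c : ℂ) :
    fcV n (fun t => c • u t) = c • fcV n u :=
  fcV_map n hu (LinearMap.lsmul ℂ V c)

theorem fcV_shift (n : ℤ) {u : ℝ → V} (hu : Function.Periodic u (2 * Real.pi)) (a : ℝ) :
    fcV n (fun s => u (s + a)) = expI (-n) a • fcV n u := by
  simp only [fcV, Finset.smul_sum, smul_smul]
  refine Finset.sum_congr rfl fun k _ => ?_
  rw [fc_shift n (g := fun s => (Module.finBasis ℂ V).coord k (u s))]
  intro t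
  simp only [hu t]

theorem WCont.of_sum {K : Type*} [Fintype K] {u : ℝ → V} {c : K → ℝ → ℂ} {e : K → V}
    (hc : ∀ k, Continuous (c k)) (h : ∀ t, u t = ∑ k, c k t • e k) : WCont u := by
  intro ℓ
  simp only [h, map_sum, map_smul, smul_eq_mul]
  exact continuous_finsetSum _ fun k _ => (hc k).mul continuous_const

end VectorFourier

/-- A real basis of `V` spans the complexification over `ℂ`. -/
instance (V : Type*) [AddCommGroup V] [Module ℝ V] [Module.Finite ℝ V] : Module.Finite ℂ (Cplx V) := by
  refine Module.Finite.of_surjective (M := Fin (Module.finrank ℝ V) → ℂ)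
    (∑ k, (LinearMap.proj k).smulRight (Cplx.mk (Module.finBasis ℝ V k) 0)) fun u => ?_
  refine ⟨fun k => (Module.finBasis ℝ V).coord k u.re + Complex.I * (Module.finBasis ℝ V).coord k u.im,
    ?_⟩
  have hre : ∀ (s : Finset (Fin (Module.finrank ℝ V))) (f : Fin (Module.finrank ℝ V) → Cplx V),
      (∑ k ∈ s, f k).re = ∑ k ∈ s, (f k).re := fun s f =>
    map_sum (AddMonoidHom.mk' Cplx.re fun _ _ => rfl) f s
  have him : ∀ (s : Finset (Fin (Module.finrank ℝ V))) (f : Fin (Module.finrank ℝ V) → Cplx V),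
      (∑ k ∈ s, f k).im = ∑ k ∈ s, (f k).im := fun s f =>
    map_sum (AddMonoidHom.mk' Cplx.im fun _ _ => rfl) f s
  simp only [LinearMap.sum_apply, LinearMap.smulRight_apply, LinearMap.proj_apply]
  apply Cplx.ext'
  · rw [hre]
    simpa using (Module.finBasis ℝ V).sum_repr u.re
  · rw [him]
    simpa using (Module.finBasis ℝ V).sum_repr u.im

instance (V : Type*) [NormedAddCommGroup V] [NormedSpace ℝ V] [FiniteDimensional ℝ V] :
    Module.Finite ℂ (V →L[ℝ] ℂ) := Module.Finite.of_restrictScalars_finite ℝ ℂ _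

/-! ### Rapid decrease in coordinates -/

section RapidLemmas

variable {E : Type*} [NormedAddCommGroup E] [NormedSpace ℝ E] {W : Set E}

theorem Rapid.add {F : Type*} [NormedAddCommGroup F] [NormedSpace ℝ F] {c d : ℤ → E → F}
    (h : Rapid W c) (h' : Rapid W d) (hW : IsOpen W) (hc : ∀ n, ContDiffOn ℝ ∞ (c n) W)
    (hd : ∀ n, ContDiffOn ℝ ∞ (d n) W) : Rapid W (fun n u => c n u + d n u) := by
  have := Rapid.sum (Finset.univ : Finset Bool) (c := fun i => bif i then c else d)
    (by rintro (_ | _) <;> assumption) hW (by rintro (_ | _) <;> assumption)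
  exact this.congr hW fun n u _ => by simp

variable {M : Type*} [TopologicalSpace M] [ChartedSpace E M]
  [IsManifold 𝓘(ℝ, E) ∞ M]

/-- The chart maps compact subsets of its source inside `U` to compact subsets of the coordinate
domain, and conversely, so the conditions on manifold and on coordinates quantify over the same
sets. -/
theorem rapidlyDecreasingOn_iff {F : Type*} [NormedAddCommGroup F] [NormedSpace ℝ F]
    (V : M → Type*) [TopologicalSpace (Bundle.TotalSpace F V)] [∀ p, TopologicalSpace (V p)]
    [FiberBundle F V] (s : ℤ → ∀ p : M, V p) (U : Set M) :
    RapidlyDecreasingOn (E := E) (F := F) V s U ↔ ∀ p₀ : M,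
      Rapid (PrincipalCircleBundle.chartDom E p₀ U) (fun n u => (trivializationAt F V p₀
            ⟨(extChartAt 𝓘(ℝ, E) p₀).symm u, s n ((extChartAt 𝓘(ℝ, E) p₀).symm u)⟩).2) := by
  constructor
  · intro h p₀ K hK hKW r l
    obtain ⟨C, hC⟩ := h p₀ ((extChartAt 𝓘(ℝ, E) p₀).symm '' K)
      (hK.image_of_continuousOn ((continuousOn_extChartAt_symm p₀).mono fun u hu => (hKW hu).1))
      (by rintro _ ⟨u, hu, rfl⟩; exact (hKW hu).2)
      (by
        rintro _ ⟨u, hu, rfl⟩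
        rw [← extChartAt_source 𝓘(ℝ, E)]
        exact (extChartAt 𝓘(ℝ, E) p₀).map_target (hKW hu).1) r l
    refine ⟨C, fun n u hu => ?_⟩
    have := hC n _ ⟨u, hu, rfl⟩
    rwa [(extChartAt 𝓘(ℝ, E) p₀).right_inv (hKW hu).1] at this
  · intro h p₀ K hK hKU hKs r l
    rw [← extChartAt_source 𝓘(ℝ, E)] at hKs
    obtain ⟨C, hC⟩ := h p₀ (extChartAt 𝓘(ℝ, E) p₀ '' K)
      (hK.image_of_continuousOn ((continuousOn_extChartAt p₀).mono hKs))
      (by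
        rintro _ ⟨q, hq, rfl⟩
        refine ⟨(extChartAt 𝓘(ℝ, E) p₀).map_source (hKs hq), ?_⟩
        rw [mem_preimage, (extChartAt 𝓘(ℝ, E) p₀).left_inv (hKs hq)]
        exact hKU hq) r l
    exact ⟨C, fun n q hq => hC n _ ⟨q, hq, rfl⟩⟩

variable {D : Type*} [NormedAddCommGroup D] [NormedSpace ℝ D] [FiniteDimensional ℝ D]
  {κ : Type*} [Fintype κ] {b : Module.Basis κ ℝ D} {Ψ : D → M} {Ω : Set D}

theorem contDiffOn_vpull {x : M → Cplx E} (hΩ : IsOpen Ω)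
    (h : ∀ i, ContDiffOn ℝ ∞ (vco b Ψ x i) Ω) :
    ContDiffOn ℝ ∞ (vpull Ψ (fun p => (x p).re)) Ω ∧
      ContDiffOn ℝ ∞ (vpull Ψ (fun p => (x p).im)) Ω := by
  have h1 := fun y hy => (contDiffAt_vco_iff (b := b) (Ψ := Ψ) (y := y) x).2
    fun i => (h i).contDiffAt (hΩ.mem_nhds hy)
  exact ⟨fun y hy => (h1 y hy).1.contDiffWithinAt, fun y hy => (h1 y hy).2.contDiffWithinAt⟩

theorem rapid_vco_iff {x : ℤ → M → Cplx E} (hΩ : IsOpen Ω)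
    (hx : ∀ n i, ContDiffOn ℝ ∞ (vco b Ψ (x n) i) Ω) :
    (Rapid Ω (fun n => vpull Ψ (fun p => (x n p).re)) ∧
      Rapid Ω (fun n => vpull Ψ (fun p => (x n p).im))) ↔
      ∀ i, Rapid Ω (fun n => vco b Ψ (x n) i) := by
  have hs := fun n => contDiffOn_vpull hΩ (hx n)
  constructor
  · rintro ⟨h1, h2⟩ i
    let c : D →L[ℝ] ℂ := Complex.ofRealCLM ∘L LinearMap.toContinuousLinearMap (b.coord i)
    exact (h1.clm_comp hΩ (fun n => (hs n).1) c).add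
      (h2.clm_comp hΩ (fun n => (hs n).2) (Complex.I • c)) hΩ
      (fun n => c.contDiff.comp_contDiffOn (hs n).1)
      (fun n => (Complex.I • c).contDiff.comp_contDiffOn (hs n).2)
  · intro h
    constructor
    · have := Rapid.sum Finset.univ (fun i => (h i).clm_comp hΩ (fun n => hx n i)
        (Complex.reCLM.smulRight (b i))) hΩ
        (fun i n => (Complex.reCLM.smulRight (b i)).contDiff.comp_contDiffOn (hx n i))
      exact this.congr hΩ fun n u _ => vpull_re (x n) u
    · have := Rapid.sum Finset.univ (fun i => (h i).clm_comp hΩ (fun n => hx n i)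
        (Complex.imCLM.smulRight (b i))) hΩ
        (fun i n => (Complex.imCLM.smulRight (b i)).contDiff.comp_contDiffOn (hx n i))
      exact this.congr hΩ fun n u _ => vpull_im (x n) u

theorem rapid_fco_iff {α : ℤ → M → E →L[ℝ] ℂ} (hΩ : IsOpen Ω)
    (hx : ∀ n i, ContDiffOn ℝ ∞ (fco b Ψ (α n) i) Ω) :
    Rapid Ω (fun n => cpull Ψ (α n)) ↔ ∀ i, Rapid Ω (fun n => fco b Ψ (α n) i) := by
  have hs : ∀ n, ContDiffOn ℝ ∞ (cpull Ψ (α n)) Ω := fun n y hy =>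
    ((contDiffAt_fco_iff (b := b) (α n)).2
      fun i => (hx n i).contDiffAt (hΩ.mem_nhds hy)).contDiffWithinAt
  constructor
  · intro h i
    exact h.clm_comp hΩ hs (ContinuousLinearMap.apply ℝ ℂ (b i))
  · intro h
    let c : κ → ℂ →L[ℝ] (D →L[ℝ] ℂ) := fun i => (ContinuousLinearMap.smulRightL ℝ D ℂ)
      (LinearMap.toContinuousLinearMap (b.coord i))
    have := Rapid.sum Finset.univ (fun i => (h i).clm_comp hΩ (fun n => hx n i) (c i)) hΩ
        (fun i n => (c i).contDiff.comp_contDiffOn (hx n i))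
    refine this.congr hΩ fun n u _ => ?_
    ext v
    conv_lhs => rw [← b.sum_repr v]
    simp only [map_sum, map_smul, sum_apply]
    refine Finset.sum_congr rfl fun i _ => ?_
    rw [fco_eq]
    simp [c]

end RapidLemmas

/-! ### Smooth and rapidly decreasing sections over the base, in charts. -/

namespace PrincipalCircleBundle

variable {EM M EZ Z : Type*}
  [NormedAddCommGroup EM] [NormedSpace ℝ EM] [FiniteDimensional ℝ EM]
  [TopologicalSpace M] [ChartedSpace EM M]
  [NormedAddCommGroup EZ] [NormedSpace ℝ EZ] [TopologicalSpace Z] [ChartedSpace EZ Z]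
  [MulAction Circle Z] {B : PrincipalCircleBundle EM M EZ Z}
  [IsManifold 𝓘(ℝ, EM) ∞ M] [IsManifold 𝓘(ℝ, EZ) ∞ Z]
  {U : Set M} {ι : Type*} [Fintype ι] (bM : Module.Basis ι ℝ EM)

theorem isOpen_chartDom' (hU : IsOpen U) (p₀ : M) : IsOpen (chartDom EM p₀ U) :=
  (continuousOn_extChartAt_symm p₀).isOpen_inter_preimage (isOpen_extChartAt_target p₀) hU

theorem isParam_base' (hU : IsOpen U) (p₀ : M) :
    IsParam EM (extChartAt 𝓘(ℝ, EM) p₀).symm (chartDom EM p₀ U) :=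
  (isParam_chart p₀).mono (isOpen_chartDom' hU p₀) inter_subset_left

variable (EM) in
theorem forall_chartDom_iff (U : Set M) (P : M → Prop) :
    (∀ q ∈ U, P q) ↔ ∀ p₀ : M, ∀ u ∈ chartDom EM p₀ U, P ((extChartAt 𝓘(ℝ, EM) p₀).symm u) := by
  refine ⟨fun h p₀ u hu => h _ hu.2, fun h q hq => ?_⟩
  have h1 := extChartAt_to_inv (I := 𝓘(ℝ, EM)) q
  have := h q (extChartAt 𝓘(ℝ, EM) q q) ⟨mem_extChartAt_target q, by rw [mem_preimage, h1]; exact hq⟩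
  rwa [h1] at this

/-- The components of a section of `TM ⊕ 1 ⊕ T^*M ⊕ 1` in a chart. -/
def ecoM (p₀ : M) (e : M → EF EM) (k : (ι ⊕ Unit) ⊕ (ι ⊕ Unit)) (u : EM) : ℂ :=
  ecoL bM (extChartAt 𝓘(ℝ, EM) p₀).symm u k (e ((extChartAt 𝓘(ℝ, EM) p₀).symm u))

theorem contMDiffOn_iff_chartDom (hU : IsOpen U) (f : M → ℂ) :
    ContMDiffOn 𝓘(ℝ, EM) 𝓘(ℝ, ℂ) ∞ f U ↔ ∀ p₀ : M,
      ContDiffOn ℝ ∞ (fun u => f ((extChartAt 𝓘(ℝ, EM) p₀).symm u)) (chartDom EM p₀ U) := by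
  have h1 : ContMDiffOn 𝓘(ℝ, EM) 𝓘(ℝ, ℂ) ∞ f U ↔ ∀ q ∈ U, ContMDiffAt 𝓘(ℝ, EM) 𝓘(ℝ, ℂ) ∞ f q :=
    ⟨fun h q hq => h.contMDiffAt (hU.mem_nhds hq), fun h q hq => (h q hq).contMDiffWithinAt⟩
  rw [h1, forall_chartDom_iff EM]
  refine forall_congr' fun p₀ => ?_
  rw [(isOpen_chartDom' hU p₀).contDiffOn_iff]
  exact forall₂_congr fun u hu => (isParam_base' hU p₀).contMDiffAt_iff hu

theorem smoothE_iff (hU : IsOpen U) (e : ∀ x : M, EFib EM x) :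
    (SmoothCVecOn (fun x => (e x).1) U ∧
      ContMDiffOn 𝓘(ℝ, EM) 𝓘(ℝ, ℂ) ∞ (fun x => (e x).2.1) U ∧
      SmoothFormOn (fun x => (e x).2.2.1) U ∧
      ContMDiffOn 𝓘(ℝ, EM) 𝓘(ℝ, ℂ) ∞ (fun x => (e x).2.2.2) U) ↔
    ∀ p₀ k, ContDiffOn ℝ ∞ (ecoM bM p₀ e k) (chartDom EM p₀ U) := by
  have hv : SmoothCVecOn (fun x => (e x).1) U ↔ ∀ p₀ : M, ∀ i,
      ContDiffOn ℝ ∞ (ecoM bM p₀ e (.inl (.inl i))) (chartDom EM p₀ U) := by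
    have h1 : SmoothCVecOn (fun x => (e x).1) U ↔ ∀ q ∈ U,
        SmoothVecAt EM (fun x => (e x).1.re) q ∧ SmoothVecAt EM (fun x => (e x).1.im) q :=
      ⟨fun h q hq => ⟨h.1.contMDiffAt (hU.mem_nhds hq), h.2.contMDiffAt (hU.mem_nhds hq)⟩,
        fun h => ⟨fun q hq => (h q hq).1.contMDiffWithinAt, fun q hq => (h q hq).2.contMDiffWithinAt⟩⟩
    rw [h1, forall_chartDom_iff EM]
    refine forall_congr' fun p₀ => ?_
    have h2 : ∀ i, ContDiffOn ℝ ∞ (ecoM bM p₀ e (.inl (.inl i))) (chartDom EM p₀ U) ↔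
        ∀ u ∈ chartDom EM p₀ U, ContDiffAt ℝ ∞ (ecoM bM p₀ e (.inl (.inl i))) u := fun i =>
      (isOpen_chartDom' hU p₀).contDiffOn_iff
    simp only [h2]
    refine Iff.trans (forall₂_congr fun u hu =>
      (isParam_base' hU p₀).smooth_vco_iff (b := bM) hu (fun x => (e x).1)) ?_
    exact ⟨fun h i u hu => h u hu i, fun h u hu i => h i u hu⟩
  have hf : SmoothFormOn (fun x => (e x).2.2.1) U ↔ ∀ p₀ : M, ∀ i,
      ContDiffOn ℝ ∞ (ecoM bM p₀ e (.inr (.inl i))) (chartDom EM p₀ U) := by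
    have h1 : SmoothFormOn (fun x => (e x).2.2.1) U ↔ ∀ q ∈ U,
        SmoothFormAt (fun x => (e x).2.2.1) q :=
      ⟨fun h q hq => h.contMDiffAt (hU.mem_nhds hq),
        fun h => fun q hq => (h q hq).contMDiffWithinAt⟩
    rw [h1, forall_chartDom_iff EM]
    refine forall_congr' fun p₀ => ?_
    have h2 : ∀ i, ContDiffOn ℝ ∞ (ecoM bM p₀ e (.inr (.inl i))) (chartDom EM p₀ U) ↔
        ∀ u ∈ chartDom EM p₀ U, ContDiffAt ℝ ∞ (ecoM bM p₀ e (.inr (.inl i))) u := fun i =>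
      (isOpen_chartDom' hU p₀).contDiffOn_iff
    simp only [h2]
    refine Iff.trans (forall₂_congr fun u hu =>
      (isParam_base' hU p₀).smooth_fco_iff (b := bM) hu (fun x => (e x).2.2.1)) ?_
    exact ⟨fun h i u hu => h u hu i, fun h u hu i => h i u hu⟩
  rw [hv, hf, contMDiffOn_iff_chartDom hU, contMDiffOn_iff_chartDom hU]
  constructor
  · rintro ⟨h1, h2, h3, h4⟩ p₀ ((i | i) | (i | i))
    exacts [h1 p₀ i, h2 p₀, h3 p₀ i, h4 p₀]
  · intro h
    exact ⟨fun p₀ i => h p₀ _, fun p₀ => h p₀ (.inl (.inr ())), fun p₀ i => h p₀ _,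
      fun p₀ => h p₀ (.inr (.inr ()))⟩

theorem rapid_fun_iff (f : ℤ → M → ℂ) (U : Set M) :
    RapidlyDecreasingOn (E := EM) (F := ℂ) (Bundle.Trivial M ℂ) f U ↔ ∀ p₀ : M,
      Rapid (chartDom EM p₀ U) (fun n u => f n ((extChartAt 𝓘(ℝ, EM) p₀).symm u)) :=
  rapidlyDecreasingOn_iff _ f U

theorem rapidE_iff (hU : IsOpen U) (e : ℤ → ∀ x : M, EFib EM x)
    (he : ∀ n p₀ k, ContDiffOn ℝ ∞ (ecoM bM p₀ (e n) k) (chartDom EM p₀ U)) :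
    (RapidlyDecreasingOn (E := EM) (F := EM) (TangentSpace 𝓘(ℝ, EM) : M → Type _)
      (fun n x => (e n x).1.re) U ∧
    RapidlyDecreasingOn (E := EM) (F := EM) (TangentSpace 𝓘(ℝ, EM) : M → Type _)
      (fun n x => (e n x).1.im) U ∧
    RapidlyDecreasingOn (E := EM) (F := ℂ) (Bundle.Trivial M ℂ) (fun n x => (e n x).2.1) U ∧
    RapidlyDecreasingOn (E := EM) (F := EM →L[ℝ] ℂ)
      (fun x : M => TangentSpace 𝓘(ℝ, EM) x →L[ℝ] Bundle.Trivial M ℂ x)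
      (fun n x => (e n x).2.2.1) U ∧
    RapidlyDecreasingOn (E := EM) (F := ℂ) (Bundle.Trivial M ℂ) (fun n x => (e n x).2.2.2) U) ↔
    ∀ p₀ k, Rapid (chartDom EM p₀ U) (fun n => ecoM bM p₀ (e n) k) := by
  have hvec : ∀ x : ℤ → M → EM, RapidlyDecreasingOn (E := EM) (F := EM)
      (TangentSpace 𝓘(ℝ, EM) : M → Type _) x U ↔ ∀ p₀ : M,
        Rapid (chartDom EM p₀ U) (fun n => vpull (E := EM) (extChartAt 𝓘(ℝ, EM) p₀).symm (x n)) := by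
    intro x
    have h1 := rapidlyDecreasingOn_iff (E := EM) (F := EM)
      (TangentSpace 𝓘(ℝ, EM) : M → Type _) x U
    refine h1.trans (forall_congr' fun p₀ => ?_)
    have ho := isOpen_chartDom' (EM := EM) hU p₀
    exact ⟨fun h => h.congr ho fun n u hu => (vec_trivialization p₀ hu.1 (x n)).symm,
      fun h => h.congr ho fun n u hu => vec_trivialization p₀ hu.1 (x n)⟩
  have hcov : ∀ α : ℤ → M → EM →L[ℝ] ℂ, RapidlyDecreasingOn (E := EM) (F := EM →L[ℝ] ℂ)
      (fun x : M => TangentSpace 𝓘(ℝ, EM) x →L[ℝ] Bundle.Trivial M ℂ x) α U ↔ ∀ p₀ : M,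
        Rapid (chartDom EM p₀ U) (fun n => cpull (extChartAt 𝓘(ℝ, EM) p₀).symm (α n)) := by
    intro α
    refine (rapidlyDecreasingOn_iff (E := EM) (F := EM →L[ℝ] ℂ)
      (fun x : M => TangentSpace 𝓘(ℝ, EM) x →L[ℝ] Bundle.Trivial M ℂ x) α U).trans (forall_congr' fun p₀ => ?_)
    have ho := isOpen_chartDom' (EM := EM) hU p₀
    exact ⟨fun h => h.congr ho fun n u hu => (cov_trivialization p₀ hu.1 (α n)).symm,
      fun h => h.congr ho fun n u hu => cov_trivialization p₀ hu.1 (α n)⟩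
  have hv : ∀ p₀ : M, _ := fun p₀ => rapid_vco_iff (b := bM) (Ψ := (extChartAt 𝓘(ℝ, EM) p₀).symm)
    (x := fun n x => (e n x).1) (isOpen_chartDom' hU p₀) (fun n i => he n p₀ (.inl (.inl i)))
  have hf : ∀ p₀ : M, _ := fun p₀ => rapid_fco_iff (b := bM) (Ψ := (extChartAt 𝓘(ℝ, EM) p₀).symm)
    (α := fun n x => (e n x).2.2.1) (isOpen_chartDom' hU p₀) (fun n i => he n p₀ (.inr (.inl i)))
  constructor
  · rintro ⟨h1, h2, h3, h4, h5⟩ p₀ ((i | i) | (i | i))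
    · exact (hv p₀).1 ⟨(hvec _).1 h1 p₀, (hvec _).1 h2 p₀⟩ i
    · exact (rapid_fun_iff _ U).1 h3 p₀
    · exact (hf p₀).1 ((hcov _).1 h4 p₀) i
    · exact (rapid_fun_iff _ U).1 h5 p₀
  · intro h
    refine ⟨(hvec _).2 fun p₀ => ((hv p₀).2 fun i => h p₀ (.inl (.inl i))).1,
      (hvec _).2 fun p₀ => ((hv p₀).2 fun i => h p₀ (.inl (.inl i))).2,
      (rapid_fun_iff _ U).2 fun p₀ => h p₀ (.inl (.inr ())),
      (hcov _).2 fun p₀ => (hf p₀).2 fun i => h p₀ (.inr (.inl i)),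
      (rapid_fun_iff _ U).2 fun p₀ => h p₀ (.inr (.inr ()))⟩

/-! ### Sections of tensor products with powers of the line bundle -/

section Tensor

variable {n : ℤ} {V : M → Type*} [∀ x, AddCommGroup (V x)] [∀ x, Module ℂ (V x)]

theorem coeff_eq (c : ∀ x, B.TensorL n V x) {σ : M → Z} {x : M} (h : B.proj (σ x) = x) :
    B.coeff c σ x = (c x).1 ⟨σ x, h⟩ := dif_pos h

/-- A local section passes through every point of `Z`, so the local coefficients see every value of
the equivariant function. -/
theorem tensor_ext {c d : ∀ x, B.TensorL n V x}
    (h : ∀ (σ : M → Z) (U : Set M), B.IsLocalSection σ U → ∀ x ∈ U, B.coeff c σ x = B.coeff d σ x) :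
    c = d := by
  funext x
  apply Subtype.ext
  funext ⟨p, hp⟩
  subst hp
  obtain ⟨σ, U, hσ, hx, hp⟩ := B.exists_localSection p
  have h1 := h σ U hσ _ hx
  have h2 : B.proj (σ (B.proj p)) = B.proj p := congrArg B.proj hp
  rw [coeff_eq c h2, coeff_eq d h2] at h1
  have h3 : (⟨σ (B.proj p), h2⟩ : {q : Z // B.proj q = B.proj p}) = ⟨p, rfl⟩ := Subtype.ext hp
  rwa [h3] at h1

theorem tensor_apply_exp (c : ∀ x, B.TensorL n V x) {σ : M → Z} {x : M} (h : B.proj (σ x) = x)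
    (t : ℝ) (h' : B.proj (Circle.exp t • σ x) = x) :
    (c x).1 ⟨Circle.exp t • σ x, h'⟩ = expI (-n) t • B.coeff c σ x := by
  rw [coeff_eq c h, ← coe_circle_exp_zpow]
  exact (c x).2 (Circle.exp t) ⟨σ x, h⟩

end Tensor

end PrincipalCircleBundle

section Transition

variable {ι : Type*} [Fintype ι]

theorem hasSum_toZ (l : ι → ℂ) {s : ℤ → (ι ⊕ Unit) ⊕ (ι ⊕ Unit) → ℂ}
    {c : (ι ⊕ Unit) ⊕ (ι ⊕ Unit) → ℂ} (h : ∀ k, HasSum (fun n => s n k) (c k))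
    (k : (ι ⊕ Unit) ⊕ (ι ⊕ Unit)) : HasSum (fun n => toZ l (s n) k) (toZ l c k) := by
  rcases k with (i | i) | (i | i)
  · exact h _
  · exact ((h _).mul_left _).sub (hasSum_sum fun i _ => (h _).mul_left _)
  · exact (h _).add ((h _).mul_left _)
  · exact (h _).mul_left _

end Transition

section Tsum

variable {V : Type*} [AddCommGroup V] [Module ℂ V] [Module.Finite ℂ V]

/-- The sum of a series in a finite dimensional space. -/
def tsumV (s : ℤ → V) : V :=
  ∑ k, (∑' n, (Module.finBasis ℂ V).coord k (s n)) • Module.finBasis ℂ V k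

/-- Summability against all functionals allows the infinite sum to be exchanged with the finite
basis expansion, so the sum does not depend on the basis. -/
theorem apply_tsumV {s : ℤ → V} (hs : ∀ ℓ : V →ₗ[ℂ] ℂ, Summable fun n => ℓ (s n))
    (ℓ : V →ₗ[ℂ] ℂ) : ℓ (tsumV s) = ∑' n, ℓ (s n) := by
  have h : ∀ v, ℓ v = ∑ k, (Module.finBasis ℂ V).coord k v * ℓ (Module.finBasis ℂ V k) := by
    intro v
    conv_lhs => rw [← (Module.finBasis ℂ V).sum_repr v, map_sum]
    simp
  simp only [tsumV, map_sum, map_smul, smul_eq_mul]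
  simp_rw [h (s _)]
  rw [Summable.tsum_finsetSum fun k _ => (hs _).mul_right _]
  exact Finset.sum_congr rfl fun k _ => (tsum_mul_right).symm

end Tsum

/-! ### The Fourier expansion maps. -/

namespace PrincipalCircleBundle

variable {EM M EZ Z : Type*}
  [NormedAddCommGroup EM] [NormedSpace ℝ EM] [FiniteDimensional ℝ EM]
  [TopologicalSpace M] [ChartedSpace EM M]
  [NormedAddCommGroup EZ] [NormedSpace ℝ EZ] [TopologicalSpace Z] [ChartedSpace EZ Z]
  [MulAction Circle Z] {B : PrincipalCircleBundle EM M EZ Z}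
  [IsManifold 𝓘(ℝ, EM) ∞ M] [IsManifold 𝓘(ℝ, EZ) ∞ Z] (A : Connection EZ Z)
  {σ : M → Z} {U : Set M} (hσ : B.IsLocalSection σ U) (p₀ : M)
  {ι : Type*} [Fintype ι] (bM : Module.Basis ι ℝ EM)

variable (B) in
theorem exists_tube_zero (p : Z) : ∃ (σ : M → Z) (U : Set M) (p₀ : M) (u : EM),
    B.IsLocalSection σ U ∧ u ∈ chartDom EM p₀ U ∧ tube EM σ p₀ (u, 0) = p ∧
      (extChartAt 𝓘(ℝ, EM) p₀).symm u = B.proj p := by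
  obtain ⟨σ, U, hσ, hx, hp⟩ := B.exists_localSection p
  have h1 := extChartAt_to_inv (I := 𝓘(ℝ, EM)) (B.proj p)
  exact ⟨σ, U, B.proj p, extChartAt 𝓘(ℝ, EM) (B.proj p) (B.proj p), hσ,
    ⟨mem_extChartAt_target _, by rw [mem_preimage, h1]; exact hx⟩, by simp [tube, hp], h1⟩

theorem GSection.smoothGAt (a : GSection EZ Z) (p : Z) : SmoothGAt a.1 p :=
  ⟨a.2.1.1.contMDiffAt univ_mem, a.2.1.2.contMDiffAt univ_mem, a.2.2.contMDiffAt univ_mem⟩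

/-- A section of the generalized tangent bundle smooth at all points. -/
def GSection.of (a : ∀ p : Z, GTan EZ p) (h : ∀ p, SmoothGAt a p) : GSection EZ Z :=
  ⟨a, ⟨fun p _ => (h p).re.contMDiffWithinAt, fun p _ => (h p).im.contMDiffWithinAt⟩,
    fun p _ => (h p).form.contMDiffWithinAt⟩

theorem circle_eq_exp (z : Circle) : ∃ t : ℝ, z = Circle.exp t := ⟨_, (Circle.exp_arg z).symm⟩

variable (B) in
/-- The `n`-th Fourier coefficient of a section of the generalized tangent bundle. -/
def coefE (n : ℤ) (a : Z → Cplx EZ × (EZ →L[ℝ] ℂ)) : ∀ x : M, B.TensorL n (EFib EM) x :=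
  fun x => ⟨fun p => (fcV n (fun t : ℝ => psiInv B A (Circle.exp t • p.1) (a (Circle.exp t • p.1))) :
      EF EM), by
    intro z p
    obtain ⟨s, rfl⟩ := circle_eq_exp z
    -- Moving the base point by `e^{is}` shifts the variable along the orbit, and the shift rule
    -- supplies the required factor `e^{-ins}`.
    have h1 := fcV_shift n (u := fun t : ℝ =>
      psiInv B A (Circle.exp t • p.1) (a (Circle.exp t • p.1)))
      (fun t => by simp [Circle.exp_add, Circle.exp_two_pi]) s
    simp only [Circle.exp_add, mul_smul] at h1
    rw [coe_circle_exp_zpow]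
    exact h1⟩

variable (B) in
/-- The `n`-th Fourier coefficient of a function. -/
def coefL (n : ℤ) (f : Z → ℂ) : ∀ x : M, B.TensorL n (fun _ : M => ℂ) x :=
  fun x => ⟨fun p => fc n (fun t : ℝ => f (Circle.exp t • p.1)), by
    intro z p
    obtain ⟨s, rfl⟩ := circle_eq_exp z
    have h1 := fc_shift n (g := fun t : ℝ => f (Circle.exp t • p.1))
      (fun t => by simp [Circle.exp_add, Circle.exp_two_pi]) s
    simp only [Circle.exp_add, mul_smul] at h1
    rw [coe_circle_exp_zpow]
    exact h1⟩

include hσ in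
theorem perSmooth_fun {f : Z → ℂ} (hf : ContMDiff 𝓘(ℝ, EZ) 𝓘(ℝ, ℂ) ∞ f) :
    PerSmooth (chartDom EM p₀ U) (fun y => f (tube EM σ p₀ y)) where
  smooth y hy := by
    have h1 := (hf _).comp y (contMDiffAt_tube hσ p₀ (y := y) hy.1)
    exact h1.contDiffAt.contDiffWithinAt
  per u hu t := congrArg f (tube_add_two_pi p₀ u t)

include hσ in
theorem wCont_psiInv {a : ∀ p : Z, GTan EZ p} (ha : ∀ p, SmoothGAt a p) {u : EM}
    (hu : u ∈ chartDom EM p₀ U) :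
    WCont fun t => psiInv B A (tube EM σ p₀ (u, t)) (a (tube EM σ p₀ (u, t))) := by
  have hinv := (isParam_base hσ p₀).isInvertible hu
  exact WCont.of_sum
    (fun k => ((perSmooth_ecoZ A hσ p₀ (Module.finBasis ℝ EM) ha k).smoothPer hu).continuous)
    (fun t => sum_eframe (bM := Module.finBasis ℝ EM) hinv _)

theorem wCont_psiInv_orbit {a : ∀ p : Z, GTan EZ p} (ha : ∀ p, SmoothGAt a p) (p : Z) :
    WCont fun t : ℝ => psiInv B A (Circle.exp t • p) (a (Circle.exp t • p)) := by
  obtain ⟨σ, U, p₀, u, hσ, hu, rfl, -⟩ := B.exists_tube_zero p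
  have h1 : (fun t => psiInv B A (tube EM σ p₀ (u, t)) (a (tube EM σ p₀ (u, t)))) = fun t : ℝ =>
      psiInv B A (Circle.exp t • tube EM σ p₀ (u, 0)) (a (Circle.exp t • tube EM σ p₀ (u, 0))) :=
    funext fun t => congrArg (fun q => psiInv B A q (a q)) (tube_eq_smul p₀ u t)
  exact h1 ▸ wCont_psiInv A hσ p₀ ha hu

variable (B) in
/-- The coefficient of a section of `E ⊗ L^{⊗n}`, with values in the model fibre. -/
def ecoeff {n : ℤ} (c : ∀ x, B.TensorL n (EFib EM) x) (σ : M → Z) (x : M) : EF EM :=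
  (B.coeff (V := EFib EM) c σ x : EFib EM x)

-- The bridge between the global definition by orbit averages and the parametric Fourier
-- coefficients. The component functional on the base does not involve `t`, so it passes through the
-- average.
include hσ in
theorem ecoM_coefE {a : ∀ p : Z, GTan EZ p} (ha : ∀ p, SmoothGAt a p) (n : ℤ) {u : EM}
    (hu : u ∈ chartDom EM p₀ U) (k : (ι ⊕ Unit) ⊕ (ι ⊕ Unit)) :
    ecoM bM p₀ (B.ecoeff (B.coefE A n a) σ) k u = fcp n (ecoZ A p₀ bM B σ a k) u := by
  have h := hσ.proj_eq _ hu.2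
  refine Eq.trans (congrArg (ecoL bM (extChartAt 𝓘(ℝ, EM) p₀).symm u k) (coeff_eq (V := EFib EM) (B.coefE A n a) h)) ?_
  exact apply_fcV n (wCont_psiInv A hσ p₀ ha hu) _

include hσ in
theorem coeff_coefL (f : Z → ℂ) (n : ℤ) {u : EM} (hu : u ∈ chartDom EM p₀ U) :
    B.coeff (B.coefL n f) σ ((extChartAt 𝓘(ℝ, EM) p₀).symm u) =
      fcp n (fun y => f (tube EM σ p₀ y)) u :=
  coeff_eq _ (hσ.proj_eq _ hu.2)

variable (B) in
/-- The Fourier expansion of sections of the generalized tangent bundle. -/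
def PhiE : GSection EZ Z →ₗ[ℂ] (∀ n : ℤ, B.ESection n) where
  toFun a n := ⟨B.coefE A n a.1, fun σ U hσ => by
    refine (smoothE_iff (Module.finBasis ℝ EM) hσ.isOpen _).2 fun p₀ k => ?_
    have h1 := (perSmooth_ecoZ A hσ p₀ (Module.finBasis ℝ EM) (GSection.smoothGAt a) k).contDiffOn_fcp
      (isOpen_chartDom hσ p₀) n
    exact h1.congr fun u hu => ecoM_coefE A hσ p₀ _ (GSection.smoothGAt a) n hu k⟩
  map_add' a a' := by
    funext n
    apply Subtype.ext
    funext x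
    apply Subtype.ext
    funext ⟨p, hp⟩
    have h1 := fcV_add n (wCont_psiInv_orbit (B := B) A (GSection.smoothGAt a) p)
      (wCont_psiInv_orbit (B := B) A (GSection.smoothGAt a') p)
    exact Eq.trans (congrArg (fcV (V := EF EM) n) (funext fun t => map_add _ _ _)) h1
  map_smul' c a := by
    funext n
    apply Subtype.ext
    funext x
    apply Subtype.ext
    funext ⟨p, hp⟩
    have h1 := fcV_smul n (wCont_psiInv_orbit (B := B) A (GSection.smoothGAt a) p) c
    exact Eq.trans (congrArg (fcV (V := EF EM) n) (funext fun t =>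
      (psiInv B A (Circle.exp t • p)).map_smul c (a.1 (Circle.exp t • p)))) h1

variable (B) in
/-- The Fourier expansion of functions. -/
def PhiL : SmoothFun EZ Z →ₗ[ℂ] (∀ n : ℤ, B.LSection n) where
  toFun f n := ⟨B.coefL n f.1, fun σ U hσ => by
    refine (contMDiffOn_iff_chartDom hσ.isOpen _).2 fun p₀ => ?_
    have h1 := (perSmooth_fun hσ p₀ f.2).contDiffOn_fcp (isOpen_chartDom hσ p₀) n
    exact h1.congr fun u hu => coeff_coefL hσ p₀ _ n hu⟩
  map_add' f f' := by
    funext n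
    apply Subtype.ext
    funext x
    apply Subtype.ext
    funext ⟨p, hp⟩
    have hc : ∀ f : SmoothFun EZ Z, Continuous fun t : ℝ => f.1 (Circle.exp t • p) := by
      intro f
      obtain ⟨σ, U, p₀, u, hσ, hu, rfl, -⟩ := B.exists_tube_zero p
      have h1 := ((perSmooth_fun hσ p₀ f.2).smoothPer hu).continuous
      exact h1.congr fun t => congrArg f.1 (tube_eq_smul p₀ u t)
    exact fc_add n (hc f) (hc f')
  map_smul' c f := by
    funext n
    apply Subtype.ext
    funext x
    apply Subtype.ext
    funext ⟨p, hp⟩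
    exact fc_const_mul n c _

include hσ in
theorem coeff_PhiL (f : SmoothFun EZ Z) (n : ℤ) {u : EM} (hu : u ∈ chartDom EM p₀ U) :
    B.coeff (B.PhiL f n).1 σ ((extChartAt 𝓘(ℝ, EM) p₀).symm u) =
      fcp n (fun y => f.1 (tube EM σ p₀ y)) u :=
  coeff_coefL hσ p₀ f.1 n hu

include hσ in
theorem ecoM_PhiE (a : GSection EZ Z) (n : ℤ) {u : EM}
    (hu : u ∈ chartDom EM p₀ U) (k : (ι ⊕ Unit) ⊕ (ι ⊕ Unit)) :
    ecoM bM p₀ (B.ecoeff (B.PhiE A a n).1 σ) k u = fcp n (ecoZ A p₀ bM B σ a.1 k) u :=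
  ecoM_coefE A hσ p₀ bM (GSection.smoothGAt a) n hu k

include hσ in
theorem contDiffOn_ecoM {n : ℤ} (c : B.ESection n) (k : (ι ⊕ Unit) ⊕ (ι ⊕ Unit)) :
    ContDiffOn ℝ ∞ (ecoM bM p₀ (B.ecoeff c.1 σ) k) (chartDom EM p₀ U) :=
  (smoothE_iff bM hσ.isOpen _).1 (c.2 σ U hσ) p₀ k

include hσ in
theorem contDiffOn_coeffL {n : ℤ} (c : B.LSection n) :
    ContDiffOn ℝ ∞ (fun u => B.coeff c.1 σ ((extChartAt 𝓘(ℝ, EM) p₀).symm u)) (chartDom EM p₀ U) :=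
  (contMDiffOn_iff_chartDom hσ.isOpen _).1 (c.2 σ U hσ) p₀

theorem RapidE_iff (c : ∀ n : ℤ, B.ESection n) : B.RapidE c ↔
    ∀ (σ : M → Z) (U : Set M), B.IsLocalSection σ U → ∀ (p₀ : M) k,
      Rapid (chartDom EM p₀ U) (fun n => ecoM bM p₀ (B.ecoeff (c n).1 σ) k) :=
  forall₃_congr fun _ _ hσ => rapidE_iff bM hσ.isOpen _ fun n p₀ k =>
    contDiffOn_ecoM hσ p₀ bM (c n) k

theorem rapidE_PhiE (a : GSection EZ Z) : B.RapidE (B.PhiE A a) := by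
  refine (RapidE_iff (Module.finBasis ℝ EM) _).2 fun σ U hσ p₀ k => ?_
  have h1 := (perSmooth_ecoZ A hσ p₀ (Module.finBasis ℝ EM) (GSection.smoothGAt a) k).rapid_fcp
      (isOpen_chartDom hσ p₀)
  exact h1.congr (isOpen_chartDom hσ p₀) fun n u hu => ecoM_PhiE A hσ p₀ _ a n hu k

theorem rapidL_PhiL (f : SmoothFun EZ Z) : B.RapidL (B.PhiL f) := by
  intro σ U hσ
  refine (rapid_fun_iff _ U).2 fun p₀ => ?_
  have h1 := (perSmooth_fun hσ p₀ f.2).rapid_fcp (isOpen_chartDom hσ p₀)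
  exact h1.congr (isOpen_chartDom hσ p₀) fun n u hu => coeff_PhiL hσ p₀ f n hu

end PrincipalCircleBundle

/-- Separation gives uniqueness of sums in the generalized tangent spaces, on which injectivity and
the uniqueness of the exotic bracket depend. -/
instance (V : Type*) [TopologicalSpace V] [T2Space V] : T2Space (Cplx V) :=
  inferInstanceAs (T2Space (V × V))

/-! ### Convergence and bijectivity of the Fourier expansion. -/

namespace PrincipalCircleBundle

variable {EM M EZ Z : Type*}
  [NormedAddCommGroup EM] [NormedSpace ℝ EM] [FiniteDimensional ℝ EM]
  [TopologicalSpace M] [ChartedSpace EM M]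
  [NormedAddCommGroup EZ] [NormedSpace ℝ EZ] [TopologicalSpace Z] [ChartedSpace EZ Z]
  [MulAction Circle Z] {B : PrincipalCircleBundle EM M EZ Z}
  [IsManifold 𝓘(ℝ, EM) ∞ M] [IsManifold 𝓘(ℝ, EZ) ∞ Z] (A : Connection EZ Z)
  {σ : M → Z} {U : Set M} (hσ : B.IsLocalSection σ U) (p₀ : M)
  {ι : Type*} [Fintype ι] (bM : Module.Basis ι ℝ EM)

/-- The value of a section of `E ⊗ L^{⊗n}` at a point of `Z`, in the model fibre. -/
def val {n : ℤ} (c : ∀ x, B.TensorL n (EFib EM) x) (p : Z) : EF EM :=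
  ((c (B.proj p)).1 ⟨p, rfl⟩ : EFib EM (B.proj p))

theorem apply_eq_val {n : ℤ} (c : ∀ x, B.TensorL n (EFib EM) x) (p : Z) {x : M}
    (h : B.proj p = x) : ((c x).1 ⟨p, h⟩ : EF EM) = val c p := by
  subst h; rfl

include hσ in
theorem val_tube {n : ℤ} (c : ∀ x, B.TensorL n (EFib EM) x) {u : EM}
    (hu : u ∈ chartDom EM p₀ U) (t : ℝ) :
    val c (tube EM σ p₀ (u, t)) =
      expI (-n) t • B.ecoeff c σ ((extChartAt 𝓘(ℝ, EM) p₀).symm u) :=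
  (apply_eq_val c _ (proj_tube hσ p₀ (y := (u, t)) hu)).symm.trans
    (tensor_apply_exp (V := EFib EM) c (hσ.proj_eq _ hu.2) t _)

theorem apply_eq_proj {n : ℤ} (c : ∀ x, B.TensorL n (fun _ : M => ℂ) x) (p : Z) {x : M}
    (h : B.proj p = x) : (c x).1 ⟨p, h⟩ = (c (B.proj p)).1 ⟨p, rfl⟩ := by
  subst h; rfl

include hσ in
theorem apply_tube {n : ℤ} (c : ∀ x, B.TensorL n (fun _ : M => ℂ) x) {u : EM}
    (hu : u ∈ chartDom EM p₀ U) (t : ℝ) :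
    (c (B.proj (tube EM σ p₀ (u, t)))).1 ⟨tube EM σ p₀ (u, t), rfl⟩ =
      expI (-n) t * B.coeff c σ ((extChartAt 𝓘(ℝ, EM) p₀).symm u) :=
  (apply_eq_proj c _ (proj_tube hσ p₀ (y := (u, t)) hu)).symm.trans
    (tensor_apply_exp c (hσ.proj_eq _ hu.2) t _)

include hσ in
theorem gcoL_mpsi_val {n : ℤ} (c : ∀ x, B.TensorL n (EFib EM) x) {u : EM}
    (hu : u ∈ chartDom EM p₀ U) (t : ℝ) (k : (ι ⊕ Unit) ⊕ (ι ⊕ Unit)) :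
    gcoL (tubeBasis bM) (tube EM σ p₀) (u, t) k
        (mpsi B A (tube EM σ p₀ (u, t)) (val c (tube EM σ p₀ (u, t)))) =
      toZ (fun i => lform A p₀ bM σ i u)
        (fun k => expI (-n) t * ecoM bM p₀ (B.ecoeff c σ) k u) k := by
  rw [gcoL_mpsi A hσ p₀ bM hu, val_tube hσ p₀ c hu]
  simp only [map_smul, smul_eq_mul]
  rfl

/-- With a local section through `p`, the point has fibre coordinate `t = 0`; the statement is
pointwise convergence of the scalar Fourier series there, carried through the change of frame. -/
theorem hasSum_PhiE (a : GSection EZ Z) (p : Z) :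
    HasSum (fun n : ℤ => mpsi B A p (val (B.PhiE A a n).1 p)) (a.1 p : Cplx EZ × (EZ →L[ℝ] ℂ)) := by
  obtain ⟨σ, U, p₀, u, hσ, hu, rfl, -⟩ := B.exists_tube_zero p
  let bM := Module.finBasis ℝ EM
  refine (hasSum_iff_gcoL (b := tubeBasis bM) (tube_inv hσ p₀ hu 0)).2 fun k => ?_
  have h1 : ∀ k, HasSum (fun n : ℤ => expI (-n) 0 * ecoM bM p₀ (B.ecoeff (B.PhiE A a n).1 σ) k u)
      (ecoZ A p₀ bM B σ a.1 k (u, 0)) := by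
    intro k
    have := ((perSmooth_ecoZ A hσ p₀ bM (GSection.smoothGAt a) k).smoothPer hu).hasSum 0
    refine this.congr_fun fun n => ?_
    rw [ecoM_PhiE A hσ p₀ bM a n hu k, mul_comm]
    rfl
  have h2 := hasSum_toZ (fun i => lform A p₀ bM σ i u) h1 k
  have h3 := gco_eq A hσ p₀ bM a.1 k (y := (u, 0)) hu
  refine (h3.symm ▸ h2).congr_fun fun n => ?_
  exact gcoL_mpsi_val A hσ p₀ bM (B.PhiE A a n).1 hu 0 k

theorem PhiE_injective : Function.Injective (B.PhiE A) := by
  intro a a' h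
  apply Subtype.ext
  funext p
  have h1 := hasSum_PhiE (B := B) A a p
  rw [h] at h1
  exact h1.unique (hasSum_PhiE A a' p)

include bM in
theorem ecoeff_ext {n : ℤ} {c d : ∀ x, B.TensorL n (EFib EM) x}
    (h : ∀ (σ : M → Z) (U : Set M), B.IsLocalSection σ U → ∀ p₀ k, ∀ u ∈ chartDom EM p₀ U,
      ecoM bM p₀ (B.ecoeff c σ) k u = ecoM bM p₀ (B.ecoeff d σ) k u) : c = d := by
  refine tensor_ext fun σ U hσ => ?_
  refine (forall_chartDom_iff EM U _).2 fun p₀ u hu => ?_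
  exact eco_ext (bM := bM) ((isParam_base hσ p₀).isInvertible hu) fun k => h σ U hσ p₀ k u hu

/-- The sum of a family of sections. -/
def sumE (c : ∀ n : ℤ, B.ESection n) (p : Z) : Cplx EZ × (EZ →L[ℝ] ℂ) :=
  mpsi B A p (tsumV fun n => val (c n).1 p)

include hσ in
theorem ecoZ_sumE {c : ∀ n : ℤ, B.ESection n} (hc : B.RapidE c) {y : EM × ℝ}
    (hy : y.1 ∈ chartDom EM p₀ U) (k : (ι ⊕ Unit) ⊕ (ι ⊕ Unit)) :
    ecoZ A p₀ bM B σ (sumE A c) k y = fseries (fun n => ecoM bM p₀ (B.ecoeff (c n).1 σ) k) y := by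
  obtain ⟨u, t⟩ := y
  have hR := (RapidE_iff bM c).1 hc σ U hσ p₀
  have hv : ∀ n k, ecoL bM (extChartAt 𝓘(ℝ, EM) p₀).symm u k (val (c n).1 (tube EM σ p₀ (u, t)))
      = ecoM bM p₀ (B.ecoeff (c n).1 σ) k u * expI (-n) t := by
    intro n k
    rw [val_tube hσ p₀ _ hy, map_smul, smul_eq_mul, mul_comm]
    rfl
  rw [ecoZ, sumE, psiInv_mpsi, apply_tsumV]
  · exact tsum_congr fun n => hv n k
  -- Any functional is a finite combination of the components `ecoL` in the frame `eframe`, so its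
  -- summability follows from rapid decrease of the components.
  · intro ℓ
    have h1 : ∀ n, ℓ (val (c n).1 (tube EM σ p₀ (u, t))) = ∑ k,
        (ecoM bM p₀ (B.ecoeff (c n).1 σ) k u * expI (-n) t)
          * ℓ (eframe bM (extChartAt 𝓘(ℝ, EM) p₀).symm u k) := by
      intro n
      conv_lhs => rw [sum_eframe (bM := bM) ((isParam_base hσ p₀).isInvertible hy)
        (val (c n).1 (tube EM σ p₀ (u, t)))]
      simp only [map_sum, map_smul, hv, smul_eq_mul]
    simp only [h1]
    exact summable_sum fun k _ => ((hR k).hasSum_fseries (y := (u, t)) hy).summable.mul_right _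

/-- The candidate is the pointwise sum. In tube coordinates it is a series with rapidly decreasing
coefficients, hence smooth, and its Fourier coefficients are the given ones. -/
theorem exists_PhiE_eq {c : ∀ n : ℤ, B.ESection n} (hc : B.RapidE c) :
    ∃ a : GSection EZ Z, B.PhiE A a = c := by
  let bM := Module.finBasis ℝ EM
  have hs : ∀ p : Z, SmoothGAt (sumE A c) p := by
    intro p
    obtain ⟨σ, U, p₀, u, hσ, hu, rfl, -⟩ := B.exists_tube_zero p
    refine smoothGAt_of_ecoZ A hσ p₀ bM (fun k => ?_) hu
    have h1 := ((RapidE_iff bM c).1 hc σ U hσ p₀ k).contDiffOn_fseries (isOpen_chartDom hσ p₀)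
      (fun n => contDiffOn_ecoM hσ p₀ bM (c n) k)
    exact h1.congr fun y hy => ecoZ_sumE A hσ p₀ bM hc hy.1 k
  refine ⟨GSection.of _ hs, ?_⟩
  funext n
  apply Subtype.ext
  refine ecoeff_ext bM fun σ U hσ p₀ k u hu => ?_
  rw [ecoM_PhiE A hσ p₀ bM _ n hu k]
  have h1 := ((RapidE_iff bM c).1 hc σ U hσ p₀ k).fcp_fseries hu n
  rw [← h1]
  exact congrArg (fc n) (funext fun t => ecoZ_sumE A hσ p₀ bM hc (y := (u, t)) hu k)

theorem range_PhiE : Set.range (B.PhiE A) = {c | B.RapidE c} := by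
  ext c
  constructor
  · rintro ⟨a, rfl⟩
    exact rapidE_PhiE A a
  · exact exists_PhiE_eq A

theorem hasSum_PhiL (f : SmoothFun EZ Z) (p : Z) :
    HasSum (fun n : ℤ => ((B.PhiL f n).1 (B.proj p)).1 ⟨p, rfl⟩) (f.1 p) := by
  obtain ⟨σ, U, p₀, u, hσ, hu, rfl, -⟩ := B.exists_tube_zero p
  have h1 := ((perSmooth_fun hσ p₀ f.2).smoothPer hu).hasSum 0
  refine h1.congr_fun fun n => ?_
  rw [apply_tube hσ p₀ _ hu, coeff_PhiL hσ p₀ f n hu, mul_comm]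
  rfl

theorem PhiL_injective : Function.Injective (B.PhiL) := by
  intro f f' h
  apply Subtype.ext
  funext p
  have h1 := hasSum_PhiL (B := B) f p
  rw [h] at h1
  exact h1.unique (hasSum_PhiL f' p)

/-- The sum of a family of sections of the powers of the line bundle. -/
def sumL (c : ∀ n : ℤ, B.LSection n) (p : Z) : ℂ := ∑' n, ((c n).1 (B.proj p)).1 ⟨p, rfl⟩

include hσ in
theorem sumL_tube (c : ∀ n : ℤ, B.LSection n) {y : EM × ℝ} (hy : y.1 ∈ chartDom EM p₀ U) :
    sumL c (tube EM σ p₀ y) =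
      fseries (fun n u => B.coeff (c n).1 σ ((extChartAt 𝓘(ℝ, EM) p₀).symm u)) y := by
  obtain ⟨u, t⟩ := y
  exact tsum_congr fun n => (apply_tube hσ p₀ (c n).1 hy t).trans (mul_comm _ _)

theorem exists_PhiL_eq {c : ∀ n : ℤ, B.LSection n} (hc : B.RapidL c) :
    ∃ f : SmoothFun EZ Z, B.PhiL f = c := by
  have hR : ∀ (σ : M → Z) (U : Set M), B.IsLocalSection σ U → ∀ p₀ : M, Rapid (chartDom EM p₀ U)
      (fun n u => B.coeff (c n).1 σ ((extChartAt 𝓘(ℝ, EM) p₀).symm u)) := fun σ U hσ =>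
    (rapid_fun_iff _ U).1 (hc σ U hσ)
  have hs : ContMDiff 𝓘(ℝ, EZ) 𝓘(ℝ, ℂ) ∞ (sumL c) := by
    intro p
    obtain ⟨σ, U, p₀, u, hσ, hu, rfl, -⟩ := B.exists_tube_zero p
    refine ((isParam_tube hσ p₀).contMDiffAt_iff (y := (u, 0)) ⟨hu, mem_univ _⟩).2 ?_
    have h1 := (hR σ U hσ p₀).contDiffOn_fseries (isOpen_chartDom hσ p₀)
      (fun n => contDiffOn_coeffL hσ p₀ (c n))
    exact (h1.congr fun y hy => sumL_tube hσ p₀ c hy.1).contDiffAt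
      (((isOpen_chartDom hσ p₀).prod isOpen_univ).mem_nhds ⟨hu, mem_univ _⟩)
  refine ⟨⟨_, hs⟩, ?_⟩
  funext n
  apply Subtype.ext
  refine tensor_ext fun σ U hσ => ?_
  refine (forall_chartDom_iff EM U _).2 fun p₀ u hu => ?_
  rw [coeff_PhiL hσ p₀ _ n hu, ← (hR σ U hσ p₀).fcp_fseries hu n]
  exact congrArg (fc n) (funext fun t => sumL_tube hσ p₀ c (y := (u, t)) hu)

theorem range_PhiL : Set.range (B.PhiL) = {c | B.RapidL c} := by
  ext c
  constructor
  · rintro ⟨a, rfl⟩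
    exact rapidL_PhiL a
  · exact exists_PhiL_eq

end PrincipalCircleBundle

/-! ### Convolution of Fourier coefficients -/

/-- `f` is continuous and its `m`-th Fourier coefficient is the sum of the series `s`. -/
structure FcSum (m : ℤ) (s : ℤ → ℂ) (f : ℝ → ℂ) : Prop where
  cont : Continuous f
  sum : HasSum s (fc m f)

namespace FcSum

variable {m : ℤ} {s s' : ℤ → ℂ} {f f' : ℝ → ℂ}

theorem congr (h : FcSum m s f) (hs : ∀ n, s' n = s n) (hf : ∀ t, f' t = f t) : FcSum m s' f' := by
  rw [show s' = s from funext hs, show f' = f from funext hf]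
  exact h

theorem add (h : FcSum m s f) (h' : FcSum m s' f') :
    FcSum m (fun n => s n + s' n) (fun t => f t + f' t) :=
  ⟨h.cont.add h'.cont, by rw [fc_add m h.cont h'.cont]; exact h.sum.add h'.sum⟩

theorem const_mul (h : FcSum m s f) (c : ℂ) : FcSum m (fun n => c * s n) (fun t => c * f t) :=
  ⟨continuous_const.mul h.cont, by rw [fc_const_mul]; exact h.sum.mul_left c⟩

theorem sub (h : FcSum m s f) (h' : FcSum m s' f') :
    FcSum m (fun n => s n - s' n) (fun t => f t - f' t) :=
  (h.add (h'.const_mul (-1))).congr (fun _ => by ring) (fun _ => by ring)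

theorem finsetSum {ι : Type*} (J : Finset ι) {s : ι → ℤ → ℂ} {f : ι → ℝ → ℂ}
    (h : ∀ i, FcSum m (s i) (f i)) : FcSum m (fun n => ∑ i ∈ J, s i n) (fun t => ∑ i ∈ J, f i t) :=
  ⟨continuous_finsetSum _ fun i _ => (h i).cont, by
    rw [fc_sum m J fun i => (h i).cont]; exact hasSum_sum fun i _ => (h i).sum⟩

theorem mul (m : ℤ) (hf : SmoothPer f) (hg : SmoothPer f') :
    FcSum m (fun n => fc n f * fc (m - n) f') (fun t => f t * f' t) :=
  ⟨hf.continuous.mul hg.continuous, hf.hasSum_fc_mul hg.continuous m⟩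

theorem mul' (m : ℤ) (hf : SmoothPer f) (hg : SmoothPer f') :
    FcSum m (fun n => fc (m - n) f' * fc n f) (fun t => f' t * f t) :=
  (mul m hf hg).congr (fun _ => mul_comm _ _) (fun _ => mul_comm _ _)

end FcSum

/-! ### The bracket as a convolution. -/

section Bracket

variable {κ : Type*} [Fintype κ]

/-- The bracket in terms of components and their derivatives. -/
def brk (h : κ → κ → κ → ℂ) (x : κ ⊕ κ → ℂ) (dx : κ → κ ⊕ κ → ℂ) (z : κ ⊕ κ → ℂ)
    (dz : κ → κ ⊕ κ → ℂ) : κ ⊕ κ → ℂ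
  | .inl j => bracketVec (fun i => x (.inl i)) (fun i k => dx i (.inl k)) (fun i => z (.inl i))
      (fun i k => dz i (.inl k)) j
  | .inr j => bracketForm h (fun i => x (.inl i)) (fun i k => dx i (.inl k))
      (fun i k => dx i (.inr k)) (fun i => z (.inl i)) (fun i => z (.inr i))
      (fun i k => dz i (.inr k)) j

/-- Every monomial of `brk` has one factor from `(x, dx)`, one from `(z, dz)`, and a coefficient `h`
constant in `t`. The convolution theorem therefore applies to each monomial separately. -/
theorem fcSum_brk (h : κ → κ → κ → ℂ) {x z : κ ⊕ κ → ℝ → ℂ} {dx dz : κ → κ ⊕ κ → ℝ → ℂ}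
    (hx : ∀ k, SmoothPer (x k)) (hdx : ∀ i k, SmoothPer (dx i k)) (hz : ∀ k, SmoothPer (z k))
    (hdz : ∀ i k, SmoothPer (dz i k)) (m : ℤ) (k : κ ⊕ κ) :
    FcSum m (fun n => brk h (fun k => fc n (x k)) (fun i k => fc n (dx i k))
        (fun k => fc (m - n) (z k)) (fun i k => fc (m - n) (dz i k)) k)
      (fun t => brk h (fun k => x k t) (fun i k => dx i k t) (fun k => z k t)
        (fun i k => dz i k t) k) := by
  rcases k with j | j
  · exact FcSum.finsetSum _ fun i => (FcSum.mul m (hx _) (hdz _ _)).sub (FcSum.mul' m (hdx _ _) (hz _))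
  · refine FcSum.add (FcSum.finsetSum _ fun i => ?_)
      (FcSum.finsetSum _ fun i => FcSum.finsetSum _ fun k => ?_)
    · refine FcSum.sub ((FcSum.mul m (hx _) (hdz _ _)).add (FcSum.mul' m (hdx _ _) (hz _))) ?_
      exact ((FcSum.mul' m (hdx _ _) (hz _)).sub (FcSum.mul' m (hdx _ _) (hz _))).congr
        (fun _ => mul_sub _ _ _) (fun _ => mul_sub _ _ _)
    · exact ((FcSum.mul' m (hx _) (hz _)).const_mul (h i k j)).congr
        (fun _ => mul_comm _ _) (fun _ => mul_comm _ _)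

theorem contDiffAt_brk {D : Type*} [NormedAddCommGroup D] [NormedSpace ℝ D] {y : D}
    {h : D → κ → κ → κ → ℂ} {x z : κ ⊕ κ → D → ℂ} {dx dz : κ → κ ⊕ κ → D → ℂ}
    (hh : ∀ i j k, ContDiffAt ℝ ∞ (fun y => h y i j k) y)
    (hx : ∀ k, ContDiffAt ℝ ∞ (x k) y) (hdx : ∀ i k, ContDiffAt ℝ ∞ (dx i k) y)
    (hz : ∀ k, ContDiffAt ℝ ∞ (z k) y) (hdz : ∀ i k, ContDiffAt ℝ ∞ (dz i k) y) (k : κ ⊕ κ) :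
    ContDiffAt ℝ ∞ (fun y => brk (h y) (fun k => x k y) (fun i k => dx i k y) (fun k => z k y)
      (fun i k => dz i k y) k) y := by
  rcases k with j | j
  · exact ContDiffAt.sum fun i _ => ((hx _).mul (hdz _ _)).sub ((hz _).mul (hdx _ _))
  · refine ContDiffAt.add (ContDiffAt.sum fun i _ => ?_)
      (ContDiffAt.sum fun i _ => ContDiffAt.sum fun k _ => ?_)
    · exact (((hx _).mul (hdz _ _)).add ((hz _).mul (hdx _ _))).sub
        ((hz _).mul ((hdx _ _).sub (hdx _ _)))
    · exact ((hz _).mul (hx _)).mul (hh _ _ _)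

variable {E : Type*} [NormedAddCommGroup E] [NormedSpace ℝ E] [CompleteSpace E]
  {N : Type*} [TopologicalSpace N] [ChartedSpace E N] [IsManifold 𝓘(ℝ, E) ∞ N]
  {D : Type*} [NormedAddCommGroup D] [NormedSpace ℝ D] [FiniteDimensional ℝ D]
  {b : Module.Basis κ ℝ D} {Ψ : D → N} {y : D} {Ω : Set D}

theorem IsParam.gco_derivedBracket (h : IsParam E Ψ Ω) (hy : y ∈ Ω)
    (H : ∀ p : N, TangentSpace 𝓘(ℝ, E) p [⋀^Fin 3]→L[ℝ] ℝ)
    (τ : ∀ p : N, TangentSpace 𝓘(ℝ, E) p →L[ℝ] ℂ) (n m : ℤ) {a c : ∀ p : N, GTan E p}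
    (ha : SmoothGAt a (Ψ y)) (hc : SmoothGAt c (Ψ y)) (k : κ ⊕ κ) :
    gco (E := E) b Ψ (derivedBracket H τ n m a c) k y =
      brk (hco (E := E) b Ψ H y) (fun k => gco (E := E) b Ψ a k y)
        (fun i k => fderiv ℝ (gco (E := E) b Ψ a k) y (b i)
          + n * fco (E := E) b Ψ τ i y * gco (E := E) b Ψ a k y)
        (fun k => gco (E := E) b Ψ c k y)
        (fun i k => fderiv ℝ (gco (E := E) b Ψ c k) y (b i)
          + m * fco (E := E) b Ψ τ i y * gco (E := E) b Ψ c k y) k := by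
  rcases k with j | j
  · exact h.derivedBracket_vec hy H τ n m ha hc j
  · exact h.derivedBracket_form hy H τ n m ha hc j

theorem IsParam.gco_dorfman (h : IsParam E Ψ Ω) (hy : y ∈ Ω)
    (H : ∀ p : N, TangentSpace 𝓘(ℝ, E) p [⋀^Fin 3]→L[ℝ] ℝ) {a c : ∀ p : N, GTan E p}
    (ha : SmoothGAt a (Ψ y)) (hc : SmoothGAt c (Ψ y)) (k : κ ⊕ κ) :
    gco (E := E) b Ψ (dorfman H a c) k y =
      brk (hco (E := E) b Ψ H y) (fun k => gco (E := E) b Ψ a k y)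
        (fun i k => fderiv ℝ (gco (E := E) b Ψ a k) y (b i))
        (fun k => gco (E := E) b Ψ c k y)
        (fun i k => fderiv ℝ (gco (E := E) b Ψ c k) y (b i)) k := by
  have h1 := h.gco_derivedBracket (b := b) hy H (fun _ => 0) 0 0 ha hc k
  simp only [Int.cast_zero, zero_mul, add_zero] at h1
  rw [← h1]
  exact congrArg (gcoL (E := E) b Ψ y k) (derivedBracket_zero H a c (Ψ y)).symm

end Bracket

/-! ### Invariant parts and their covariant derivatives. -/

namespace PrincipalCircleBundle

variable {EM M EZ Z : Type*}
  [NormedAddCommGroup EM] [NormedSpace ℝ EM] [FiniteDimensional ℝ EM]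
  [TopologicalSpace M] [ChartedSpace EM M]
  [NormedAddCommGroup EZ] [NormedSpace ℝ EZ] [TopologicalSpace Z] [ChartedSpace EZ Z]
  [MulAction Circle Z] {B : PrincipalCircleBundle EM M EZ Z}
  [IsManifold 𝓘(ℝ, EM) ∞ M] [IsManifold 𝓘(ℝ, EZ) ∞ Z] (A : Connection EZ Z)
  {σ : M → Z} {U : Set M} (hσ : B.IsLocalSection σ U) (p₀ : M)
  {ι : Type*} [Fintype ι] (bM : Module.Basis ι ℝ EM)

/-- The invariant section over `Z` given by a Fourier coefficient in the frame of a local section. -/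
def invariantPart (B : PrincipalCircleBundle EM M EZ Z) (σ : M → Z) (n : ℤ)
    (a : Z → Cplx EZ × (EZ →L[ℝ] ℂ)) (q : Z) : Cplx EZ × (EZ →L[ℝ] ℂ) :=
  mpsi B A q (B.ecoeff (B.coefE A n a) σ (B.proj q))

-- Passing through `ψ` costs nothing: the change of frame is independent of `t` and commutes with
-- `fc`. In particular the components of the invariant part do not depend on `t`.
include hσ in
theorem gco_invariantPart {a : ∀ p : Z, GTan EZ p} (ha : ∀ p, SmoothGAt a p) (n : ℤ) {y : EM × ℝ}
    (hy : y.1 ∈ chartDom EM p₀ U) (k : (ι ⊕ Unit) ⊕ (ι ⊕ Unit)) :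
    gco (E := EZ) (tubeBasis bM) (tube EM σ p₀) (invariantPart A B σ n a) k y =
      fcp n (gco (E := EZ) (tubeBasis bM) (tube EM σ p₀) a k) y.1 := by
  obtain ⟨u, t⟩ := y
  have h1 : invariantPart A B σ n a (tube EM σ p₀ (u, t)) = mpsi B A (tube EM σ p₀ (u, t))
      (B.ecoeff (B.coefE A n a) σ ((extChartAt 𝓘(ℝ, EM) p₀).symm u)) :=
    congrArg (fun x => mpsi B A (tube EM σ p₀ (u, t)) (B.ecoeff (B.coefE A n a) σ x))
      (proj_tube hσ p₀ (y := (u, t)) hy)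
  rw [gco, h1, gcoL_mpsi A hσ p₀ bM hy]
  have h2 : (fun k => ecoL bM (extChartAt 𝓘(ℝ, EM) p₀).symm u k
      (B.ecoeff (B.coefE A n a) σ ((extChartAt 𝓘(ℝ, EM) p₀).symm u))) =
      fun k => fc n (fun t => ecoZ A p₀ bM B σ a k (u, t)) :=
    funext fun k => ecoM_coefE A hσ p₀ bM ha n hy k
  rw [h2, ← fc_toZ n _ fun k => ((perSmooth_ecoZ A hσ p₀ bM ha k).smoothPer hy).continuous]
  exact congrArg (fc n) (funext fun t => (gco_eq A hσ p₀ bM a k (y := (u, t)) hy).symm)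

include hσ in
theorem eventuallyEq_gco_invariantPart {a : ∀ p : Z, GTan EZ p} (ha : ∀ p, SmoothGAt a p) (n : ℤ)
    {y : EM × ℝ} (hy : y.1 ∈ chartDom EM p₀ U) (k : (ι ⊕ Unit) ⊕ (ι ⊕ Unit)) :
    gco (E := EZ) (tubeBasis bM) (tube EM σ p₀) (invariantPart A B σ n a) k =ᶠ[𝓝 y]
      fun y => fcp n (gco (E := EZ) (tubeBasis bM) (tube EM σ p₀) a k) y.1 := by
  filter_upwards [((isOpen_chartDom hσ p₀).preimage continuous_fst).mem_nhds hy] with y' hy'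
  exact gco_invariantPart A hσ p₀ bM ha n hy' k

include hσ in
theorem contDiffAt_fcp_gco {a : ∀ p : Z, GTan EZ p} (ha : ∀ p, SmoothGAt a p) (n : ℤ)
    {u : EM} (hu : u ∈ chartDom EM p₀ U) (k : (ι ⊕ Unit) ⊕ (ι ⊕ Unit)) :
    ContDiffAt ℝ ∞ (fcp n (gco (E := EZ) (tubeBasis bM) (tube EM σ p₀) a k)) u :=
  ((perSmooth_gco hσ p₀ bM ha k).contDiffOn_fcp (isOpen_chartDom hσ p₀) n).contDiffAt
    ((isOpen_chartDom hσ p₀).mem_nhds hu)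

include hσ in
theorem smoothGAt_invariantPart {a : ∀ p : Z, GTan EZ p} (ha : ∀ p, SmoothGAt a p) (n : ℤ)
    {y : EM × ℝ} (hy : y.1 ∈ chartDom EM p₀ U) :
    SmoothGAt (E := EZ) (invariantPart A B σ n a) (tube EM σ p₀ y) := by
  refine ((isParam_tube hσ p₀).smoothGAt_iff (b := tubeBasis (Module.finBasis ℝ EM))
    ⟨hy, mem_univ _⟩ _).2 fun k => ?_
  refine ContDiffAt.congr_of_eventuallyEq ?_ (eventuallyEq_gco_invariantPart A hσ p₀ _ ha n hy k)
  exact (contDiffAt_fcp_gco hσ p₀ _ ha n hy k).comp y contDiffAt_fst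

include hσ in
theorem fco_tau {y : EM × ℝ} (hy : y.1 ∈ chartDom EM p₀ U) (i : ι ⊕ Unit) :
    fco (E := EZ) (tubeBasis bM) (tube EM σ p₀) (B.tau A σ) i y =
      -(Complex.I * (tubeBasis bM i).2) :=
  tau_dM_tube hσ p₀ A (u := y.1) hy y.2 (tubeBasis bM i).1 (tubeBasis bM i).2

-- The central identity for the bracket: covariant derivatives of the invariant part are Fourier
-- coefficients of ordinary derivatives, because `n τ_σ` restores the derivative of the suppressed
-- factor `e^{-int}`.
include hσ in
theorem covariant_invariantPart {a : ∀ p : Z, GTan EZ p} (ha : ∀ p, SmoothGAt a p) (n : ℤ)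
    {y : EM × ℝ} (hy : y.1 ∈ chartDom EM p₀ U) (i : ι ⊕ Unit) (k : (ι ⊕ Unit) ⊕ (ι ⊕ Unit)) :
    fderiv ℝ (gco (E := EZ) (tubeBasis bM) (tube EM σ p₀) (invariantPart A B σ n a) k) y
          (tubeBasis bM i)
        + n * fco (E := EZ) (tubeBasis bM) (tube EM σ p₀) (B.tau A σ) i y
          * gco (E := EZ) (tubeBasis bM) (tube EM σ p₀) (invariantPart A B σ n a) k y =
      fcp n (fun y => fderiv ℝ (gco (E := EZ) (tubeBasis bM) (tube EM σ p₀) a k) y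
        (tubeBasis bM i)) y.1 := by
  have hP := perSmooth_gco hσ p₀ bM ha k
  have hd : ∀ v : EM × ℝ, fderiv ℝ (gco (E := EZ) (tubeBasis bM) (tube EM σ p₀)
      (invariantPart A B σ n a) k) y v
      = fderiv ℝ (fcp n (gco (E := EZ) (tubeBasis bM) (tube EM σ p₀) a k)) y.1 v.1 := by
    intro v
    rw [(eventuallyEq_gco_invariantPart A hσ p₀ bM ha n hy k).fderiv_eq]
    have h1 := (((contDiffAt_fcp_gco hσ p₀ bM ha n hy k).differentiableAt (by simp)).hasFDerivAt.comp
      y (hasFDerivAt_fst (𝕜 := ℝ) (p := y))).fderiv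
    exact congrArg (fun T : EM × ℝ →L[ℝ] ℂ => T v) h1
  rw [hd, fco_tau A hσ p₀ bM hy, gco_invariantPart A hσ p₀ bM ha n hy]
  -- In base directions `τ_σ` vanishes and the claim is differentiation under the integral. In the
  -- fibre direction the invariant part has derivative zero, and the whole contribution `-i n` comes
  -- from `τ_σ`, matching integration by parts.
  rcases i with i | i
  · rw [tubeBasis_inl, hP.fderiv_fcp (isOpen_chartDom hσ p₀) n hy]
    simp
  · rw [tubeBasis_inr, hP.fcp_dir_snd (isOpen_chartDom hσ p₀) hy]
    simp

end PrincipalCircleBundle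

namespace PrincipalCircleBundle

variable {EM M EZ Z : Type*}
  [NormedAddCommGroup EM] [NormedSpace ℝ EM] [FiniteDimensional ℝ EM]
  [TopologicalSpace M] [ChartedSpace EM M]
  [NormedAddCommGroup EZ] [NormedSpace ℝ EZ] [TopologicalSpace Z] [ChartedSpace EZ Z]
  [MulAction Circle Z] {B : PrincipalCircleBundle EM M EZ Z}
  [IsManifold 𝓘(ℝ, EM) ∞ M] [IsManifold 𝓘(ℝ, EZ) ∞ Z] (A : Connection EZ Z)
  {σ : M → Z} {U : Set M} (hσ : B.IsLocalSection σ U) (p₀ : M)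
  {ι : Type*} [Fintype ι] (bM : Module.Basis ι ℝ EM)

include hσ in
theorem exists_tube {p : Z} (hp : B.proj p ∈ U) :
    ∃ (p₀ : M) (u : EM) (t : ℝ), u ∈ chartDom EM p₀ U ∧ tube EM σ p₀ (u, t) = p := by
  obtain ⟨hu, t, ht⟩ := exists_tube_eq hσ (B.proj p) hp (mem_extChartAt_source _)
  exact ⟨_, _, t, hu, ht⟩

/-! ### The bracket -/

include B in
theorem exists_dorfman [FiniteDimensional ℝ EZ] (H : Flux EZ Z) (a b : GSection EZ Z) :
    ∃ c : GSection EZ Z, ∀ p, c.1 p = dorfman H.form a.1 b.1 p := by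
  have := FiniteDimensional.complete ℝ EZ
  refine ⟨GSection.of (dorfman H.form a.1 b.1) fun p => ?_, fun p => rfl⟩
  obtain ⟨σ, U, p₀, u, hσ, hu, rfl, -⟩ := B.exists_tube_zero p
  let bM := Module.finBasis ℝ EM
  have hW := isOpen_chartDom hσ p₀
  have ha := fun k => perSmooth_gco hσ p₀ bM (GSection.smoothGAt a) k
  have hb := fun k => perSmooth_gco hσ p₀ bM (GSection.smoothGAt b) k
  refine ((isParam_tube hσ p₀).smoothGAt_iff (b := tubeBasis bM) ⟨hu, mem_univ _⟩ _).2 fun k => ?_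
  have h1 := contDiffAt_brk (fun i j k => contDiffAt_hco hσ p₀ (tubeBasis bM) H (y := (u, 0)) hu i j k)
    (fun k => (ha k).contDiffAt hW (y := (u, 0)) hu)
    (fun i k => ((ha k).dir hW (tubeBasis bM i)).contDiffAt hW (y := (u, 0)) hu)
    (fun k => (hb k).contDiffAt hW (y := (u, 0)) hu)
    (fun i k => ((hb k).dir hW (tubeBasis bM i)).contDiffAt hW (y := (u, 0)) hu) k
  refine h1.congr_of_eventuallyEq ?_
  filter_upwards [(hW.preimage continuous_fst).mem_nhds (show (u, (0 : ℝ)) ∈ _ from hu)] with y hy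
  exact (isParam_tube hσ p₀).gco_dorfman ⟨hy, mem_univ _⟩ H.form (GSection.smoothGAt a _)
    (GSection.smoothGAt b _) k

/-- Both brackets are `brk` in tube coordinates. On `Z` it is fed with components and derivatives as
functions of `t`; on `M` it is fed with their Fourier coefficients of indices `n` and `m - n`. The
convolution formula equates the sum over `n` with the `m`-th coefficient of the Dorfman bracket. -/
theorem isExoticBracket_PhiE [FiniteDimensional ℝ EZ] (H : Flux EZ Z) {a b c : GSection EZ Z}
    (hc : ∀ p, c.1 p = dorfman H.form a.1 b.1 p) :
    B.IsExoticBracket A H (B.PhiE A a) (B.PhiE A b) (B.PhiE A c) := by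
  have := FiniteDimensional.complete ℝ EZ
  intro m σ U hσ p hp
  obtain ⟨p₀, u, t, hu, rfl⟩ := exists_tube hσ hp
  let bM := Module.finBasis ℝ EM
  have hW := isOpen_chartDom hσ p₀
  have hP := isParam_tube hσ p₀
  have hy : ∀ t : ℝ, (u, t) ∈ chartDom EM p₀ U ×ˢ (univ : Set ℝ) := fun t => ⟨hu, mem_univ _⟩
  have sa := GSection.smoothGAt a
  have sb := GSection.smoothGAt b
  have ha := fun k => perSmooth_gco hσ p₀ bM sa k
  have hb := fun k => perSmooth_gco hσ p₀ bM sb k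
  refine (hasSum_iff_gcoL (b := tubeBasis bM) (tube_inv hσ p₀ hu t)).2 fun j => ?_
  have key := (fcSum_brk (hco (E := EZ) (tubeBasis bM) (tube EM σ p₀) H.alt (u, t))
    (fun k => (ha k).smoothPer hu)
    (fun i k => ((ha k).dir hW (tubeBasis bM i)).smoothPer hu) (fun k => (hb k).smoothPer hu)
    (fun i k => ((hb k).dir hW (tubeBasis bM i)).smoothPer hu) m j).sum
  have hg : ∀ s : ℝ, gco (E := EZ) (tubeBasis bM) (tube EM σ p₀) c.1 j (u, s) =
      brk (hco (E := EZ) (tubeBasis bM) (tube EM σ p₀) H.alt (u, t))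
        (fun k => gco (E := EZ) (tubeBasis bM) (tube EM σ p₀) a.1 k (u, s))
        (fun i k => fderiv ℝ (gco (E := EZ) (tubeBasis bM) (tube EM σ p₀) a.1 k) (u, s)
          (tubeBasis bM i))
        (fun k => gco (E := EZ) (tubeBasis bM) (tube EM σ p₀) b.1 k (u, s))
        (fun i k => fderiv ℝ (gco (E := EZ) (tubeBasis bM) (tube EM σ p₀) b.1 k) (u, s)
          (tubeBasis bM i)) j := by
    intro s
    refine (congrArg (gcoL (E := EZ) (tubeBasis bM) (tube EM σ p₀) (u, s) j)
      (hc (tube EM σ p₀ (u, s)))).trans ?_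
    refine (hP.gco_dorfman (hy s) H.form (sa _) (sb _) j).trans ?_
    -- Along the fibre the flux components are frozen at the given `t`, so that they can act as
    -- constants.
    have hs : hco (E := EZ) (tubeBasis bM) (tube EM σ p₀) H.alt (u, s)
        = hco (E := EZ) (tubeBasis bM) (tube EM σ p₀) H.alt (u, t) := by
      funext i j k
      rw [hco_shift hσ p₀ _ H hu s, hco_shift hσ p₀ _ H hu t]
    exact congrArg (fun h => brk h _ _ _ _ j) hs
  have hr := (gco_invariantPart A hσ p₀ bM (GSection.smoothGAt c) m (y := (u, t)) hu j).trans
    (congrArg (fc m) (funext hg))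
  rw [← hr] at key
  refine HasSum.congr_fun key fun n => ?_
  refine (hP.gco_derivedBracket (hy t) H.form (B.tau A σ) n (m - n)
    (smoothGAt_invariantPart A hσ p₀ sa n (y := (u, t)) hu)
    (smoothGAt_invariantPart A hσ p₀ sb (m - n) (y := (u, t)) hu) j).trans ?_
  have hcongr : ∀ {h : (Fin (Module.finrank ℝ EM) ⊕ Unit) → (Fin (Module.finrank ℝ EM) ⊕ Unit) → (Fin (Module.finrank ℝ EM) ⊕ Unit) → ℂ} {x x' z z' : (Fin (Module.finrank ℝ EM) ⊕ Unit) ⊕ (Fin (Module.finrank ℝ EM) ⊕ Unit) → ℂ} {dx dx' dz dz' : (Fin (Module.finrank ℝ EM) ⊕ Unit) → (Fin (Module.finrank ℝ EM) ⊕ Unit) ⊕ (Fin (Module.finrank ℝ EM) ⊕ Unit) → ℂ},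
      (∀ k, x k = x' k) → (∀ i k, dx i k = dx' i k) → (∀ k, z k = z' k) →
      (∀ i k, dz i k = dz' i k) → brk h x dx z dz j = brk h x' dx' z' dz' j := by
    intro h x x' z z' dx dx' dz dz' h1 h2 h3 h4
    rw [funext h1, funext fun i => funext (h2 i), funext h3, funext fun i => funext (h4 i)]
  exact hcongr (gco_invariantPart A hσ p₀ bM sa n (y := (u, t)) hu)
    (covariant_invariantPart A hσ p₀ bM sa n (y := (u, t)) hu)
    (gco_invariantPart A hσ p₀ bM sb (m - n) (y := (u, t)) hu)
    (covariant_invariantPart A hσ p₀ bM sb (m - n) (y := (u, t)) hu)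

/-- Limits are unique and `ψ` is injective, evaluated along a local section. -/
theorem IsExoticBracket.unique {A : Connection EZ Z} {H : Flux EZ Z} {c d e e' : ∀ n : ℤ, B.ESection n}
    (h : B.IsExoticBracket A H c d e) (h' : B.IsExoticBracket A H c d e') : e = e' := by
  funext k
  apply Subtype.ext
  refine tensor_ext fun σ U hσ x hx => ?_
  have hp := hσ.proj_eq x hx
  have hx' : B.proj (σ x) ∈ U := by rwa [hp]
  have h1 : mpsi B A (σ x) (B.ecoeff (e k).1 σ (B.proj (σ x)))
      = mpsi B A (σ x) (B.ecoeff (e' k).1 σ (B.proj (σ x))) :=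
    HasSum.unique (α := Cplx EZ × (EZ →L[ℝ] ℂ)) (h k σ U hσ (σ x) hx') (h' k σ U hσ (σ x) hx')
  have h2 := congrArg (psiInv B A (σ x)) h1
  rw [psiInv_mpsi, psiInv_mpsi, hp] at h2
  exact h2

/-! ### The pairing -/

/-- The pairing in components. -/
def pairCo (x z : (ι ⊕ Unit) ⊕ (ι ⊕ Unit) → ℂ) : ℂ :=
  ∑ i, z (.inr (.inl i)) * x (.inl (.inl i)) + ∑ i, x (.inr (.inl i)) * z (.inl (.inl i))
    + x (.inr (.inr ())) * z (.inl (.inr ())) + x (.inl (.inr ())) * z (.inr (.inr ()))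

theorem fcSum_pairCo {x z : (ι ⊕ Unit) ⊕ (ι ⊕ Unit) → ℝ → ℂ} (hx : ∀ k, SmoothPer (x k))
    (hz : ∀ k, SmoothPer (z k)) (m : ℤ) :
    FcSum m (fun n => pairCo (fun k => fc n (x k)) (fun k => fc (m - n) (z k)))
      (fun t => pairCo (fun k => x k t) (fun k => z k t)) :=
  (((FcSum.finsetSum _ fun i => FcSum.mul' m (hx _) (hz _)).add
    (FcSum.finsetSum _ fun i => FcSum.mul m (hx _) (hz _))).add
    (FcSum.mul m (hx _) (hz _))).add (FcSum.mul m (hx _) (hz _))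

theorem pairingE_eq_pairCo {Φ : EM → M} {u : EM} (hinv : (dM EM EM Φ u).IsInvertible)
    (e e' : EF EM) : pairingE (x := Φ u) e e' =
      pairCo (fun k => ecoL bM Φ u k e) (fun k => ecoL bM Φ u k e') := by
  have h1 := eval_eq_sum (b := bM) hinv e'.2.2.1 e.1
  have h2 := eval_eq_sum (b := bM) hinv e.2.2.1 e'.1
  exact congrArg₂ (fun r s : ℂ => r + s + e.2.2.2 * e'.2.1 + e.2.1 * e'.2.2.2) h1 h2

/-- `ψ` is an isometry: `π^*ξ(v) = 0`, `A(h(X)) = 0`, `A(v) = 1` and `π^*ξ(h(X)) = ξ(X)`. -/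
theorem pairing_mpsi (p : Z) (e e' : EF EM) :
    pairing (E := EZ) (p := p) (mpsi B A p e) (mpsi B A p e') = pairingE (x := B.proj p) e e' := by
  have hg := cov_gen A p
  have hpg : dM EZ EM B.proj p (gen EZ p) = 0 := B.proj_generator p
  have h : ∀ e e' : EF EM, Cplx.eval (V := EZ) (mpsi B A p e).2 (mpsi B A p e').1 =
      Cplx.eval (V := EM) e.2.2.1 e'.1 + e.2.2.2 * e'.2.1 := by
    intro e e'
    simp [mpsi, Cplx.map, Cplx.eval_def, proj_hlift, form_hlift, hpg, hg]
    conv_rhs => rw [← Complex.re_add_im e'.2.1]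
    linear_combination (-e.2.2.2 * e'.2.1.re) * Complex.I_sq
  refine (congrArg₂ (fun r s : ℂ => r + s) (h e e') (h e' e)).trans ?_
  change _ = Cplx.eval (V := EM) e'.2.2.1 e.1 + Cplx.eval (V := EM) e.2.2.1 e'.1
    + e.2.2.2 * e'.2.1 + e.2.1 * e'.2.2.2
  ring

include hσ in
theorem pairing_tube (a b : ∀ p : Z, GTan EZ p) {y : EM × ℝ} (hy : y.1 ∈ chartDom EM p₀ U) :
    pairing (a (tube EM σ p₀ y)) (b (tube EM σ p₀ y)) =
      pairCo (fun k => ecoZ A p₀ bM B σ a k y) (fun k => ecoZ A p₀ bM B σ b k y) := by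
  refine Eq.trans ?_ (pairingE_eq_pairCo bM ((isParam_base hσ p₀).isInvertible hy) _ _)
  have h1 := pairing_mpsi (B := B) A (tube EM σ p₀ y)
    (psiInv B A (tube EM σ p₀ y) (a (tube EM σ p₀ y)))
    (psiInv B A (tube EM σ p₀ y) (b (tube EM σ p₀ y)))
  exact (congrArg₂ (fun g g' : Cplx EZ × (EZ →L[ℝ] ℂ) =>
    pairing (E := EZ) (p := tube EM σ p₀ y) g g') (mpsi_psiInv B A _ _)
      (mpsi_psiInv B A _ _)).symm.trans h1

variable (B) in
theorem contMDiff_of_tube {f : Z → ℂ} (h : ∀ (σ : M → Z) (U : Set M), B.IsLocalSection σ U →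
    ∀ (p₀ : M) (y : EM × ℝ), y.1 ∈ chartDom EM p₀ U →
      ContDiffAt ℝ ∞ (fun y => f (tube EM σ p₀ y)) y) :
    ContMDiff 𝓘(ℝ, EZ) 𝓘(ℝ, ℂ) ∞ f := by
  intro p
  obtain ⟨σ, U, p₀, u, hσ, hu, rfl, -⟩ := B.exists_tube_zero p
  exact ((isParam_tube hσ p₀).contMDiffAt_iff (y := (u, 0)) ⟨hu, mem_univ _⟩).2
    (h σ U hσ p₀ (u, 0) hu)

-- The connection enters only as a tool: its frame makes the pairing a polynomial in smooth
-- components.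
include A B in
theorem exists_pairing (a b : GSection EZ Z) :
    ∃ f : SmoothFun EZ Z, ∀ p, f.1 p = pairing (a.1 p) (b.1 p) := by
  refine ⟨⟨fun p => pairing (a.1 p) (b.1 p), B.contMDiff_of_tube fun σ U hσ p₀ y hy => ?_⟩,
    fun p => rfl⟩
  let bM := Module.finBasis ℝ EM
  have hW := isOpen_chartDom hσ p₀
  have ha := fun k => (perSmooth_ecoZ A hσ p₀ bM (GSection.smoothGAt a) k).contDiffAt hW hy
  have hb := fun k => (perSmooth_ecoZ A hσ p₀ bM (GSection.smoothGAt b) k).contDiffAt hW hy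
  have h1 : ContDiffAt ℝ ∞ (fun y => pairCo (fun k => ecoZ A p₀ bM B σ a.1 k y)
      (fun k => ecoZ A p₀ bM B σ b.1 k y)) y :=
    (((ContDiffAt.sum fun i _ => (hb _).mul (ha _)).add
      (ContDiffAt.sum fun i _ => (ha _).mul (hb _))).add ((ha _).mul (hb _))).add ((ha _).mul (hb _))
  refine h1.congr_of_eventuallyEq ?_
  filter_upwards [(hW.preimage continuous_fst).mem_nhds hy] with y' hy'
  exact pairing_tube A hσ p₀ bM a.1 b.1 hy'

/-- Since `ψ` is an isometry, the pairing on `Z` is a bilinear expression with constant coefficients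
in the components on the base, and the convolution theorem applies. -/
theorem isExoticPairing_PhiE {a b : GSection EZ Z} {f : SmoothFun EZ Z}
    (hf : ∀ p, f.1 p = pairing (a.1 p) (b.1 p)) :
    B.IsExoticPairing (B.PhiE A a) (B.PhiE A b) (B.PhiL f) := by
  rintro m x ⟨p, rfl⟩
  obtain ⟨σ, U, p₀, u, hσ, hu, rfl, -⟩ := B.exists_tube_zero p
  let bM := Module.finBasis ℝ EM
  have hinv := (isParam_base hσ p₀).isInvertible hu
  have key := (fcSum_pairCo
    (fun k => (perSmooth_ecoZ A hσ p₀ bM (GSection.smoothGAt a) k).smoothPer hu)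
    (fun k => (perSmooth_ecoZ A hσ p₀ bM (GSection.smoothGAt b) k).smoothPer hu) m).sum
  have hr : ((B.PhiL f m).1 (B.proj (tube EM σ p₀ (u, 0)))).1 ⟨tube EM σ p₀ (u, 0), rfl⟩ =
      fcp m (fun y => f.1 (tube EM σ p₀ y)) u := by
    rw [apply_tube hσ p₀ _ hu, expI_zero_right, one_mul, coeff_PhiL hσ p₀ f m hu]
  have hr' := hr.trans (congrArg (fc m) (funext fun t => (hf _).trans
      (pairing_tube A hσ p₀ bM a.1 b.1 (y := (u, t)) hu)))
  rw [← hr'] at key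
  refine HasSum.congr_fun key fun n => ?_
  have hv : ∀ (c : GSection EZ Z) (n : ℤ), val (B.PhiE A c n).1 (tube EM σ p₀ (u, 0)) =
      B.ecoeff (B.PhiE A c n).1 σ ((extChartAt 𝓘(ℝ, EM) p₀).symm u) := by
    intro c n
    rw [val_tube hσ p₀ _ hu, expI_zero_right, one_smul]
  have h1 := congrArg₂ (fun e e' : EF EM => pairingE (x := B.proj (tube EM σ p₀ (u, 0))) e e')
    (hv a n) (hv b (m - n))
  refine h1.trans ((pairingE_eq_pairCo bM hinv _ _).trans ?_)
  exact congrArg₂ pairCo (funext fun k => ecoM_PhiE A hσ p₀ bM a n hu k)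
    (funext fun k => ecoM_PhiE A hσ p₀ bM b (m - n) hu k)

theorem IsExoticPairing.unique {c d : ∀ n : ℤ, B.ESection n} {h h' : ∀ n : ℤ, B.LSection n}
    (H : B.IsExoticPairing c d h) (H' : B.IsExoticPairing c d h') : h = h' := by
  funext k
  apply Subtype.ext
  funext x
  apply Subtype.ext
  funext p
  exact (H k x p).unique (H' k x p)

end PrincipalCircleBundle

/-! ### Weights and single Fourier coefficients. -/

section Weights

variable {E : Type*} [NormedAddCommGroup E] [NormedSpace ℝ E] {W : Set E} {G : E × ℝ → ℂ}

theorem SmoothPer.eq_zero {g : ℝ → ℂ} (hg : SmoothPer g) (h : ∀ m : ℤ, fc m g = 0) (t : ℝ) :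
    g t = 0 := by
  have h1 := hg.hasSum t
  simp only [h, zero_mul] at h1
  exact h1.unique hasSum_zero

/-- The function `-i ∂_t G + n G` has `m`-th coefficient `(n - m)` times that of `G`. It vanishes
identically exactly when all its coefficients do, and `n - m` is invertible for `m ≠ n`. -/
theorem PerSmooth.weight_iff (h : PerSmooth W G) (hW : IsOpen W) {u : E} (hu : u ∈ W) (n : ℤ) :
    (∀ t, -Complex.I * fderiv ℝ G (u, t) (0, 1) = ((-n : ℤ) : ℂ) * G (u, t)) ↔
      ∀ m ≠ n, fcp m G u = 0 := by
  have h1 := h.smoothPer hu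
  have h2 := (h.dir hW (0, 1)).smoothPer hu
  have hs : SmoothPer fun t => -Complex.I * fderiv ℝ G (u, t) (0, 1) + n * G (u, t) :=
    ⟨(contDiff_const.mul h2.smooth).add (contDiff_const.mul h1.smooth), fun t => by
      simp only [h1.per t, h2.per t]⟩
  have hf : ∀ m : ℤ, fc m (fun t => -Complex.I * fderiv ℝ G (u, t) (0, 1) + n * G (u, t))
      = (n - m) * fcp m G u := by
    intro m
    have hc1 := h1.continuous
    have hc2 := h2.continuous
    rw [fc_add m (f := fun t => -Complex.I * fderiv ℝ G (u, t) (0, 1))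
      (g := fun t => n * G (u, t)) (continuous_const.mul hc2) (continuous_const.mul hc1), fc_const_mul, fc_const_mul]
    have h3 : fc m (fun t => fderiv ℝ G (u, t) (0, 1)) = -(m * Complex.I) * fc m fun t => G (u, t) :=
      h.fcp_dir_snd hW hu m
    rw [h3, fcp]
    linear_combination m * (fc m fun t => G (u, t)) * Complex.I_sq
  have he : (∀ t, -Complex.I * fderiv ℝ G (u, t) (0, 1) = ((-n : ℤ) : ℂ) * G (u, t)) ↔
      ∀ t, -Complex.I * fderiv ℝ G (u, t) (0, 1) + n * G (u, t) = 0 := by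
    refine forall_congr' fun t => ?_
    rw [← sub_eq_zero, Int.cast_neg, neg_mul (n : ℂ), sub_neg_eq_add]
  rw [he]
  constructor
  · intro h0 m hm
    have h3 := hf m
    -- The zero function is written as `0 * 0` so that the rule for constant multiples shows its
    -- coefficients to vanish.
    rw [show (fun t => -Complex.I * fderiv ℝ G (u, t) (0, 1) + n * G (u, t)) = fun _ => 0 * 0 from
      funext fun t => (h0 t).trans (mul_zero 0).symm, fc_const_mul, zero_mul] at h3
    have h4 : (n - m : ℂ) ≠ 0 := sub_ne_zero.2 (by exact_mod_cast hm.symm)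
    exact (mul_eq_zero.1 h3.symm).resolve_left h4
  · intro h0 t
    refine hs.eq_zero (fun m => ?_) t
    rw [hf m]
    by_cases hm : m = n
    · rw [hm, sub_self, zero_mul]
    · rw [h0 m hm, mul_zero]

/-- Injectivity on a weight space holds because all other components take prescribed values;
surjectivity onto the component is asked for as `hs`. The family `z` will be zero. -/
theorem bijOn_component {V : Type*} {X : ℤ → Type*} {Φ : V → ∀ n, X n} {z : ∀ n, X n}
    (hΦ : Function.Injective Φ) {n : ℤ} {P : V → Prop} (hP : ∀ a, P a ↔ ∀ m ≠ n, Φ a m = z m)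
    (hs : ∀ c : X n, ∃ a, Φ a n = c ∧ ∀ m ≠ n, Φ a m = z m) :
    BijOn (fun a => Φ a n) {a | P a} univ := by
  refine ⟨fun _ _ => mem_univ _, fun a ha a' ha' h => hΦ (funext fun m => ?_), fun c _ => ?_⟩
  · by_cases hm : m = n
    · subst hm; exact h
    · rw [(hP a).1 ha m hm, (hP a').1 ha' m hm]
  · obtain ⟨a, ha, ha'⟩ := hs c
    exact ⟨a, (hP a).2 ha', ha⟩

end Weights

namespace PrincipalCircleBundle

variable {EM M EZ Z : Type*}
  [NormedAddCommGroup EM] [NormedSpace ℝ EM] [FiniteDimensional ℝ EM]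
  [TopologicalSpace M] [ChartedSpace EM M]
  [NormedAddCommGroup EZ] [NormedSpace ℝ EZ] [TopologicalSpace Z] [ChartedSpace EZ Z]
  [MulAction Circle Z] {B : PrincipalCircleBundle EM M EZ Z}
  [IsManifold 𝓘(ℝ, EM) ∞ M] [IsManifold 𝓘(ℝ, EZ) ∞ Z] (A : Connection EZ Z)
  {σ : M → Z} {U : Set M} (hσ : B.IsLocalSection σ U) (p₀ : M)
  {ι : Type*} [Fintype ι] (bM : Module.Basis ι ℝ EM)

/-! ### Weights -/

theorem ecoeff_zero {n : ℤ} (σ : M → Z) (x : M) :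
    B.ecoeff (0 : ∀ x, B.TensorL n (EFib EM) x) σ x = 0 := B.coeff_zero σ x

-- Vanishing of a coefficient does not depend on the frame, as `ψ` is a fibrewise isomorphism. The
-- coordinate frame of the tube is preferred because `L_v` is diagonal in it.
include bM in
theorem PhiE_eq_zero_iff (a : GSection EZ Z) (m : ℤ) : B.PhiE A a m = 0 ↔
    ∀ (σ : M → Z) (U : Set M), B.IsLocalSection σ U → ∀ p₀ : M, ∀ u ∈ chartDom EM p₀ U, ∀ k,
      fcp m (gco (E := EZ) (tubeBasis bM) (tube EM σ p₀) a.1 k) u = 0 := by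
  have sa := GSection.smoothGAt a
  constructor
  · intro h σ U hσ p₀ u hu k
    have h1 := gco_invariantPart A hσ p₀ bM sa m (y := (u, 0)) hu k
    have h2 : invariantPart A B σ m a.1 (tube EM σ p₀ (u, 0)) = 0 := by
      refine Eq.trans (congrArg (mpsi B A (tube EM σ p₀ (u, 0))) (?_ : _ = (0 : EF EM))) (map_zero _)
      have h3 : B.coefE A m a.1 = 0 := congrArg Subtype.val h
      rw [h3]
      exact ecoeff_zero σ _
    rw [← h1, gco, h2, map_zero]
  · intro h
    apply Subtype.ext
    refine tensor_ext fun σ U hσ => ?_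
    refine (forall_chartDom_iff EM U _).2 fun p₀ u hu => ?_
    have h1 : mpsi B A (tube EM σ p₀ (u, 0))
        (B.ecoeff (B.coefE A m a.1) σ (B.proj (tube EM σ p₀ (u, 0)))) = 0 := by
      refine gco_ext (b := tubeBasis bM) (tube_inv hσ p₀ hu 0) fun k => ?_
      rw [map_zero, ← h σ U hσ p₀ u hu k]
      exact gco_invariantPart A hσ p₀ bM sa m (y := (u, 0)) hu k
    have h2 := congrArg (psiInv B A (tube EM σ p₀ (u, 0))) h1
    rw [psiInv_mpsi, map_zero, proj_tube hσ p₀ (y := (u, 0)) hu] at h2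
    exact h2.trans (ecoeff_zero (n := m) σ _).symm

theorem PhiL_eq_zero_iff (f : SmoothFun EZ Z) (m : ℤ) : B.PhiL f m = 0 ↔
    ∀ (σ : M → Z) (U : Set M), B.IsLocalSection σ U → ∀ p₀ : M, ∀ u ∈ chartDom EM p₀ U,
      fcp m (fun y => f.1 (tube EM σ p₀ y)) u = 0 := by
  constructor
  · intro h σ U hσ p₀ u hu
    rw [← coeff_PhiL hσ p₀ f m hu, h]
    exact B.coeff_zero σ _
  · intro h
    apply Subtype.ext
    refine tensor_ext fun σ U hσ => ?_
    refine (forall_chartDom_iff EM U _).2 fun p₀ u hu => ?_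
    rw [coeff_PhiL hσ p₀ f m hu, h σ U hσ p₀ u hu]
    exact (B.coeff_zero (n := m) (V := fun _ => ℂ) σ _).symm

include hσ in
theorem vco_vertical {y : EM × ℝ} (hy : y.1 ∈ chartDom EM p₀ U) (k : ι ⊕ Unit) :
    vco (E := EZ) (tubeBasis bM) (tube EM σ p₀) (vertical EZ) k y
      = -(Complex.I * (tubeBasis bM k).2) := by
  classical
  obtain ⟨u, t⟩ := y
  have h1 := dM_tube_snd hσ p₀ hy t
  have h2 : vco (E := EZ) (tubeBasis bM) (tube EM σ p₀) (vertical EZ) k (u, t) =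
      Cplx.eval (V := EZ) (coframe (tubeBasis bM) (tube EM σ p₀) k (u, t))
        (Cplx.mk 0 (-gen EZ (tube EM σ p₀ (u, t)))) := rfl
  have h3 := coframe_frame (b := tubeBasis bM) (tube_inv hσ p₀ hy t) k (.inr ())
  rw [tubeBasis_inr, h1] at h3
  rw [h2, Cplx.eval_def]
  simp only [Cplx.re_mk, Cplx.im_mk, map_zero, map_neg, h3, zero_add]
  rcases k with k | k <;> simp

include hσ in
theorem smoothVecAt_vertical {y : EM × ℝ} (hy : y.1 ∈ chartDom EM p₀ U) :
    SmoothVecAt EZ (fun p : Z => (vertical EZ p).re) (tube EM σ p₀ y) ∧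
      SmoothVecAt EZ (fun p : Z => (vertical EZ p).im) (tube EM σ p₀ y) := by
  refine ((isParam_tube hσ p₀).smooth_vco_iff (b := tubeBasis (Module.finBasis ℝ EM))
    ⟨hy, mem_univ _⟩ _).2 fun k => ?_
  refine (contDiffAt_const (c := -(Complex.I *
    ((tubeBasis (Module.finBasis ℝ EM) k).2 : ℂ)))).congr_of_eventuallyEq ?_
  filter_upwards [((isOpen_chartDom hσ p₀).preimage continuous_fst).mem_nhds hy] with y' hy'
  exact vco_vertical hσ p₀ _ hy' k

include hσ in
theorem fderiv_vco_vertical {y : EM × ℝ} (hy : y.1 ∈ chartDom EM p₀ U) (k : ι ⊕ Unit) :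
    fderiv ℝ (vco (E := EZ) (tubeBasis bM) (tube EM σ p₀) (vertical EZ) k) y = 0 := by
  have h1 : vco (E := EZ) (tubeBasis bM) (tube EM σ p₀) (vertical EZ) k =ᶠ[𝓝 y]
      fun _ => -(Complex.I * (tubeBasis bM k).2) := by
    filter_upwards [((isOpen_chartDom hσ p₀).preimage continuous_fst).mem_nhds hy] with y' hy'
    exact vco_vertical hσ p₀ _ hy' k
  rw [h1.fderiv_eq, fderiv_const_apply]

-- Since `v = -i ∂_t` has constant components, `L_v` acts on each component separately. For forms,
-- Cartan's formula gives `-i (∂_t α_j - ∂_j α_t) - i ∂_j α_t`, and the terms in `α_t` cancel.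
include hσ in
theorem gco_lieG_vertical [CompleteSpace EZ] {a : ∀ p : Z, GTan EZ p} (ha : ∀ p, SmoothGAt a p)
    {y : EM × ℝ} (hy : y.1 ∈ chartDom EM p₀ U) (k : (ι ⊕ Unit) ⊕ (ι ⊕ Unit)) :
    gco (E := EZ) (tubeBasis bM) (tube EM σ p₀) (lieG (vertical EZ) a) k y =
      -Complex.I * fderiv ℝ (gco (E := EZ) (tubeBasis bM) (tube EM σ p₀) a k) y (0, 1) := by
  have hP := isParam_tube hσ p₀
  have hy' : y ∈ chartDom EM p₀ U ×ˢ (univ : Set ℝ) := ⟨hy, mem_univ _⟩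
  have hv := smoothVecAt_vertical hσ p₀ hy
  have hsum : ∀ (x : ι ⊕ Unit → ℂ), ∑ i, -(Complex.I * ((tubeBasis bM i).2 : ℂ)) * x i
      = -Complex.I * x (.inr ()) := by
    intro x
    simp [Fintype.sum_sum_type]
  rcases k with j | j
  · refine (hP.vco_lieC (b := tubeBasis bM) hy' hv ⟨(ha _).re, (ha _).im⟩ j).trans ?_
    simp only [vco_vertical hσ p₀ bM hy, fderiv_vco_vertical hσ p₀ bM hy, zero_apply,
      mul_zero, sub_zero]
    refine (hsum _).trans ?_
    rw [tubeBasis_inr]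
    rfl
  · have h1 := hP.contract₂_dForm (b := tubeBasis bM) hy' (ha _).form
      (vertical EZ (tube EM σ p₀ y)) j _ rfl
    have h2 := hP.dFun_eval (b := tubeBasis bM) hy' (ha _).form hv j
    refine (congrArg₂ (fun r s : ℂ => r + s) h1 h2).trans ?_
    have h3 : ∀ i, Cplx.eval (V := EZ) (coframe (tubeBasis bM) (tube EM σ p₀) i y)
        (vertical EZ (tube EM σ p₀ y)) = -(Complex.I * ((tubeBasis bM i).2 : ℂ)) :=
      vco_vertical hσ p₀ bM hy
    simp only [h3, vco_vertical hσ p₀ bM hy, fderiv_vco_vertical hσ p₀ bM hy, zero_apply,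
      mul_zero, add_zero]
    rw [hsum]
    simp only [mul_comm (fderiv ℝ _ y (tubeBasis bM j)), hsum]
    rw [tubeBasis_inr]
    change _ = -Complex.I * fderiv ℝ (fco (E := EZ) (tubeBasis bM) (tube EM σ p₀)
      (fun p => (a p).2) j) y (0, 1)
    ring

/-- Applies the scalar criterion to each component on each fibre; the fibre must be treated as a
whole since Fourier coefficients involve all `t`. -/
theorem hasWeight_iff [FiniteDimensional ℝ EZ] (n : ℤ) (a : GSection EZ Z) :
    HasWeight (-n) a ↔ ∀ m ≠ n, B.PhiE A a m = 0 := by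
  have := FiniteDimensional.complete ℝ EZ
  let bM := Module.finBasis ℝ EM
  have sa := GSection.smoothGAt a
  have hP := fun {σ U} (hσ : B.IsLocalSection σ U) (p₀ : M) k => perSmooth_gco hσ p₀ bM sa k
  have key : ∀ (σ : M → Z) (U : Set M) (hσ : B.IsLocalSection σ U) (p₀ : M) (u : EM)
      (hu : u ∈ chartDom EM p₀ U),
      (∀ t, lieG (vertical EZ) a.1 (tube EM σ p₀ (u, t))
        = ((-n : ℤ) : ℂ) • a.1 (tube EM σ p₀ (u, t))) ↔
      ∀ k, ∀ m ≠ n, fcp m (gco (E := EZ) (tubeBasis bM) (tube EM σ p₀) a.1 k) u = 0 := by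
    intro σ U hσ p₀ u hu
    have h1 : ∀ k, _ := fun k => (hP hσ p₀ k).weight_iff (isOpen_chartDom hσ p₀) hu n
    have h2 : ∀ t, lieG (vertical EZ) a.1 (tube EM σ p₀ (u, t))
        = ((-n : ℤ) : ℂ) • a.1 (tube EM σ p₀ (u, t)) ↔ ∀ k, -Complex.I *
          fderiv ℝ (gco (E := EZ) (tubeBasis bM) (tube EM σ p₀) a.1 k) (u, t) (0, 1)
          = ((-n : ℤ) : ℂ) * gco (E := EZ) (tubeBasis bM) (tube EM σ p₀) a.1 k (u, t) := by
      intro t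
      have h3 : ∀ k, gcoL (E := EZ) (tubeBasis bM) (tube EM σ p₀) (u, t) k
          (((-n : ℤ) : ℂ) • a.1 (tube EM σ p₀ (u, t))) = ((-n : ℤ) : ℂ)
            * gco (E := EZ) (tubeBasis bM) (tube EM σ p₀) a.1 k (u, t) := fun k =>
        (gcoL (E := EZ) (tubeBasis bM) (tube EM σ p₀) (u, t) k).map_smul _ _
      constructor
      · intro h k
        rw [← gco_lieG_vertical hσ p₀ bM sa (y := (u, t)) hu k, ← h3 k]
        exact congrArg (gcoL (E := EZ) (tubeBasis bM) (tube EM σ p₀) (u, t) k) h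
      · intro h
        refine gco_ext (b := tubeBasis bM) (tube_inv hσ p₀ hu t) fun k => ?_
        exact (gco_lieG_vertical hσ p₀ bM sa (y := (u, t)) hu k).trans ((h k).trans (h3 k).symm)
    rw [forall_congr' h2, forall_comm]
    exact forall_congr' h1
  constructor
  · intro h m hm
    exact (PhiE_eq_zero_iff A bM a m).2 fun σ U hσ p₀ u hu k =>
      (key σ U hσ p₀ u hu).1 (fun t => h _) k m hm
  · intro h p
    obtain ⟨σ, U, p₀, u, hσ, hu, rfl, -⟩ := B.exists_tube_zero p
    exact (key σ U hσ p₀ u hu).2 (fun k m hm =>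
      (PhiE_eq_zero_iff A bM a m).1 (h m hm) σ U hσ p₀ u hu k) 0

include hσ in
theorem eval_dFun_tube (f : SmoothFun EZ Z) (x : Z → Cplx EZ) {y : EM × ℝ}
    (hy : y.1 ∈ chartDom EM p₀ U) :
    Cplx.eval (V := EZ) (dFun (E := EZ) f.1 (tube EM σ p₀ y)) (x (tube EM σ p₀ y)) =
      ∑ k, fderiv ℝ (fun y => f.1 (tube EM σ p₀ y)) y (tubeBasis bM k)
        * vco (E := EZ) (tubeBasis bM) (tube EM σ p₀) x k y := by
  have hP := isParam_tube hσ p₀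
  have hy' : y ∈ chartDom EM p₀ U ×ˢ (univ : Set ℝ) := ⟨hy, mem_univ _⟩
  refine (eval_comp (b := tubeBasis bM) hP (fun p => dFun (E := EZ) f.1 p) x hy').trans ?_
  refine Finset.sum_congr rfl fun k _ => ?_
  exact congrArg (fun r : ℂ => r * vco (E := EZ) (tubeBasis bM) (tube EM σ p₀) x k y) (hP.dFun_apply hy' (f.2 _) (tubeBasis bM k))

theorem funHasWeight_iff (n : ℤ) (f : SmoothFun EZ Z) :
    FunHasWeight (-n) f ↔ ∀ m ≠ n, B.PhiL f m = 0 := by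
  let bM := Module.finBasis ℝ EM
  have key : ∀ (σ : M → Z) (U : Set M) (hσ : B.IsLocalSection σ U) (p₀ : M) (u : EM)
      (hu : u ∈ chartDom EM p₀ U),
      (∀ t, Cplx.eval (dFun f.1 (tube EM σ p₀ (u, t))) (vertical EZ (tube EM σ p₀ (u, t)))
        = ((-n : ℤ) : ℂ) * f.1 (tube EM σ p₀ (u, t))) ↔
      ∀ m ≠ n, fcp m (fun y => f.1 (tube EM σ p₀ y)) u = 0 := by
    intro σ U hσ p₀ u hu
    refine Iff.trans (forall_congr' fun t => ?_)
      ((perSmooth_fun hσ p₀ f.2).weight_iff (isOpen_chartDom hσ p₀) hu n)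
    have h1 := eval_dFun_tube hσ p₀ bM f (vertical EZ) (y := (u, t)) hu
    simp only [vco_vertical hσ p₀ bM (y := (u, t)) hu] at h1
    have h2 : ∑ k, fderiv ℝ (fun y => f.1 (tube EM σ p₀ y)) (u, t) (tubeBasis bM k)
        * -(Complex.I * ((tubeBasis bM k).2 : ℂ))
        = -Complex.I * fderiv ℝ (fun y => f.1 (tube EM σ p₀ y)) (u, t) (0, 1) := by
      simp [Fintype.sum_sum_type, mul_comm]
    exact Eq.congr_left (h1.trans h2)
  constructor
  · intro h m hm
    exact (PhiL_eq_zero_iff f m).2 fun σ U hσ p₀ u hu =>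
      (key σ U hσ p₀ u hu).1 (fun t => h _) m hm
  · intro h p
    obtain ⟨σ, U, p₀, u, hσ, hu, rfl, -⟩ := B.exists_tube_zero p
    exact (key σ U hσ p₀ u hu).2 (fun m hm =>
      (PhiL_eq_zero_iff f m).1 (h m hm) σ U hσ p₀ u hu) 0

theorem rapidE_single (n : ℤ) (c : B.ESection n) : B.RapidE (Pi.single n c) := by
  let bM := Module.finBasis ℝ EM
  refine (RapidE_iff bM _).2 fun σ U hσ p₀ k => ?_
  refine Rapid.of_finite_support (isOpen_chartDom hσ p₀)
    (fun m => contDiffOn_ecoM hσ p₀ bM _ k) n fun m hm u hu => ?_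
  rw [Pi.single_eq_of_ne hm]
  exact (congrArg (ecoL bM (extChartAt 𝓘(ℝ, EM) p₀).symm u k) (ecoeff_zero (n := m) σ _)).trans
    (map_zero _)

theorem rapidL_single (n : ℤ) (c : B.LSection n) : B.RapidL (Pi.single n c) := by
  intro σ U hσ
  refine (rapid_fun_iff _ U).2 fun p₀ => ?_
  refine Rapid.of_finite_support (isOpen_chartDom hσ p₀)
    (fun m => contDiffOn_coeffL hσ p₀ _) n fun m hm u hu => ?_
  rw [Pi.single_eq_of_ne hm]
  exact B.coeff_zero σ _

/-! ### The anchor -/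

theorem exists_anchor (a : GSection EZ Z) :
    ∃ x : GSection EZ Z, ∀ p, x.1 p = (anchor (a.1 p), 0) :=
  ⟨⟨fun p => (anchor (a.1 p), 0), a.2.1, SmoothFormOn.zero _⟩, fun _ => rfl⟩

variable (EM) in
/-- The projection `(X, f, ξ, g) ↦ (X, f, 0, 0)`. -/
def anchorE : EF EM →ₗ[ℂ] EF EM where
  toFun e := (e.1, e.2.1, 0, 0)
  map_add' e e' := by simp
  map_smul' c e := by
    refine Prod.ext rfl (Prod.ext rfl (Prod.ext ?_ ?_))
    · exact (smul_zero (A := EM →L[ℝ] ℂ) c).symm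
    · simp

/-- `ψ⁻¹` carries the projection to the vector part into `(X, f, ξ, g) ↦ (X, f, 0, 0)`, a linear map
that commutes with vector-valued Fourier coefficients. -/
theorem PhiE_anchor {a x : GSection EZ Z} (hx : ∀ p, x.1 p = (anchor (a.1 p), 0)) (n : ℤ) (y : M)
    (p : {p : Z // B.proj p = y}) :
    ((B.PhiE A x n).1 y).1 p
      = ((((B.PhiE A a n).1 y).1 p).1, (((B.PhiE A a n).1 y).1 p).2.1, 0, 0) := by
  have h1 := fcV_map n (wCont_psiInv_orbit (B := B) A (GSection.smoothGAt a) p.1) (anchorE EM)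
  refine Eq.trans (congrArg (fcV (V := EF EM) n) (funext fun t => ?_)) h1
  refine (congrArg (psiInv B A (Circle.exp t • p.1)) (hx _)).trans ?_
  refine Prod.ext rfl (Prod.ext rfl (Prod.ext ?_ ?_))
  · exact ContinuousLinearMap.zero_comp _
  · have h2 : ∀ u : Cplx EZ, Cplx.eval (0 : EZ →L[ℝ] ℂ) u = 0 := fun u => by simp [Cplx.eval_def]
    exact h2 _

end PrincipalCircleBundle

namespace PrincipalCircleBundle

variable {EM M EZ Z : Type*}
  [NormedAddCommGroup EM] [NormedSpace ℝ EM] [FiniteDimensional ℝ EM]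
  [TopologicalSpace M] [ChartedSpace EM M]
  [NormedAddCommGroup EZ] [NormedSpace ℝ EZ] [TopologicalSpace Z] [ChartedSpace EZ Z]
  [MulAction Circle Z] {B : PrincipalCircleBundle EM M EZ Z}
  [IsManifold 𝓘(ℝ, EM) ∞ M] [IsManifold 𝓘(ℝ, EZ) ∞ Z] (A : Connection EZ Z)
  {σ : M → Z} {U : Set M} (hσ : B.IsLocalSection σ U) (p₀ : M)
  {ι : Type*} [Fintype ι] (bM : Module.Basis ι ℝ EM)

/-! ### The action on functions -/

include B in
theorem exists_action (a : GSection EZ Z) (f : SmoothFun EZ Z) :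
    ∃ g : SmoothFun EZ Z, ∀ p, g.1 p = Cplx.eval (dFun f.1 p) (anchor (a.1 p)) := by
  refine ⟨⟨fun p => Cplx.eval (dFun f.1 p) (anchor (a.1 p)),
    B.contMDiff_of_tube fun σ U hσ p₀ y hy => ?_⟩, fun p => rfl⟩
  let bM := Module.finBasis ℝ EM
  have hW := isOpen_chartDom hσ p₀
  have h1 : ContDiffAt ℝ ∞ (fun y => ∑ k, fderiv ℝ (fun y => f.1 (tube EM σ p₀ y)) y (tubeBasis bM k)
        * gco (E := EZ) (tubeBasis bM) (tube EM σ p₀) a.1 (.inl k) y) y :=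
    ContDiffAt.sum fun k _ =>
      (((perSmooth_fun hσ p₀ f.2).dir hW (tubeBasis bM k)).contDiffAt hW hy).mul
        ((perSmooth_gco hσ p₀ bM (GSection.smoothGAt a) _).contDiffAt hW hy)
  refine h1.congr_of_eventuallyEq ?_
  filter_upwards [(hW.preimage continuous_fst).mem_nhds hy] with y' hy'
  exact eval_dFun_tube hσ p₀ bM f (fun p => (a.1 p).1) hy'

include hσ in
theorem fcp_gco {a : ∀ p : Z, GTan EZ p} (ha : ∀ p, SmoothGAt a p) (n : ℤ) {u : EM}
    (hu : u ∈ chartDom EM p₀ U) (k : (ι ⊕ Unit) ⊕ (ι ⊕ Unit)) :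
    fcp n (gco (E := EZ) (tubeBasis bM) (tube EM σ p₀) a k) u =
      toZ (fun i => lform A p₀ bM σ i u)
        (fun k => ecoM bM p₀ (B.ecoeff (B.coefE A n a) σ) k u) k := by
  have h2 : (fun k => ecoM bM p₀ (B.ecoeff (B.coefE A n a) σ) k u) =
      fun k => fc n (fun t => ecoZ A p₀ bM B σ a k (u, t)) :=
    funext fun k => ecoM_coefE A hσ p₀ bM ha n hu k
  rw [h2, ← fc_toZ n _ fun k => ((perSmooth_ecoZ A hσ p₀ bM ha k).smoothPer hu).continuous]
  exact congrArg (fc n) (funext fun t => gco_eq A hσ p₀ bM a k (y := (u, t)) hu)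

include hσ in
theorem localForm_base {u : EM} (hu : u ∈ chartDom EM p₀ U) (w : EM) :
    (localForm A σ ((extChartAt 𝓘(ℝ, EM) p₀).symm u) : EM →L[ℝ] ℂ)
      (dM EM EM (extChartAt 𝓘(ℝ, EM) p₀).symm u w) = Complex.I * (tubeForm p₀ A σ u w : ℝ) := by
  have e3 := form_dM_tube hσ p₀ A hu 0 w 0
  rw [← dM_section hσ p₀ hu w, add_zero] at e3
  have e7 : tube EM σ p₀ (u, 0) = σ ((extChartAt 𝓘(ℝ, EM) p₀).symm u) := by simp [tube]
  rw [e7] at e3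
  exact congrArg (fun r : ℝ => Complex.I * (r : ℂ)) e3

include hσ in
theorem dFun_coeff (f : SmoothFun EZ Z) (m : ℤ) {u : EM} (hu : u ∈ chartDom EM p₀ U) (w : EM) :
    (dFun (E := EM) (B.coeff (B.PhiL f m).1 σ) ((extChartAt 𝓘(ℝ, EM) p₀).symm u) : EM →L[ℝ] ℂ)
        (dM EM EM (extChartAt 𝓘(ℝ, EM) p₀).symm u w) =
      fcp m (fun y => fderiv ℝ (fun y => f.1 (tube EM σ p₀ y)) y (w, 0)) u := by
  have hW := isOpen_chartDom hσ p₀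
  refine ((isParam_base hσ p₀).dFun_apply hu
    (((B.PhiL f m).2 σ U hσ).contMDiffAt (hσ.isOpen.mem_nhds hu.2)) w).trans ?_
  rw [← (perSmooth_fun hσ p₀ f.2).fderiv_fcp hW m hu w]
  have h1 : B.coeff (B.PhiL f m).1 σ ∘ (extChartAt 𝓘(ℝ, EM) p₀).symm =ᶠ[𝓝 u]
      fcp m (fun y => f.1 (tube EM σ p₀ y)) := by
    filter_upwards [hW.mem_nhds hu] with u' hu'
    exact coeff_PhiL hσ p₀ f m hu'
  exact congrArg (fun T : EM →L[ℝ] ℂ => T w) h1.fderiv_eq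

/-- On `Z` the action is `∑ (∂_k f) x_k`, a convolution after Fourier transform. In the frame of `E`
the fibre component of the vector is `-i f_n - ∑ ℓ_i X_i`; multiplied by `∂_t`, which acts as `-i (l
- n)`, it yields the term `-(l - n) f_n` of `D` and the connection term of `∇_X`. -/
theorem isExoticAction_PhiE {a : GSection EZ Z} {f g : SmoothFun EZ Z}
    (hg : ∀ p, g.1 p = Cplx.eval (dFun f.1 p) (anchor (a.1 p))) :
    B.IsExoticAction A (B.PhiE A a) (B.PhiL f) (B.PhiL g) := by
  intro l σ U hσ
  refine (forall_chartDom_iff EM U _).2 fun p₀ u hu => ?_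
  let bM := Module.finBasis ℝ EM
  have hW := isOpen_chartDom hσ p₀
  have sa := GSection.smoothGAt a
  have hF := perSmooth_fun hσ p₀ f.2
  have hinv := (isParam_base hσ p₀).isInvertible hu
  have key := (FcSum.finsetSum Finset.univ fun k => FcSum.mul' l
    ((perSmooth_gco hσ p₀ bM sa (.inl k)).smoothPer hu)
    ((hF.dir hW (tubeBasis bM k)).smoothPer hu)).sum
  have hr := (coeff_PhiL hσ p₀ g l hu).trans (congrArg (fc l) (funext fun t =>
    (hg (tube EM σ p₀ (u, t))).trans
      (eval_dFun_tube hσ p₀ bM f (fun p => (a.1 p).1) (y := (u, t)) hu)))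
  refine HasSum.congr_fun (hr.symm ▸ key) fun n => ?_
  let e : EF EM := B.ecoeff (B.PhiE A a n).1 σ ((extChartAt 𝓘(ℝ, EM) p₀).symm u)
  let c : ℂ := B.coeff (B.PhiL f (l - n)).1 σ ((extChartAt 𝓘(ℝ, EM) p₀).symm u)
  let η : EM →L[ℝ] ℂ := covFun (localForm A σ) (l - n) (B.coeff (B.PhiL f (l - n)).1 σ)
    ((extChartAt 𝓘(ℝ, EM) p₀).symm u)
  have hc : c = fcp (l - n) (fun y => f.1 (tube EM σ p₀ y)) u := coeff_PhiL hσ p₀ f (l - n) hu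
  have hη : ∀ i, η (dM EM EM (extChartAt 𝓘(ℝ, EM) p₀).symm u (bM i)) =
      fcp (l - n) (fun y => fderiv ℝ (fun y => f.1 (tube EM σ p₀ y)) y (bM i, 0)) u
        + ((l - n : ℤ) : ℂ) * c * (Complex.I * lform A p₀ bM σ i u) := fun i =>
    congrArg₂ (fun r s : ℂ => r + ((l - n : ℤ) : ℂ) * c * s)
      (dFun_coeff hσ p₀ f (l - n) hu (bM i)) (localForm_base A hσ p₀ hu (bM i))
  have h1 : pairingE (x := (extChartAt 𝓘(ℝ, EM) p₀).symm u) e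
      ((0, 0, η, -(((l - n : ℤ) : ℂ) * c)) : EF EM) =
      ∑ i, η (dM EM EM (extChartAt 𝓘(ℝ, EM) p₀).symm u (bM i))
        * ecoL bM (extChartAt 𝓘(ℝ, EM) p₀).symm u (.inl (.inl i)) e
        + e.2.1 * -(((l - n : ℤ) : ℂ) * c) := by
    have h2 := eval_eq_sum (b := bM) hinv η e.1
    have h3 : Cplx.eval (V := EM) e.2.2.1 0 = 0 := Cplx.eval_zero _
    refine (congrArg₂ (fun r s : ℂ => r + s + e.2.2.2 * 0 + e.2.1 * -(((l - n : ℤ) : ℂ) * c))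
      h2 h3).trans ?_
    rw [mul_zero, add_zero, add_zero]
    rfl
  refine h1.trans ?_
  have h4 := fcp_gco A hσ p₀ bM sa n hu
  have h5 := hF.fcp_dir_snd hW hu (l - n)
  have h6 : ∀ k, (fc n fun t => gco (E := EZ) (tubeBasis bM) (tube EM σ p₀) a.1 (.inl k) (u, t)) =
      toZ (fun i => lform A p₀ bM σ i u)
        (fun k => ecoL bM (extChartAt 𝓘(ℝ, EM) p₀).symm u k e) (.inl k) := fun k => h4 (.inl k)
  have h7 : (fc (l - n) fun t => fderiv ℝ (fun y => f.1 (tube EM σ p₀ y)) (u, t) (0, 1)) =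
      -(((l - n : ℤ) : ℂ) * Complex.I) * c := by rw [hc]; exact h5
  have h8 : e.2.1 = ecoL bM (extChartAt 𝓘(ℝ, EM) p₀).symm u (.inl (.inr ())) e := rfl
  simp only [h6, hη, h8, Fintype.sum_sum_type, tubeBasis_inl, tubeBasis_inr, toZ, Finset.univ_unique,
    Finset.sum_singleton, h7, fcp]
  simp only [add_mul, Finset.sum_add_distrib, mul_sub, Finset.mul_sum]
  rw [add_assoc]
  congr 1
  -- The terms containing `ℓ` cancel: the part `-ℓ_i X_i ∂_t` of the horizontal lift accounts for
  -- the local connection form in `∇`.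
  rw [eq_sub_iff_add_eq, add_assoc, add_left_comm, ← Finset.sum_add_distrib,
    Finset.sum_eq_zero fun i _ => by ring, add_zero]
  linear_combination (-(((l - n : ℤ) : ℂ) * c
    * ecoL bM (extChartAt 𝓘(ℝ, EM) p₀).symm u (.inl (.inr ())) e)) * Complex.I_sq

theorem IsExoticAction.unique {A : Connection EZ Z} {c : ∀ n : ℤ, B.ESection n}
    {k h h' : ∀ n : ℤ, B.LSection n}
    (H : B.IsExoticAction A c k h) (H' : B.IsExoticAction A c k h') : h = h' := by
  funext l
  apply Subtype.ext
  exact tensor_ext fun σ U hσ x hx => (H l σ U hσ x hx).unique (H' l σ U hσ x hx)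

/-! ### The weight spaces -/

theorem bijOn_PhiE [FiniteDimensional ℝ EZ] (n : ℤ) :
    BijOn (fun a => B.PhiE A a n) {a | HasWeight (-n) a} univ := by
  refine bijOn_component (X := fun m => B.ESection m) (Φ := fun a => B.PhiE A a) (z := fun m => 0)
    (PhiE_injective A) (P := HasWeight (-n)) (hasWeight_iff A n) fun c => ?_
  obtain ⟨a, ha⟩ := exists_PhiE_eq A (rapidE_single n c)
  refine ⟨a, ?_, fun m hm => ?_⟩
  · rw [ha, Pi.single_eq_same]
  · rw [ha, Pi.single_eq_of_ne hm]

theorem bijOn_PhiL (n : ℤ) : BijOn (fun f => B.PhiL f n) {f | FunHasWeight (-n) f} univ := by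
  refine bijOn_component (X := fun m => B.LSection m) (Φ := fun f => B.PhiL f) (z := fun m => 0)
    PhiL_injective (P := FunHasWeight (-n)) (funHasWeight_iff n) fun c => ?_
  obtain ⟨f, hf⟩ := exists_PhiL_eq (rapidL_single n c)
  refine ⟨f, ?_, fun m hm => ?_⟩
  · rw [hf, Pi.single_eq_same]
  · rw [hf, Pi.single_eq_of_ne hm]

/-! ### Transport of the structure -/

/-- The completed operations are relations asserting convergence. Existence of the sum together with
uniqueness turns the relation into equality with the transported bracket; the pairing and the action
are treated alike. -/
theorem exists_bracket_iff [FiniteDimensional ℝ EZ] (H : Flux EZ Z) (a b : GSection EZ Z) :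
    ∃ c : GSection EZ Z, (∀ p, c.1 p = dorfman H.form a.1 b.1 p) ∧
      ∀ e, B.IsExoticBracket A H (B.PhiE A a) (B.PhiE A b) e ↔ e = B.PhiE A c := by
  obtain ⟨c, hc⟩ := exists_dorfman (B := B) H a b
  have h := isExoticBracket_PhiE (B := B) A H hc
  refine ⟨c, hc, fun e => ⟨fun he => he.unique h, fun he => ?_⟩⟩
  subst he
  exact h

theorem exists_pairing_iff (a b : GSection EZ Z) :
    ∃ f : SmoothFun EZ Z, (∀ p, f.1 p = pairing (a.1 p) (b.1 p)) ∧
      ∀ h, B.IsExoticPairing (B.PhiE A a) (B.PhiE A b) h ↔ h = B.PhiL f := by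
  obtain ⟨f, hf⟩ := exists_pairing (B := B) A a b
  have h := isExoticPairing_PhiE (B := B) A hf
  refine ⟨f, hf, fun e => ⟨fun he => he.unique h, fun he => ?_⟩⟩
  subst he
  exact h

theorem exists_anchor_eq (a : GSection EZ Z) :
    ∃ x : GSection EZ Z, (∀ p, x.1 p = (anchor (a.1 p), 0)) ∧
      ∀ (n : ℤ) (y : M) (p : {p : Z // B.proj p = y}),
        ((B.PhiE A x n).1 y).1 p =
          ((((B.PhiE A a n).1 y).1 p).1, (((B.PhiE A a n).1 y).1 p).2.1, 0, 0) := by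
  obtain ⟨x, hx⟩ := exists_anchor a
  exact ⟨x, hx, fun n y p => PhiE_anchor A hx n y p⟩

theorem exists_action_iff (a : GSection EZ Z) (f : SmoothFun EZ Z) :
    ∃ g : SmoothFun EZ Z, (∀ p, g.1 p = Cplx.eval (dFun f.1 p) (anchor (a.1 p))) ∧
      ∀ h, B.IsExoticAction A (B.PhiE A a) (B.PhiL f) h ↔ h = B.PhiL g := by
  obtain ⟨g, hg⟩ := exists_action (B := B) a f
  have h := isExoticAction_PhiE (B := B) A hg
  refine ⟨g, hg, fun e => ⟨fun he => he.unique h, fun he => ?_⟩⟩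
  subst he
  exact h

end PrincipalCircleBundle

end ExoticCourant

/-! ### The proposition. -/

open ExoticCourant in
theorem proposition2p5
    {EM M EZ Z : Type*}
    [NormedAddCommGroup EM] [NormedSpace ℝ EM] [FiniteDimensional ℝ EM]
    [TopologicalSpace M] [ChartedSpace EM M] [IsManifold 𝓘(ℝ, EM) ∞ M]
    [T2Space M] [SecondCountableTopology M]
    [NormedAddCommGroup EZ] [NormedSpace ℝ EZ] [FiniteDimensional ℝ EZ]
    [TopologicalSpace Z] [ChartedSpace EZ Z] [IsManifold 𝓘(ℝ, EZ) ∞ Z]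
    [T2Space Z] [SecondCountableTopology Z] [MulAction Circle Z]
    (B : PrincipalCircleBundle EM M EZ Z) (A : Connection EZ Z) (H : Flux EZ Z) :
    ∃ (Φ : GSection EZ Z →ₗ[ℂ] (∀ n : ℤ, B.ESection n))
      (Φ₀ : SmoothFun EZ Z →ₗ[ℂ] (∀ n : ℤ, B.LSection n)),
      -- `Φ` and `Φ₀` are bijections onto the completed direct sums
      (Function.Injective Φ ∧ Set.range Φ = {c | B.RapidE c}) ∧
      (Function.Injective Φ₀ ∧ Set.range Φ₀ = {h | B.RapidL h}) ∧
      -- they are given by the fibrewise Fourier expansion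
      (∀ (a : GSection EZ Z) (p : Z),
        HasSum (fun n : ℤ => B.psi A p (((Φ a n).1 (B.proj p)).1 ⟨p, rfl⟩)) (a.1 p)) ∧
      (∀ (f : SmoothFun EZ Z) (p : Z),
        HasSum (fun n : ℤ => ((Φ₀ f n).1 (B.proj p)).1 ⟨p, rfl⟩) (f.1 p)) ∧
      -- they identify the weight space `-n` with the sections of the `n`-th summand
      (∀ n : ℤ, Set.BijOn (fun a => Φ a n) {a | HasWeight (-n) a} Set.univ ∧
        ∀ a : GSection EZ Z, HasWeight (-n) a ↔ ∀ m ≠ n, Φ a m = 0) ∧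
      (∀ n : ℤ, Set.BijOn (fun f => Φ₀ f n) {f | FunHasWeight (-n) f} Set.univ ∧
        ∀ f : SmoothFun EZ Z, FunHasWeight (-n) f ↔ ∀ m ≠ n, Φ₀ f m = 0) ∧
      -- bracket
      (∀ a b : GSection EZ Z, ∃ c : GSection EZ Z, (∀ p, c.1 p = dorfman H.form a.1 b.1 p) ∧
        ∀ e, B.IsExoticBracket A H (Φ a) (Φ b) e ↔ e = Φ c) ∧
      -- pairing
      (∀ a b : GSection EZ Z, ∃ f : SmoothFun EZ Z, (∀ p, f.1 p = pairing (a.1 p) (b.1 p)) ∧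
        ∀ h, B.IsExoticPairing (Φ a) (Φ b) h ↔ h = Φ₀ f) ∧
      -- anchor, as a map with values in `(TM ⊕ 1) ⊗ L^{⊗n}`
      (∀ a : GSection EZ Z, ∃ x : GSection EZ Z, (∀ p, x.1 p = (anchor (a.1 p), 0)) ∧
        ∀ (n : ℤ) (y : M) (p : {p : Z // B.proj p = y}),
          ((Φ x n).1 y).1 p = ((((Φ a n).1 y).1 p).1, (((Φ a n).1 y).1 p).2.1, 0, 0)) ∧
      -- anchor, as an action on functions
      (∀ (a : GSection EZ Z) (f : SmoothFun EZ Z), ∃ g : SmoothFun EZ Z,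
        (∀ p, g.1 p = Cplx.eval (dFun f.1 p) (anchor (a.1 p))) ∧
        ∀ h, B.IsExoticAction A (Φ a) (Φ₀ f) h ↔ h = Φ₀ g) := by
  open PrincipalCircleBundle in
  exact ⟨B.PhiE A, B.PhiL, ⟨PhiE_injective A, range_PhiE A⟩, ⟨PhiL_injective, range_PhiL⟩,
    hasSum_PhiE A, hasSum_PhiL, fun n => ⟨bijOn_PhiE A n, hasWeight_iff A n⟩,
    fun n => ⟨bijOn_PhiL n, funHasWeight_iff n⟩, exists_bracket_iff A H, exists_pairing_iff A,
    exists_anchor_eq A, exists_action_iff A⟩
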